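/- Let an entropy functional be a family $S=(S_n)_{n\ge 0}$ of real-valued functions, $S_n$ being continuous on the simplex $\Delta_n=\{P=(p_1,\dots,p_n): p_i\ge 0,\ \sum_i p_i=1\}$. A constraint system $C$ on $n$ states consists of finitely many equations $\sum_i \mathcal I_{k,i}\,p_i=c_k$ with real $\mathcal I_{k,i},c_k$; write $\Delta(C)\subseteq\Delta_n$ for its set of solutions. The maximum entropy principle (MEP) with $S$ selects the maximizers of $S_n$ on $\Delta(C)$ (the MaxEnt distributions). Two functionals are equivalent, $S\sim T$, if they have the same MaxEnt distributions for every $n$ and every $C$. MEP with $S$ satisfies the Shore–Johnson axioms if: 1. (Uniqueness) If $\Delta(C)\neq\emptyset$, there is exactly one MaxEnt distribution. 2. (Permutation invariance) Permuting the states in the constraints permutes the MaxEnt distribution accordingly. 3. (Subset independence) Let the states be partitioned into blocks $B_1,\dots,B_K$, with constraint systems $C_k$ on the states of $B_k$ and numbers $m_k$. If $P$ maximizes $S_n$ among the distributions with $P(B_k)=m_k$ for all $k$ and with conditional distribution $P(\cdot\mid B_k)\in\Delta(C_k)$ whenever $m_k>0$, then for each $k$ with $m_k>0$ the distribution $P(\cdot\mid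 B_k)$ is a MaxEnt distribution for $C_k$. 4. (System independence) Let $U$ and $V$ be MaxEnt distributions for constraint systems $C$ on $n$ states and $D$ on $m$ states. Then $(u_iv_j)_{ij}$ is the unique maximizer of $S_{nm}$ among the joint distributions $(p_{ij})$ under which the two systems are independent and which satisfy the constraints $C$ for the first system and $D$ for the second. 5. (Maximality) For $n\ge1$ the uniform distribution maximizes $S_n$ on $\Delta_n$. It satisfies strong system independence (SSI) if in 4 the product $(u_iv_j)$ is even the unique maximizer among all joint distributions $(p_{ij})$ satisfying the constraints $C$ and $D$, independent or not. For $q>0$, $q\ne1$, let $\mathcal U_q(P)=\bigl(\sum_i p_i^q\bigr)^{1/(1-q)}$, and let $\mathcal U_1(P)=\exp\bigl(-\sum_i p_i\ln p_i\bigr)$, with $0\ln 0=0$. **Theorem (Uffink).** For every such $S$, MEP with $S$ satisfies the Shore–Johnson axioms 1–5 if and only if $S\sim\mathcal U_q$ for some $q>0$ (the same $q$ for all $n$). Moreover, $f(\mathcal U_q)\sim\mathcal U_q$ for every $q>0$ and every strictly increasing $f:(0,\infty)\to\mathbb R$. Finally, MEP with $S$ satisfies axioms 1–5 and SSI if and only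 if $S$ is equivalent to the Shannon entropy $-\sum_i p_i\ln p_i$; and among the $\mathcal U_q$ with $q>0$, exactly $\mathcal U_1$ satisfies SSI. -/

import Mathlib

open scoped BigOperators

namespace MaxEntInference

/-- An entropy functional: for each number `n` of states, a real function of `P = (p_i)`.
Only its values on probability vectors are ever used. -/
abbrev EntropyFunctional : Type := (n : ℕ) → (Fin n → ℝ) → ℝ

/-- Real-valued and continuous on each simplex of probability vectors. -/
def IsContinuousEntropy (S : EntropyFunctional) : Prop :=
  ∀ n : ℕ, ContinuousOn (S n) (stdSimplex ℝ (Fin n))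

/-- Finitely many expectation-value constraints `∑ i, obs k i * p i = val k` on `n` states. -/
structure Constraints (n : ℕ) where
  num : ℕ
  obs : Fin num → Fin n → ℝ
  val : Fin num → ℝ

/-- The probability vectors that satisfy the constraints. -/
def Constraints.feasible {n : ℕ} (C : Constraints n) : Set (Fin n → ℝ) :=
  {p | p ∈ stdSimplex ℝ (Fin n) ∧ ∀ k, ∑ i, C.obs k i * p i = C.val k}

/-- `p` is a result of maximizing the entropy functional `S` over the set `A`. -/
def IsMaxEnt (S : EntropyFunctional) {n : ℕ} (A : Set (Fin n → ℝ)) (p : Fin n → ℝ) : Prop :=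
  p ∈ A ∧ ∀ p' ∈ A, S n p' ≤ S n p

/-- Equivalence of entropy functionals: the same MaxEnt distributions under all constraints. -/
def Equivalent (S T : EntropyFunctional) : Prop :=
  ∀ (n : ℕ) (C : Constraints n) (p : Fin n → ℝ),
    IsMaxEnt S C.feasible p ↔ IsMaxEnt T C.feasible p

/-! ### The Shore--Johnson axioms -/

/-- Uniqueness: under consistent constraints there is exactly one result. -/
def Uniqueness (S : EntropyFunctional) : Prop :=
  ∀ (n : ℕ) (C : Constraints n), C.feasible.Nonempty → ∃! p, IsMaxEnt S C.feasible p

/-- Permutation invariance: relabelling the states in the constraints relabels the result. -/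
def PermutationInvariance (S : EntropyFunctional) : Prop :=
  ∀ (n : ℕ) (σ : Equiv.Perm (Fin n)) (C : Constraints n) (p : Fin n → ℝ),
    IsMaxEnt S C.feasible p → IsMaxEnt S {x | x ∘ σ ∈ C.feasible} (p ∘ σ.symm)

/-- The states are split by `e` into `K` disjoint blocks, block `k` having `a k` states. The set of
full distributions that give block `k` the probability `m k` and whose conditional distribution on
each block of positive probability satisfies that block's constraints. -/
def blockFeasible {n K : ℕ} {a : Fin K → ℕ} (e : (Σ k, Fin (a k)) ≃ Fin n)
    (C : (k : Fin K) → Constraints (a k)) (m : Fin K → ℝ) : Set (Fin n → ℝ) :=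
  {p | p ∈ stdSimplex ℝ (Fin n) ∧ ∀ k, ∑ i, p (e ⟨k, i⟩) = m k ∧
    (0 < m k → (fun i => p (e ⟨k, i⟩) / m k) ∈ (C k).feasible)}

/-- Subset independence: the conditional distribution on a block that results from treating the full
distribution is the one that results from treating the block by itself. -/
def SubsetIndependence (S : EntropyFunctional) : Prop :=
  ∀ (n K : ℕ) (a : Fin K → ℕ) (e : (Σ k, Fin (a k)) ≃ Fin n)
    (C : (k : Fin K) → Constraints (a k)) (m : Fin K → ℝ) (p : Fin n → ℝ),
    IsMaxEnt S (blockFeasible e C m) p →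
      ∀ k, 0 < m k → IsMaxEnt S (C k).feasible (fun i => p (e ⟨k, i⟩) / m k)

/-- First marginal of a joint distribution, the joint states being numbered by `e`. -/
def marginalFst {n m N : ℕ} (e : Fin n × Fin m ≃ Fin N) (p : Fin N → ℝ) : Fin n → ℝ :=
  fun i => ∑ j, p (e (i, j))

/-- Second marginal of a joint distribution. -/
def marginalSnd {n m N : ℕ} (e : Fin n × Fin m ≃ Fin N) (p : Fin N → ℝ) : Fin m → ℝ :=
  fun j => ∑ i, p (e (i, j))

/-- The product distribution `p_{ij} = u_i v_j`. -/
def productDist {n m N : ℕ} (e : Fin n × Fin m ≃ Fin N) (u : Fin n → ℝ) (v : Fin m → ℝ) :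
    Fin N → ℝ :=
  fun s => u (e.symm s).1 * v (e.symm s).2

/-- The joint distributions satisfying the constraints `C` on the first system and `D` on the second,
that is, `∑_{ij} C.obs k i * p_{ij} = C.val k` and likewise for `D`. -/
def jointFeasible {n m N : ℕ} (e : Fin n × Fin m ≃ Fin N) (C : Constraints n) (D : Constraints m) :
    Set (Fin N → ℝ) :=
  {p | p ∈ stdSimplex ℝ (Fin N) ∧
    (∀ k, ∑ i, ∑ j, C.obs k i * p (e (i, j)) = C.val k) ∧
    (∀ k, ∑ i, ∑ j, D.obs k j * p (e (i, j)) = D.val k)}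

/-- The joint distributions for which the two systems are independent. -/
def independentJoint {n m N : ℕ} (e : Fin n × Fin m ≃ Fin N) : Set (Fin N → ℝ) :=
  {p | p = productDist e (marginalFst e p) (marginalSnd e p)}

/-- System independence: for two systems known to be independent, with separate constraints, treating
the joint distribution gives the same result as treating the two marginal distributions. -/
def SystemIndependence (S : EntropyFunctional) : Prop :=
  ∀ (n m N : ℕ) (e : Fin n × Fin m ≃ Fin N) (C : Constraints n) (D : Constraints m)
    (u : Fin n → ℝ) (v : Fin m → ℝ), IsMaxEnt S C.feasible u → IsMaxEnt S D.feasible v →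
      ∀ p, IsMaxEnt S (jointFeasible e C D ∩ independentJoint e) p ↔ p = productDist e u v

/-- Maximality: without any constraint the result is the uniform distribution. -/
def Maximality (S : EntropyFunctional) : Prop :=
  ∀ n : ℕ, 0 < n → IsMaxEnt S (stdSimplex ℝ (Fin n)) (fun _ => 1 / (n : ℝ))

/-- The five Shore--Johnson axioms for the maximization of `S`. -/
structure ShoreJohnson (S : EntropyFunctional) : Prop where
  uniqueness : Uniqueness S
  permutation : PermutationInvariance S
  subset : SubsetIndependence S
  system : SystemIndependence S
  maximality : Maximality S

/-- Strong system independence: under separate constraints on two systems, and with no information on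
their dependence, the joint result is the product of the two separate results. -/
def StrongSystemIndependence (S : EntropyFunctional) : Prop :=
  ∀ (n m N : ℕ) (e : Fin n × Fin m ≃ Fin N) (C : Constraints n) (D : Constraints m)
    (u : Fin n → ℝ) (v : Fin m → ℝ), IsMaxEnt S C.feasible u → IsMaxEnt S D.feasible v →
      ∀ p, IsMaxEnt S (jointFeasible e C D) p ↔ p = productDist e u v

/-! ### The entropies -/

/-- Shannon entropy `-∑ p_i log p_i`. -/
noncomputable def shannonEntropy : EntropyFunctional :=
  fun _ p => ∑ i, Real.negMulLog (p i)

/-- `U_q(P) = (∑ p_i ^ q) ^ (1 / (1 - q))`; at `q = 1` its limit, the exponential of the Shannon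
entropy. -/
noncomputable def entropyPower (q : ℝ) : EntropyFunctional :=
  fun n p => if q = 1 then Real.exp (shannonEntropy n p)
    else (∑ i, p i ^ q) ^ (1 / (1 - q))

end MaxEntInference

/-! Continuity, uniqueness, subset independence and maximality already force the family U_q;
conversely, every functional equivalent to some U_q satisfies all five axioms.

It is convenient to work with finite measures instead of distributions: `Opt S P W` expresses
optimality of P in the slice P + W at fixed mass. Subset independence and uniqueness let optimality
be restricted to, and extended from, subsets of the states. Call A and B balanced (`Bal`) if A ⊕ B
is optimal among the mixtures aA ⊕ bB. Balance is an equivalence relation, and every measure is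
balanced with exactly one point mass, whose size is the scale `eps` of the measure. (In the end eps
P = 1 / U_q(P) for probability vectors.) The scale of A ⊕ B depends only on the scales x, y of the
parts and on the proportion l of the masses. This defines a homogeneous, bisymmetric, continuous
`mean` M(l, x, y). An argument of Kolmogorov–Nagumo type makes M quasi-arithmetic, homogeneity
leaves only the generators ψ = `powGen r`, so that mass · ψ(eps P) = ∑ P_i ψ(P_i), and continuity at
a vertex gives r > -1.

The remaining task is to return from scales to maximization under arbitrary linear constraints.
Attach to each state of mass z_i a companion measure of scale z_i, with prescribed masses. Equality
of scales then says that S is maximal at z along every line on which the derivative at z of the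
strictly concave potential Φ = `pot r`, Φ' = ψ, vanishes (`Opt.of_stationary`). With at least three
states, a small step that increases Φ to first order can be bridged by two such tangent lines, so S
does not decrease along it (`eventually_ent_le`). Following the segment from a competitor to the
constrained maximizer of Φ shows that this maximizer also maximizes S, and uniqueness gives S ∼ Φ.
On the simplex Φ is an increasing function of U_q with q = r + 1.

For the converse, Φ is strictly concave, additive over states, and on a block of mass m equals m^q
Φ(conditional) plus a constant. Strong system independence for Shannon entropy is subadditivity. For
r ≠ 0 it fails, because Φ has nonzero derivative at some product distribution along a direction that
fixes both marginals. -/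

namespace MaxEntInference

/-! ### Slices of the simplex -/

theorem exists_constraints {n : ℕ} {κ : Type} [Fintype κ] (obs : κ → Fin n → ℝ) (val : κ → ℝ) :
    ∃ C : Constraints n, ∀ p, p ∈ C.feasible ↔
      p ∈ stdSimplex ℝ (Fin n) ∧ ∀ k, ∑ i, obs k i * p i = val k := by
  refine ⟨⟨Fintype.card κ, fun k => obs ((Fintype.equivFin κ).symm k),
    fun k => val ((Fintype.equivFin κ).symm k)⟩, fun p => and_congr_right fun _ => ?_⟩
  exact ⟨fun h k => by simpa using h (Fintype.equivFin κ k), fun h k => h _⟩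

/-- The functionals are the coordinates of the quotient map by W. This allows subspaces to replace
lists of observables. -/
theorem Submodule.exists_functionals {ι : Type} [Fintype ι] (W : Submodule ℝ (ι → ℝ)) :
    ∃ (m : ℕ) (obs : Fin m → ι → ℝ), ∀ v, v ∈ W ↔ ∀ k, ∑ i, obs k i * v i = 0 := by
  classical
  let b := Module.finBasis ℝ ((ι → ℝ) ⧸ W)
  refine ⟨_, fun k i => b.repr (W.mkQ (Pi.single i 1)) k, fun v => ?_⟩
  have key : ∀ k, ∑ i, b.repr (W.mkQ (Pi.single i 1)) k * v i = b.repr (W.mkQ v) k := by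
    intro k
    have hv : v = ∑ i, v i • (Pi.single i 1 : ι → ℝ) := by
      ext j
      simp [Pi.single_apply]
    conv_rhs => rw [hv]
    simp only [map_sum, map_smul, Finsupp.coe_finsetSum, Finset.sum_apply, Finsupp.smul_apply,
      smul_eq_mul, mul_comm]
  simp only [key]
  rw [← Submodule.Quotient.mk_eq_zero, ← Submodule.mkQ_apply, ← b.repr.map_eq_zero_iff]
  exact Finsupp.ext_iff

/-- The entropy functional on a finite type of states. -/
noncomputable def ent (S : EntropyFunctional) {ι : Type} [Fintype ι] (p : ι → ℝ) : ℝ :=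
  S (Fintype.card ι) (p ∘ (Fintype.equivFin ι).symm)

/-- The normalization of the measure `P` maximizes `S` among the normalizations of the measures of
the same mass that differ from `P` by an element of `W`. -/
structure Opt (S : EntropyFunctional) {ι : Type} [Fintype ι] (P : ι → ℝ)
    (W : Submodule ℝ (ι → ℝ)) : Prop where
  nonneg : ∀ i, 0 ≤ P i
  pos : 0 < ∑ i, P i
  le : ∀ Q : ι → ℝ, (∀ i, 0 ≤ Q i) → ∑ i, Q i = ∑ i, P i → Q - P ∈ W →
    ent S ((∑ i, P i)⁻¹ • Q) ≤ ent S ((∑ i, P i)⁻¹ • P)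

section
variable {S : EntropyFunctional} {ι : Type} [Fintype ι]

theorem exists_constraints_slice (R : ι → ℝ) (W : Submodule ℝ (ι → ℝ)) :
    ∃ C : Constraints (Fintype.card ι), ∀ p, p ∈ C.feasible ↔
      p ∈ stdSimplex ℝ (Fin (Fintype.card ι)) ∧ p ∘ Fintype.equivFin ι - R ∈ W := by
  obtain ⟨m, obs, h⟩ := Submodule.exists_functionals W
  obtain ⟨C, hC⟩ := exists_constraints (fun k i => obs k ((Fintype.equivFin ι).symm i))
    (fun k => ∑ i, obs k i * R i)
  refine ⟨C, fun p => ?_⟩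
  rw [hC, h]
  refine and_congr_right fun _ => forall_congr' fun k => ?_
  have : ∑ i, obs k ((Fintype.equivFin ι).symm i) * p i
      = ∑ i, obs k i * p (Fintype.equivFin ι i) := by
    rw [← (Fintype.equivFin ι).sum_comp]
    simp
  rw [this]
  simp [mul_sub, sub_eq_zero]

theorem Opt.mono {P : ι → ℝ} {W W' : Submodule ℝ (ι → ℝ)} (h : Opt S P W)
    (hW : ∀ Q : ι → ℝ, (∀ i, 0 ≤ Q i) → ∑ i, Q i = ∑ i, P i → Q - P ∈ W' → Q - P ∈ W) :
    Opt S P W' :=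
  ⟨h.nonneg, h.pos, fun Q h0 h1 h2 => h.le Q h0 h1 (hW Q h0 h1 h2)⟩

theorem Opt.smul {P : ι → ℝ} {W : Submodule ℝ (ι → ℝ)} (h : Opt S P W) {c : ℝ} (hc : 0 < c) :
    Opt S (c • P) W := by
  have hs : ∑ i, (c • P) i = c * ∑ i, P i := by simp [Finset.mul_sum]
  refine ⟨fun i => mul_nonneg hc.le (h.nonneg i), hs ▸ mul_pos hc h.pos, fun Q h0 h1 h2 => ?_⟩
  have := h.le (c⁻¹ • Q) (fun i => mul_nonneg (inv_nonneg.2 hc.le) (h0 i))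
    (by rw [hs] at h1; simp [← Finset.mul_sum, h1, hc.ne'])
    (by
      have := W.smul_mem c⁻¹ h2
      rwa [smul_sub, smul_smul, inv_mul_cancel₀ hc.ne', one_smul] at this)
  rw [hs, mul_inv, smul_smul, mul_comm c⁻¹, mul_assoc, inv_mul_cancel₀ hc.ne', mul_one, mul_smul]
  exact this

theorem normalize_mem {P : ι → ℝ} (h0 : ∀ i, 0 ≤ P i) (h1 : 0 < ∑ i, P i) :
    (∑ i, P i)⁻¹ • P ∈ stdSimplex ℝ ι :=
  ⟨fun i => mul_nonneg (inv_nonneg.2 h1.le) (h0 i), by simp [← Finset.mul_sum, h1.ne']⟩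

theorem comp_equiv_mem_stdSimplex {κ : Type} [Fintype κ] {p : ι → ℝ} (hp : p ∈ stdSimplex ℝ ι)
    (e : κ ≃ ι) : p ∘ e ∈ stdSimplex ℝ κ :=
  ⟨fun i => hp.1 _, by simpa using (e.sum_comp p).trans hp.2⟩

/-- Dictionary between MaxEnt distributions and optimal measures; σ is the common mass, by which
everything is divided on the side of the axioms. -/
theorem isMaxEnt_slice_iff {σ : ℝ} (hσ : 0 < σ) {R : ι → ℝ} {W : Submodule ℝ (ι → ℝ)}
    {C : Constraints (Fintype.card ι)}
    (hC : ∀ p, p ∈ C.feasible ↔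
      p ∈ stdSimplex ℝ (Fin (Fintype.card ι)) ∧ p ∘ Fintype.equivFin ι - σ⁻¹ • R ∈ W)
    (P : ι → ℝ) :
    IsMaxEnt S C.feasible ((σ⁻¹ • P) ∘ (Fintype.equivFin ι).symm) ↔
      Opt S P W ∧ ∑ i, P i = σ ∧ P - R ∈ W := by
  have hmem : ∀ P : ι → ℝ, (σ⁻¹ • P) ∘ (Fintype.equivFin ι).symm ∈ C.feasible ↔
      (∀ i, 0 ≤ P i) ∧ ∑ i, P i = σ ∧ P - R ∈ W := by
    intro P
    rw [hC, ← and_assoc]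
    refine and_congr ⟨fun h => ?_, fun h => ?_⟩ ?_
    · have h' := comp_equiv_mem_stdSimplex h (Fintype.equivFin ι)
      have h0 := h'.1
      have h1 := h'.2
      simp only [Function.comp_def, Equiv.symm_apply_apply, Pi.smul_apply, smul_eq_mul,
        ← Finset.mul_sum] at h0 h1
      refine ⟨fun i => ?_, ?_⟩
      · have := h0 i
        exact nonneg_of_mul_nonneg_right this (inv_pos.2 hσ)
      · field_simp at h1
        exact h1
    · refine comp_equiv_mem_stdSimplex ?_ _
      rw [← h.2]
      exact normalize_mem h.1 (h.2 ▸ hσ)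
    · have : ((σ⁻¹ • P) ∘ (Fintype.equivFin ι).symm) ∘ Fintype.equivFin ι - σ⁻¹ • R
          = σ⁻¹ • (P - R) := by
        ext i
        simp [mul_sub]
      rw [this]
      exact ⟨fun h => by simpa [smul_smul, hσ.ne'] using W.smul_mem σ h, fun h => W.smul_mem _ h⟩
  constructor
  · rintro ⟨h1, h2⟩
    obtain ⟨a, b, c⟩ := (hmem P).1 h1
    refine ⟨⟨a, b ▸ hσ, fun Q q0 q1 q2 => ?_⟩, b, c⟩
    rw [b] at q1 ⊢
    refine h2 _ ((hmem Q).2 ⟨q0, q1, ?_⟩)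
    have := W.add_mem q2 c
    simpa using this
  · rintro ⟨h, b, c⟩
    refine ⟨(hmem P).2 ⟨h.nonneg, b, c⟩, fun q hq => ?_⟩
    have hq' : q = (σ⁻¹ • (σ • (q ∘ Fintype.equivFin ι))) ∘ (Fintype.equivFin ι).symm := by
      ext i
      simp [hσ.ne']
    rw [hq'] at hq ⊢
    obtain ⟨a', b', c'⟩ := (hmem _).1 hq
    have := h.le _ a' (b'.trans b.symm) (by
      have := W.sub_mem c' c
      simpa using this)
    rw [b] at this
    exact this

theorem Opt.exists_of (hS : Uniqueness S) {P : ι → ℝ} (h0 : ∀ i, 0 ≤ P i) (h1 : 0 < ∑ i, P i)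
    (W : Submodule ℝ (ι → ℝ)) : ∃ P', Opt S P' W ∧ ∑ i, P' i = ∑ i, P i ∧ P' - P ∈ W := by
  obtain ⟨C, hC⟩ := exists_constraints_slice ((∑ i, P i)⁻¹ • P) W
  obtain ⟨p, hp, -⟩ := hS _ C ⟨((∑ i, P i)⁻¹ • P) ∘ (Fintype.equivFin ι).symm, (hC _).2
    ⟨comp_equiv_mem_stdSimplex (normalize_mem h0 h1) _, by simp [Function.comp_assoc]⟩⟩
  refine ⟨(∑ i, P i) • (p ∘ Fintype.equivFin ι), (isMaxEnt_slice_iff h1 hC _).1 ?_⟩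
  convert hp
  ext i
  simp [h1.ne']

theorem Opt.unique (hS : Uniqueness S) {P P' : ι → ℝ} {W : Submodule ℝ (ι → ℝ)} (h : Opt S P W)
    (h' : Opt S P' W) (hs : ∑ i, P' i = ∑ i, P i) (hW : P' - P ∈ W) : P' = P := by
  obtain ⟨C, hC⟩ := exists_constraints_slice ((∑ i, P i)⁻¹ • P) W
  have a := (isMaxEnt_slice_iff h.pos hC P).2 ⟨h, rfl, by simp⟩
  have b := (isMaxEnt_slice_iff h.pos hC P').2 ⟨h', hs, hW⟩
  have := (hS _ C ⟨_, a.1⟩).unique b a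
  ext i
  have := congrFun this (Fintype.equivFin ι i)
  simpa [h.pos.ne'] using this

/-- Subset independence in linear form. The block masses are those of P, and block k is constrained
to the slice through its own conditional distribution. -/
theorem Opt.block (hS : SubsetIndependence S) {K : ℕ} {β : Fin K → Type} [∀ k, Fintype (β k)]
    (E : (Σ k, β k) ≃ ι) {P : ι → ℝ} {W : ∀ k, Submodule ℝ (β k → ℝ)}
    (h : Opt S P (⨅ k, (W k).comap (LinearMap.funLeft ℝ ℝ fun x => E ⟨k, x⟩))) (k : Fin K)
    (hk : 0 < ∑ x, P (E ⟨k, x⟩)) : Opt S (fun x => P (E ⟨k, x⟩)) (W k) := by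
  set σ := ∑ i, P i with hσ
  have hσ0 : 0 < σ := h.pos
  let e : (Σ k, Fin (Fintype.card (β k))) ≃ Fin (Fintype.card ι) :=
    (Equiv.sigmaCongrRight fun k => (Fintype.equivFin (β k)).symm).trans
      (E.trans (Fintype.equivFin ι))
  have he : ∀ k i, e ⟨k, i⟩ = Fintype.equivFin ι (E ⟨k, (Fintype.equivFin (β k)).symm i⟩) :=
    fun _ _ => rfl
  let s : Fin K → ℝ := fun k => ∑ x, P (E ⟨k, x⟩)
  have hs0 : ∀ k, 0 ≤ s k := fun k => Finset.sum_nonneg fun x _ => h.nonneg _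
  choose C hC using fun k =>
    exists_constraints_slice ((s k)⁻¹ • fun x : β k => P (E ⟨k, x⟩)) (W k)
  set p : Fin (Fintype.card ι) → ℝ := (σ⁻¹ • P) ∘ (Fintype.equivFin ι).symm with hp
  have hpe : ∀ k i, p (e ⟨k, i⟩) = σ⁻¹ * P (E ⟨k, (Fintype.equivFin (β k)).symm i⟩) := by
    intro k i
    simp [hp, he]
  have hsum : ∀ (k) (f : β k → ℝ), ∑ i, f ((Fintype.equivFin (β k)).symm i) = ∑ x, f x :=
    fun k f => (Fintype.equivFin (β k)).symm.sum_comp f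
  have hcond : ∀ k, 0 < s k → (fun i => p (e ⟨k, i⟩) / (s k / σ)) =
      ((s k)⁻¹ • fun x : β k => P (E ⟨k, x⟩)) ∘ (Fintype.equivFin (β k)).symm := by
    intro k hk
    ext i
    simp only [hpe, Function.comp, Pi.smul_apply, smul_eq_mul]
    field_simp
  have hmax : IsMaxEnt S (blockFeasible e C (fun k => s k / σ)) p := by
    refine ⟨⟨comp_equiv_mem_stdSimplex (normalize_mem h.nonneg h.pos) _, fun k => ⟨?_, fun hk => ?_⟩⟩,
      fun p' hp' => ?_⟩
    · simp only [hpe, ← Finset.mul_sum, hsum k fun x => P (E ⟨k, x⟩)]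
      rw [div_eq_inv_mul]
    · have hk' : 0 < s k := by
        by_contra hh
        have : s k = 0 := le_antisymm (not_lt.1 hh) (hs0 k)
        simp [this] at hk
      rw [hcond k hk', hC]
      refine ⟨comp_equiv_mem_stdSimplex (normalize_mem (fun _ => h.nonneg _) hk') _, ?_⟩
      simp [Function.comp_assoc, s]
    · have hq : p' = (σ⁻¹ • (σ • (p' ∘ Fintype.equivFin ι))) ∘ (Fintype.equivFin ι).symm := by
        ext i
        simp [hσ0.ne']
      rw [hq]
      have hsim := comp_equiv_mem_stdSimplex hp'.1 (Fintype.equivFin ι)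
      refine h.le _ (fun i => mul_nonneg hσ0.le (hsim.1 i)) ?_ ?_
      · simp only [Pi.smul_apply, smul_eq_mul, ← Finset.mul_sum, hsim.2, mul_one, ← hσ]
      · rw [Submodule.mem_iInf]
        intro k
        rw [Submodule.mem_comap]
        obtain ⟨hm, hc⟩ := hp'.2 k
        have hp'sum : ∑ x, p' (Fintype.equivFin ι (E ⟨k, x⟩)) = s k / σ := by
          rw [show s k / σ = ∑ i, p' (e ⟨k, i⟩) from hm.symm]
          exact (hsum k fun x => p' (Fintype.equivFin ι (E ⟨k, x⟩))).symm
        rcases (hs0 k).lt_or_eq with hk' | hk'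
        · have := (hC k _).1 (hc (by positivity))
          have := (W k).smul_mem (s k) this.2
          convert this using 1
          ext x
          simp only [LinearMap.funLeft_apply, Pi.sub_apply, Pi.smul_apply, smul_eq_mul,
            Function.comp, he, Equiv.symm_apply_apply]
          field_simp
        -- On a block of mass zero the axiom imposes no conditional constraint, but both measures
        -- vanish there, so their difference is trivially admissible.
        · have z1 : ∀ x, P (E ⟨k, x⟩) = 0 := fun x =>
            (Finset.sum_eq_zero_iff_of_nonneg (fun _ _ => h.nonneg _)).1 hk'.symm x (Finset.mem_univ _)
          have z2 : ∀ x, p' (Fintype.equivFin ι (E ⟨k, x⟩)) = 0 := fun x =>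
            (Finset.sum_eq_zero_iff_of_nonneg
              (f := fun x => p' (Fintype.equivFin ι (E ⟨k, x⟩))) (fun _ _ => hp'.1.1 _)).1
              (by rw [hp'sum, ← hk', zero_div]) x (Finset.mem_univ _)
          convert (W k).zero_mem using 1
          ext x
          simp [LinearMap.funLeft_apply, z1, z2]
  have := hS _ _ _ e C _ p hmax k (div_pos hk hσ0)
  rw [hcond k hk] at this
  exact ((isMaxEnt_slice_iff hk (hC k) _).1 this).1

end

end MaxEntInference

namespace MaxEntInference

/-! ### Restriction to a subset of the states -/

section
variable {S : EntropyFunctional} {ι α : Type} [Fintype ι] [Fintype α]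

/-- Subset independence with a single block and an arbitrary numbering of its states amounts to
relabelling. -/
theorem Opt.equiv (hS : SubsetIndependence S) (e : α ≃ ι) {P : ι → ℝ}
    {W : Submodule ℝ (ι → ℝ)} (h : Opt S P W) :
    Opt S (P ∘ e) (W.comap (LinearMap.funLeft ℝ ℝ e.symm)) := by
  have := Opt.block hS (K := 1) (β := fun _ => α)
    ((Equiv.uniqueSigma (fun _ : Fin 1 => α)).trans e) (P := P)
    (W := fun _ => W.comap (LinearMap.funLeft ℝ ℝ e.symm)) (h.mono fun Q _ _ hQ => by
      have := (Submodule.mem_iInf _).1 hQ 0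
      simp only [Submodule.mem_comap] at this
      convert this using 1
      ext i
      simp [LinearMap.funLeft_apply, Equiv.uniqueSigma]) 0 (by
        have := h.pos
        rw [← e.sum_comp] at this
        simpa [Equiv.uniqueSigma] using this)
  simpa [Equiv.uniqueSigma, Function.comp_def] using this

/-- The vectors that restrict to an element of `W` along `j` and vanish off the range of `j`. -/
def extendSub (j : α → ι) (W : Submodule ℝ (α → ℝ)) : Submodule ℝ (ι → ℝ) where
  carrier := {D | D ∘ j ∈ W ∧ ∀ i, i ∉ Set.range j → D i = 0}
  add_mem' := fun {a b} ha hb => ⟨W.add_mem ha.1 hb.1, fun i hi => by simp [ha.2 i hi, hb.2 i hi]⟩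
  zero_mem' := ⟨W.zero_mem, fun _ _ => rfl⟩
  smul_mem' := fun c a ha => ⟨W.smul_mem c ha.1, fun i hi => by simp [ha.2 i hi]⟩

/-- Two blocks: the range of `j` with the directions W, and its complement with the zero subspace,
which freezes it. -/
theorem Opt.restrict (hS : SubsetIndependence S) {j : α → ι} (hj : Function.Injective j)
    {P : ι → ℝ} {W : Submodule ℝ (α → ℝ)} (h : Opt S P (extendSub j W))
    (hpos : 0 < ∑ a, P (j a)) : Opt S (P ∘ j) W := by
  classical
  let c : ι → Fin 2 := fun i => if i ∈ Set.range j then 0 else 1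
  have hc0 : ∀ i, c i = 0 ↔ i ∈ Set.range j := fun i => by
    dsimp only [c]; split_ifs with h <;> simp [h]
  have hc1 : ∀ i, c i = 1 ↔ i ∉ Set.range j := fun i => by
    dsimp only [c]; split_ifs with h <;> simp [h]
  let e : α ≃ {i // c i = 0} := Equiv.ofBijective (fun a => ⟨j a, (hc0 _).2 ⟨a, rfl⟩⟩)
    ⟨fun a b hab => hj (congrArg Subtype.val hab), fun ⟨i, hi⟩ => by
      obtain ⟨a, ha⟩ := (hc0 i).1 hi
      exact ⟨a, Subtype.ext ha⟩⟩
  let W0 : Submodule ℝ ({i // c i = 0} → ℝ) := W.comap (LinearMap.funLeft ℝ ℝ e)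
  let WW : ∀ k : Fin 2, Submodule ℝ ({i // c i = k} → ℝ) := fun k =>
    if hk : k = 0 then (hk ▸ W0) else ⊥
  have := Opt.block hS (Equiv.sigmaFiberEquiv c) (P := P) (W := WW) (h.mono fun Q _ _ hQ => by
      have hQ := (Submodule.mem_iInf _).1 hQ
      refine ⟨hQ 0, fun i hi => ?_⟩
      have h1 : LinearMap.funLeft ℝ ℝ (fun x => Equiv.sigmaFiberEquiv c ⟨1, x⟩) (Q - P) = 0 := by
        have := hQ 1
        simpa [WW] using this
      exact congrFun h1 ⟨i, (hc1 i).2 hi⟩) 0 (by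
        rw [← e.sum_comp]
        exact hpos)
  have h2 := this.equiv hS e
  refine h2.mono fun Q _ _ hQ => ?_
  change ((Q - P ∘ j) ∘ e.symm) ∘ e ∈ W
  rw [Function.comp_assoc, e.symm_comp_self]
  exact hQ

theorem sum_comp_le_of_injective {j : α → ι} (hj : Function.Injective j) {P : ι → ℝ}
    (hP : ∀ i, 0 ≤ P i) : ∑ a, P (j a) ≤ ∑ i, P i := by
  have := Finset.sum_map Finset.univ ⟨j, hj⟩ P
  simp only [Function.Embedding.coeFn_mk] at this
  rw [← this]
  exact Finset.sum_le_univ_sum_of_nonneg hP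

theorem sum_comp_eq_of_injective {j : α → ι} (hj : Function.Injective j) {P : ι → ℝ}
    (hP : ∀ i, i ∉ Set.range j → P i = 0) : ∑ a, P (j a) = ∑ i, P i := by
  have := Finset.sum_map Finset.univ ⟨j, hj⟩ P
  simp only [Function.Embedding.coeFn_mk] at this
  rw [← this]
  exact Finset.sum_subset (Finset.subset_univ _) fun i _ hi => hP i (by simpa using hi)

/-- Converse of `Opt.restrict`: the optimum of the extended slice restricts to an optimum in the
slice of `P ∘ j`, hence to `P ∘ j` by uniqueness, and it equals P elsewhere by construction. -/
theorem Opt.extend (hU : Uniqueness S) (hS : SubsetIndependence S) {j : α → ι}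
    (hj : Function.Injective j) {P : ι → ℝ} (hP : ∀ i, 0 ≤ P i) {W : Submodule ℝ (α → ℝ)}
    (h : Opt S (P ∘ j) W) : Opt S P (extendSub j W) := by
  have hpos : 0 < ∑ i, P i := h.pos.trans_le (sum_comp_le_of_injective hj hP)
  obtain ⟨P', h', hs, hm⟩ := Opt.exists_of hU hP hpos (extendSub j W)
  have hsum : ∑ a, P' (j a) = ∑ a, P (j a) := by
    have hz : ∑ a, (P' - P) (j a) = ∑ i, (P' - P) i := sum_comp_eq_of_injective hj hm.2
    simp only [Pi.sub_apply, Finset.sum_sub_distrib, hs, sub_self] at hz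
    linarith
  have hP' := Opt.unique hU h (h'.restrict hS hj (hsum ▸ h.pos)) hsum hm.1
  have : P' = P := by
    ext i
    by_cases hi : i ∈ Set.range j
    · obtain ⟨a, rfl⟩ := hi
      exact congrFun hP' a
    · have := hm.2 i hi
      simpa [sub_eq_zero] using this
  exact this ▸ h'

theorem Opt.const (hM : Maximality S) [Nonempty ι] {c : ℝ} (hc : 0 < c) :
    Opt S (fun _ : ι => c) ⊤ := by
  refine ⟨fun _ => hc.le, by simp [hc, Fintype.card_pos], fun Q h0 h1 _ => ?_⟩
  have hn : (0 : ℝ) < Fintype.card ι := by exact_mod_cast Fintype.card_pos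
  have hpos : 0 < ∑ i, Q i := by
    rw [h1]
    simp [hc, Fintype.card_pos]
  have := (hM (Fintype.card ι) Fintype.card_pos).2 _
    (comp_equiv_mem_stdSimplex (normalize_mem h0 hpos) (Fintype.equivFin ι).symm)
  rw [h1] at this
  unfold ent
  convert this using 2
  ext i
  simp
  field_simp

end

/-! ### Balanced pairs of measures -/

section
variable {S : EntropyFunctional} {ι α β γ α' β' : Type} [Fintype ι] [Fintype α] [Fintype β]
  [Fintype γ] [Fintype α'] [Fintype β']

/-- The combinations `a A ⊕ b B`. -/
def sumSub (A : α → ℝ) (B : β → ℝ) : Submodule ℝ (α ⊕ β → ℝ) where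
  carrier := {D | ∃ a b : ℝ, D = Sum.elim (a • A) (b • B)}
  add_mem' := by
    rintro _ _ ⟨a, b, rfl⟩ ⟨a', b', rfl⟩
    exact ⟨a + a', b + b', by ext (i | i) <;> simp [add_mul]⟩
  zero_mem' := ⟨0, 0, by ext (i | i) <;> simp⟩
  smul_mem' := by
    rintro c _ ⟨a, b, rfl⟩
    exact ⟨c * a, c * b, by ext (i | i) <;> simp [mul_assoc]⟩

/-- `A ⊕ B` is optimal among the measures `a A ⊕ b B` of the same mass. -/
structure Bal (S : EntropyFunctional) (A : α → ℝ) (B : β → ℝ) : Prop where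
  pos_left : 0 < ∑ i, A i
  pos_right : 0 < ∑ i, B i
  opt : Opt S (Sum.elim A B) (sumSub A B)

theorem Bal.nonneg_left {A : α → ℝ} {B : β → ℝ} (h : Bal S A B) (i : α) : 0 ≤ A i :=
  h.opt.nonneg (Sum.inl i)

theorem Bal.nonneg_right {A : α → ℝ} {B : β → ℝ} (h : Bal S A B) (i : β) : 0 ≤ B i :=
  h.opt.nonneg (Sum.inr i)

theorem Bal.of_opt (hS : SubsetIndependence S) {P : ι → ℝ} {V : Submodule ℝ (ι → ℝ)}
    (h : Opt S P V) {i : α → ι} {k : β → ι} (hik : Function.Injective (Sum.elim i k))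
    (hA : 0 < ∑ x, P (i x)) (hB : 0 < ∑ x, P (k x))
    (hV : ∀ (a b : ℝ) (D : ι → ℝ), D ∘ i = a • (P ∘ i) → D ∘ k = b • (P ∘ k) →
      (∀ x, x ∉ Set.range i → x ∉ Set.range k → D x = 0) → D ∈ V) :
    Bal S (P ∘ i) (P ∘ k) := by
  refine ⟨hA, hB, ?_⟩
  have hP : Sum.elim (P ∘ i) (P ∘ k) = P ∘ Sum.elim i k := by ext (x | x) <;> rfl
  rw [hP]
  refine Opt.restrict hS hik (h.mono fun Q _ _ hQ => ?_) ?_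
  · obtain ⟨⟨a, b, hab⟩, h0⟩ := hQ
    refine hV a b _ ?_ ?_ fun x hi hk => h0 x ?_
    · ext x
      exact congrFun hab (Sum.inl x)
    · ext x
      exact congrFun hab (Sum.inr x)
    · simpa using ⟨fun y hy => hi ⟨y, hy⟩, fun y hy => hk ⟨y, hy⟩⟩
  · simpa using add_pos hA hB


theorem sumSub_smul_sub {α β : Type} (A : α → ℝ) (B : β → ℝ) (a b a' b' : ℝ) :
    Sum.elim (a • A) (b • B) - Sum.elim (a' • A) (b' • B) ∈ sumSub A B :=
  ⟨a - a', b - b', by ext (i | i) <;> simp [sub_mul]⟩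

/-- The multiple c(A ⊕ B) with the mass of the given mixture is optimal in the same slice, so
uniqueness identifies the two. A coefficient that could a priori be zero is thereby excluded. -/
theorem Bal.eq_of_opt (hU : Uniqueness S) {A : α → ℝ} {B : β → ℝ} (h : Bal S A B) {a b : ℝ}
    (h' : Opt S (Sum.elim (a • A) (b • B)) (sumSub A B)) : a = b := by
  set x := ∑ i, A i with hx
  set y := ∑ i, B i with hy
  have hx0 : 0 < x := h.pos_left
  have hy0 : 0 < y := h.pos_right
  have hs : a * x + b * y = ∑ i, Sum.elim (a • A) (b • B) i := by
    simp [hx, hy, Finset.mul_sum]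
  have hpos : 0 < a * x + b * y := hs ▸ h'.pos
  set c := (a * x + b * y) / (x + y) with hc
  have hc0 : 0 < c := by positivity
  have h2 := h.opt.smul hc0
  have h3 : c • Sum.elim A B = Sum.elim (c • A) (c • B) := by ext (i | i) <;> simp
  rw [h3] at h2
  have := Opt.unique hU h2 h' (by
    rw [← hs]
    simp only [Fintype.sum_sum_type, Sum.elim_inl, Sum.elim_inr, Pi.smul_apply, smul_eq_mul,
      ← Finset.mul_sum, ← hx, ← hy, hc]
    field_simp) (sumSub_smul_sub A B a b c c)
  have e1 : a * x = c * x := by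
    rw [hx, Finset.mul_sum, Finset.mul_sum]
    exact Finset.sum_congr rfl fun i _ => congrFun this (Sum.inl i)
  have e2 : b * y = c * y := by
    rw [hy, Finset.mul_sum, Finset.mul_sum]
    exact Finset.sum_congr rfl fun i _ => congrFun this (Sum.inr i)
  rw [mul_right_cancel₀ hx0.ne' e1, mul_right_cancel₀ hy0.ne' e2]

/-- The combinations `a A ⊕ b B ⊕ c C`. -/
def triSub (A : α → ℝ) (B : β → ℝ) (C : γ → ℝ) : Submodule ℝ (α ⊕ (β ⊕ γ) → ℝ) where
  carrier := {D | ∃ a b c : ℝ, D = Sum.elim (a • A) (Sum.elim (b • B) (c • C))}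
  add_mem' := by
    rintro _ _ ⟨a, b, c, rfl⟩ ⟨a', b', c', rfl⟩
    exact ⟨a + a', b + b', c + c', by ext (i | i | i) <;> simp [add_mul]⟩
  zero_mem' := ⟨0, 0, 0, by ext (i | i | i) <;> simp⟩
  smul_mem' := by
    rintro t _ ⟨a, b, c, rfl⟩
    exact ⟨t * a, t * b, t * c, by ext (i | i | i) <;> simp [mul_assoc]⟩

/-- Let aA ⊕ bB ⊕ cC be the optimum. Its restrictions to A ⊕ B and to B ⊕ C are optimal when they
have positive mass, so balance gives a = b and b = c; b = 0 would make everything vanish.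
Transitivity and `Bal.sum_left` are two readings of this. -/
theorem Bal.opt_triple (hU : Uniqueness S) (hS : SubsetIndependence S) {A : α → ℝ} {B : β → ℝ}
    {C : γ → ℝ} (h : Bal S A B) (h' : Bal S B C) :
    Opt S (Sum.elim A (Sum.elim B C)) (triSub A B C) := by
  have hA := h.pos_left
  have hB := h.pos_right
  have hC := h'.pos_right
  obtain ⟨P', hP', hs, a, b, c, habc⟩ := Opt.exists_of hU (P := Sum.elim A (Sum.elim B C))
    (by rintro (i | i | i); exacts [h.nonneg_left i, h.nonneg_right i, h'.nonneg_right i])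
    (by simpa using add_pos hA (add_pos hB hC)) (triSub A B C)
  have hP : P' = Sum.elim ((1 + a) • A) (Sum.elim ((1 + b) • B) ((1 + c) • C)) := by
    rw [sub_eq_iff_eq_add] at habc
    rw [habc]
    ext (i | i | i) <;> simp [add_mul, add_comm]
  generalize 1 + a = a at hP
  generalize 1 + b = b at hP
  generalize 1 + c = c at hP
  subst hP
  have ha : 0 ≤ a := by
    refine nonneg_of_mul_nonneg_left (b := ∑ i, A i) ?_ hA
    rw [Finset.mul_sum]
    exact Finset.sum_nonneg fun i _ => hP'.nonneg (Sum.inl i)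
  have hb : 0 ≤ b := by
    refine nonneg_of_mul_nonneg_left (b := ∑ i, B i) ?_ hB
    rw [Finset.mul_sum]
    exact Finset.sum_nonneg fun i _ => hP'.nonneg (Sum.inr (Sum.inl i))
  have hc : 0 ≤ c := by
    refine nonneg_of_mul_nonneg_left (b := ∑ i, C i) ?_ hC
    rw [Finset.mul_sum]
    exact Finset.sum_nonneg fun i _ => hP'.nonneg (Sum.inr (Sum.inr i))
  simp only [Fintype.sum_sum_type, Sum.elim_inl, Sum.elim_inr, Pi.smul_apply, smul_eq_mul,
      ← Finset.mul_sum] at hs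
  have hab : 0 < a ∨ 0 < b → a = b := by
    intro hab
    refine h.eq_of_opt hU ?_
    have := Opt.restrict hS (j := Sum.map id Sum.inl) (α := α ⊕ β)
      (Sum.map_injective.2 ⟨Function.injective_id, Sum.inl_injective⟩) (W := sumSub A B)
      (hP'.mono fun Q _ _ hQ => ?_) ?_
    · convert this using 1
      ext (i | i) <;> simp
    · obtain ⟨⟨a', b', hD⟩, h0⟩ := hQ
      refine ⟨a', b', 0, ?_⟩
      ext (i | i | i)
      · exact congrFun hD (Sum.inl i)
      · exact congrFun hD (Sum.inr i)
      · rw [h0 _ (by simp)]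
        simp
    · simp only [Fintype.sum_sum_type, Sum.elim_inl, Sum.elim_inr, Pi.smul_apply, smul_eq_mul,
        Sum.map_inl, Sum.map_inr, id, ← Finset.mul_sum]
      rcases hab with hab | hab <;> positivity
  have hbc : 0 < b ∨ 0 < c → b = c := by
    intro hab
    refine h'.eq_of_opt hU ?_
    have := Opt.restrict hS (j := Sum.inr) (α := β ⊕ γ) (ι := α ⊕ (β ⊕ γ))
      Sum.inr_injective (W := sumSub B C) (hP'.mono fun Q _ _ hQ => ?_) ?_
    · exact this
    · obtain ⟨⟨a', b', hD⟩, h0⟩ := hQ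
      refine ⟨0, a', b', ?_⟩
      ext (i | i | i)
      · rw [h0 _ (by simp)]
        simp
      · exact congrFun hD (Sum.inl i)
      · exact congrFun hD (Sum.inr i)
    · simp only [Fintype.sum_sum_type, Sum.elim_inl, Sum.elim_inr, Pi.smul_apply, smul_eq_mul,
        ← Finset.mul_sum]
      rcases hab with hab | hab <;> positivity
  have hall : a = 1 ∧ b = 1 ∧ c = 1 := by
    by_cases hb0 : 0 < b
    · have e1 := hab (Or.inr hb0)
      have e2 := hbc (Or.inl hb0)
      subst e1 e2
      have : a = 1 := by
        have : a * (∑ i, A i + (∑ i, B i + ∑ i, C i)) = 1 * (∑ i, A i + (∑ i, B i + ∑ i, C i)) := by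
          linarith
        exact mul_right_cancel₀ (by positivity) this
      exact ⟨this, this, this⟩
    · have e0 : b = 0 := le_antisymm (not_lt.1 hb0) hb
      have e1 : a = 0 := by
        by_contra h
        exact h ((hab (Or.inl (ha.lt_of_ne' h))).trans e0)
      have e2 : c = 0 := by
        by_contra h
        exact h ((hbc (Or.inr (hc.lt_of_ne' h))).symm.trans e0)
      rw [e0, e1, e2] at hs
      linarith
  obtain ⟨rfl, rfl, rfl⟩ := hall
  simpa using hP'

theorem Bal.trans (hU : Uniqueness S) (hS : SubsetIndependence S) {A : α → ℝ} {B : β → ℝ}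
    {C : γ → ℝ} (h : Bal S A B) (h' : Bal S B C) : Bal S A C := by
  have := Bal.of_opt hS (h.opt_triple hU hS h') (i := Sum.inl) (k := Sum.inr ∘ Sum.inr)
    (by rintro (x | x) (y | y) hxy <;> simp_all)
    h.pos_left h'.pos_right fun a b D h1 h2 h3 => ⟨a, 0, b, by
      ext (i | i | i)
      · exact congrFun h1 i
      · rw [h3 _ (by simp) (by simp)]
        simp
      · exact congrFun h2 i⟩
  exact this

theorem Bal.symm (hS : SubsetIndependence S) {A : α → ℝ} {B : β → ℝ} (h : Bal S A B) :
    Bal S B A :=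
  Bal.of_opt hS h.opt (i := Sum.inr) (k := Sum.inl)
    (by rintro (x | x) (y | y) hxy <;> simp_all)
    h.pos_right h.pos_left fun a b D h1 h2 _ => ⟨b, a, by
      ext (i | i)
      · exact congrFun h2 i
      · exact congrFun h1 i⟩

theorem Bal.sum_left (hU : Uniqueness S) (hS : SubsetIndependence S) {A : α → ℝ} {B : β → ℝ}
    {C : γ → ℝ} (h : Bal S A C) (h' : Bal S B C) : Bal S (Sum.elim A B) C := by
  have := Bal.of_opt hS (h.opt_triple hU hS (h'.symm hS))
    (i := Sum.elim Sum.inl (Sum.inr ∘ Sum.inr)) (k := Sum.inr ∘ Sum.inl)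
    (by rintro ((x | x) | x) ((y | y) | y) hxy <;> simp_all)
    (by simpa using add_pos h.pos_left h'.pos_left) h.pos_right
    fun a b D h1 h2 h3 => ⟨a, b, a, by
      ext (i | i | i)
      · exact congrFun h1 (Sum.inl i)
      · exact congrFun h2 i
      · exact congrFun h1 (Sum.inr i)⟩
  have e : Sum.elim A (Sum.elim C B) ∘ Sum.elim Sum.inl (Sum.inr ∘ Sum.inr) = Sum.elim A B := by
    ext (i | i) <;> rfl
  exact e ▸ this

theorem Bal.smul {A : α → ℝ} {B : β → ℝ} (h : Bal S A B) {c : ℝ} (hc : 0 < c) :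
    Bal S (c • A) (c • B) := by
  refine ⟨by simpa [← Finset.mul_sum] using mul_pos hc h.pos_left,
    by simpa [← Finset.mul_sum] using mul_pos hc h.pos_right, ?_⟩
  have h3 : c • Sum.elim A B = Sum.elim (c • A) (c • B) := by ext (i | i) <;> simp
  rw [← h3]
  refine (h.opt.smul hc).mono fun Q _ _ hQ => ?_
  obtain ⟨a, b, h⟩ := hQ
  exact ⟨a * c, b * c, by rw [h]; ext (i | i) <;> simp [mul_assoc]⟩

theorem Bal.const (hM : Maximality S) [Nonempty α] [Nonempty β] {c : ℝ} (hc : 0 < c) :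
    Bal S (fun _ : α => c) (fun _ : β => c) := by
  refine ⟨by simp [hc, Fintype.card_pos], by simp [hc, Fintype.card_pos], ?_⟩
  have := Opt.const (S := S) (ι := α ⊕ β) hM hc
  convert this.mono fun Q _ _ _ => Submodule.mem_top using 1
  ext (i | i) <;> rfl

theorem Bal.comp_embedding (hU : Uniqueness S) (hS : SubsetIndependence S) {j : α → ι}
    (hj : Function.Injective j) {P : ι → ℝ} (hP : ∀ i, 0 ≤ P i)
    (h0 : ∀ i, i ∉ Set.range j → P i = 0) {B : β → ℝ} :
    Bal S (P ∘ j) B ↔ Bal S P B := by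
  have hsum : ∑ a, P (j a) = ∑ i, P i := sum_comp_eq_of_injective hj h0
  have hinj : Function.Injective (Sum.map j (id : β → β)) :=
    Sum.map_injective.2 ⟨hj, Function.injective_id⟩
  have hcomp : Sum.elim P B ∘ Sum.map j (id : β → β) = Sum.elim (P ∘ j) B := by
    ext (i | i) <;> rfl
  constructor
  · intro h
    refine ⟨hsum ▸ h.pos_left, h.pos_right, ?_⟩
    refine (Opt.extend hU hS hinj (P := Sum.elim P B) ?_ (hcomp ▸ h.opt)).mono fun Q _ _ hQ => ?_
    · rintro (i | i)
      exacts [hP i, h.nonneg_right i]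
    · obtain ⟨a, b, hab⟩ := hQ
      rw [hab]
      refine ⟨⟨a, b, by ext (i | i) <;> rfl⟩, ?_⟩
      rintro (i | i) hi
      · simp [h0 i (by simpa using hi)]
      · simp at hi
  · intro h
    refine ⟨hsum ▸ h.pos_left, h.pos_right, ?_⟩
    rw [← hcomp]
    refine Opt.restrict hS hinj (h.opt.mono fun Q _ _ hQ => ?_) ?_
    · obtain ⟨⟨a, b, hab⟩, hz⟩ := hQ
      refine ⟨a, b, ?_⟩
      ext (i | i)
      · by_cases hi : i ∈ Set.range j
        · obtain ⟨x, rfl⟩ := hi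
          exact congrFun hab (Sum.inl x)
        · rw [hz _ (by simpa using hi)]
          simp [h0 i hi]
      · exact congrFun hab (Sum.inr i)
    · simpa [hsum] using add_pos h.pos_left h.pos_right

/-- Let mass flow inside the pair A, A' and inside the pair B, B', but not between the pairs:
balance of each pair makes the given measure optimal. Since both mass ratios are κ, every
mass-preserving flow between A ⊕ B and A' ⊕ B' is of this kind. This is what makes `mean` well
defined. -/
theorem Bal.sum_sum (hU : Uniqueness S) (hS : SubsetIndependence S) {A : α → ℝ} {B : β → ℝ}
    {A' : α' → ℝ} {B' : β' → ℝ} (h : Bal S A A') (h' : Bal S B B') {κ : ℝ}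
    (hA : ∑ i, A' i = κ * ∑ i, A i) (hB : ∑ i, B' i = κ * ∑ i, B i) :
    Bal S (Sum.elim A B) (Sum.elim A' B') := by
  have pA := h.pos_left
  have pB := h'.pos_left
  have pA' := h.pos_right
  have pB' := h'.pos_right
  -- As A' has κ times the mass of A, the condition a + κ a' = 0 is conservation of mass in the
  -- first pair; likewise for the second.
  let V : Submodule ℝ ((α ⊕ β) ⊕ (α' ⊕ β') → ℝ) :=
    { carrier := {D | ∃ a b a' b' : ℝ, a + κ * a' = 0 ∧ b + κ * b' = 0 ∧
        D = Sum.elim (Sum.elim (a • A) (b • B)) (Sum.elim (a' • A') (b' • B'))}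
      add_mem' := by
        rintro _ _ ⟨a, b, c, d, h1, h2, rfl⟩ ⟨a', b', c', d', h1', h2', rfl⟩
        exact ⟨a + a', b + b', c + c', d + d', by linarith, by linarith, by
          ext ((i | i) | (i | i)) <;> simp [add_mul]⟩
      zero_mem' := ⟨0, 0, 0, 0, by simp, by simp, by ext ((i | i) | (i | i)) <;> simp⟩
      smul_mem' := by
        rintro t _ ⟨a, b, c, d, h1, h2, rfl⟩
        exact ⟨t * a, t * b, t * c, t * d, by linear_combination t * h1,
          by linear_combination t * h2, by ext ((i | i) | (i | i)) <;> simp [mul_assoc]⟩ }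
  set P : (α ⊕ β) ⊕ (α' ⊕ β') → ℝ := Sum.elim (Sum.elim A B) (Sum.elim A' B') with hP
  obtain ⟨P', hP', hs, a, b, a', b', ha, hb, hD⟩ := Opt.exists_of hU (P := P)
    (by rintro ((i | i) | (i | i))
        exacts [h.nonneg_left i, h'.nonneg_left i, h.nonneg_right i, h'.nonneg_right i])
    (by simpa [hP] using add_pos (add_pos pA pB) (add_pos pA' pB')) V
  have e1 : 1 + a = 1 + a' := by
    refine h.eq_of_opt hU ?_
    have hc : P' ∘ Sum.map Sum.inl Sum.inl = Sum.elim ((1 + a) • A) ((1 + a') • A') := by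
      rw [sub_eq_iff_eq_add] at hD
      rw [hD]
      ext (i | i) <;> simp [hP, add_mul, add_comm]
    rw [← hc]
    refine Opt.restrict hS (Sum.map_injective.2 ⟨Sum.inl_injective, Sum.inl_injective⟩)
      (hP'.mono fun Q _ hsQ hQ => ?_) ?_
    · obtain ⟨⟨u, u', hu⟩, h0⟩ := hQ
      have hform : Q - P' = Sum.elim (Sum.elim (u • A) ((0 : ℝ) • B))
          (Sum.elim (u' • A') ((0 : ℝ) • B')) := by
        ext ((i | i) | (i | i))
        · exact congrFun hu (Sum.inl i)
        · rw [h0 _ (by simp)]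
          simp
        · exact congrFun hu (Sum.inr i)
        · rw [h0 _ (by simp)]
          simp
      refine ⟨u, 0, u', 0, ?_, by simp, hform⟩
      have : ∑ i, (Q - P') i = 0 := by simp [hsQ]
      rw [hform] at this
      simp only [Fintype.sum_sum_type, Sum.elim_inl, Sum.elim_inr, Pi.smul_apply, smul_eq_mul,
        ← Finset.mul_sum, hA, zero_mul, Finset.sum_const_zero] at this
      refine (mul_eq_zero.1 (?_ : (u + κ * u') * ∑ i, A i = 0)).resolve_right pA.ne'
      linarith
    · have : ∑ x, P' (Sum.map Sum.inl Sum.inl x)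
          = ∑ x, (Sum.elim ((1 + a) • A) ((1 + a') • A')) x := by
        rw [← hc]
        rfl
      rw [this]
      simp only [Fintype.sum_sum_type, Sum.elim_inl, Sum.elim_inr, Pi.smul_apply, smul_eq_mul,
        ← Finset.mul_sum]
      have : (1 + a) * ∑ i, A i + (1 + a') * ∑ i, A' i = ∑ i, A i + ∑ i, A' i := by
        rw [hA]
        linear_combination (∑ i, A i) * ha
      rw [this]
      positivity
  have e2 : 1 + b = 1 + b' := by
    refine h'.eq_of_opt hU ?_
    have hc : P' ∘ Sum.map Sum.inr Sum.inr = Sum.elim ((1 + b) • B) ((1 + b') • B') := by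
      rw [sub_eq_iff_eq_add] at hD
      rw [hD]
      ext (i | i) <;> simp [hP, add_mul, add_comm]
    rw [← hc]
    refine Opt.restrict hS (Sum.map_injective.2 ⟨Sum.inr_injective, Sum.inr_injective⟩)
      (hP'.mono fun Q _ hsQ hQ => ?_) ?_
    · obtain ⟨⟨u, u', hu⟩, h0⟩ := hQ
      have hform : Q - P' = Sum.elim (Sum.elim ((0 : ℝ) • A) (u • B))
          (Sum.elim ((0 : ℝ) • A') (u' • B')) := by
        ext ((i | i) | (i | i))
        · rw [h0 _ (by simp)]
          simp
        · exact congrFun hu (Sum.inl i)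
        · rw [h0 _ (by simp)]
          simp
        · exact congrFun hu (Sum.inr i)
      refine ⟨0, u, 0, u', by simp, ?_, hform⟩
      have : ∑ i, (Q - P') i = 0 := by simp [hsQ]
      rw [hform] at this
      simp only [Fintype.sum_sum_type, Sum.elim_inl, Sum.elim_inr, Pi.smul_apply, smul_eq_mul,
        ← Finset.mul_sum, hB, zero_mul, Finset.sum_const_zero] at this
      refine (mul_eq_zero.1 (?_ : (u + κ * u') * ∑ i, B i = 0)).resolve_right pB.ne'
      linarith
    · have : ∑ x, P' (Sum.map Sum.inr Sum.inr x)
          = ∑ x, (Sum.elim ((1 + b) • B) ((1 + b') • B')) x := by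
        rw [← hc]
        rfl
      rw [this]
      simp only [Fintype.sum_sum_type, Sum.elim_inl, Sum.elim_inr, Pi.smul_apply, smul_eq_mul,
        ← Finset.mul_sum]
      have : (1 + b) * ∑ i, B i + (1 + b') * ∑ i, B' i = ∑ i, B i + ∑ i, B' i := by
        rw [hB]
        linear_combination (∑ i, B i) * hb
      rw [this]
      positivity
  have hκ : 0 < κ := by
    rw [hA] at pA'
    exact pos_of_mul_pos_left pA' pA.le
  have a0 : a = 0 := by
    have : (1 + κ) * a = 0 := by linear_combination ha + κ * e1
    exact (mul_eq_zero.1 this).resolve_left (by positivity)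
  have b0 : b = 0 := by
    have : (1 + κ) * b = 0 := by linear_combination hb + κ * e2
    exact (mul_eq_zero.1 this).resolve_left (by positivity)
  have a0' : a' = 0 := by linarith
  have b0' : b' = 0 := by linarith
  have hPP : P' = P := by
    rw [sub_eq_iff_eq_add] at hD
    rw [hD, a0, b0, a0', b0']
    ext ((i | i) | (i | i)) <;> simp
  rw [hPP] at hP'
  refine ⟨by simpa using add_pos pA pB, by simpa using add_pos pA' pB', hP'.mono fun Q _ hsQ hQ => ?_⟩
  obtain ⟨u, u', hu⟩ := hQ
  have : ∑ i, (Q - P) i = 0 := by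
    simp only [Pi.sub_apply, Finset.sum_sub_distrib, hsQ, hP, sub_self]
  have hu' : Q - P = Sum.elim (Sum.elim (u • A) (u • B)) (Sum.elim (u' • A') (u' • B')) := by
    rw [hP, hu]
    ext ((i | i) | (i | i)) <;> simp
  rw [hu'] at this
  simp only [Fintype.sum_sum_type, Sum.elim_inl, Sum.elim_inr, Pi.smul_apply, smul_eq_mul,
    ← Finset.mul_sum, hA, hB] at this
  have h0 : u + κ * u' = 0 := by
    refine (mul_eq_zero.1 (?_ : (u + κ * u') * (∑ i, A i + ∑ i, B i) = 0)).resolve_right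
      (by positivity)
    linarith
  exact ⟨u, u, u', u', h0, h0, hu'⟩

end

end MaxEntInference

namespace MaxEntInference

/-! ### The odds of optimal mixtures -/

open Topology Filter Set unitInterval

/-- The maximum conditions cut out a closed set, the graph of f; projecting along the compact
interval preserves closedness. -/
theorem continuous_of_unique_max {X : Type*} [TopologicalSpace X] {Φ : X × I → ℝ}
    (hΦ : Continuous Φ) {f : X → I} (h : ∀ x t, t = f x ↔ ∀ t', Φ (x, t') ≤ Φ (x, t)) :
    Continuous f := by
  rw [continuous_iff_isClosed]
  intro F hF
  have : f ⁻¹' F = Prod.fst '' ({z : X × I | z.2 ∈ F} ∩ ⋂ t', {z : X × I | Φ (z.1, t') ≤ Φ z}) := by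
    ext x
    simp only [mem_preimage, mem_image, mem_inter_iff, mem_ofPred_eq, mem_iInter, Prod.exists,
      exists_and_right, exists_eq_right]
    exact ⟨fun hx => ⟨f x, hx, (h x _).1 rfl⟩, fun ⟨t, ht, hm⟩ => (h x t).2 hm ▸ ht⟩
  rw [this]
  refine isClosedMap_fst_of_compactSpace _ ((hF.preimage continuous_snd).inter
    (isClosed_iInter fun t' => isClosed_le ?_ hΦ))
  exact hΦ.comp (continuous_fst.prodMk continuous_const)

/-- The nonnegative vectors of positive mass. -/
def measures (α : Type) [Fintype α] : Set (α → ℝ) := {A | (∀ i, 0 ≤ A i) ∧ 0 < ∑ i, A i}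

/-- The consequences of the axioms that determine the entropy functional. -/
structure Admissible (S : EntropyFunctional) : Prop where
  cont : IsContinuousEntropy S
  uniq : Uniqueness S
  sub : SubsetIndependence S
  max : Maximality S

section
variable {S : EntropyFunctional} {ι α β : Type} [Fintype ι] [Fintype α] [Fintype β]

theorem continuousOn_ent (hc : IsContinuousEntropy S) :
    ContinuousOn (ent S) (stdSimplex ℝ ι) :=
  (hc _).comp (f := fun p : ι → ℝ => p ∘ (Fintype.equivFin ι).symm)
    (by fun_prop) fun _ hp => comp_equiv_mem_stdSimplex hp _

theorem mem_measures_of_mem_stdSimplex {A : α → ℝ} (hA : A ∈ stdSimplex ℝ α) : A ∈ measures α :=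
  ⟨hA.1, hA.2 ▸ one_pos⟩

theorem smul_mem_measures {A : α → ℝ} (hA : A ∈ measures α) {c : ℝ} (hc : 0 < c) :
    c • A ∈ measures α :=
  ⟨fun i => mul_nonneg hc.le (hA.1 i), by simpa [← Finset.mul_sum] using mul_pos hc hA.2⟩

theorem sum_elim_mem_measures {A : α → ℝ} {B : β → ℝ} (hA : A ∈ measures α) (hB : B ∈ measures β) :
    Sum.elim A B ∈ measures (α ⊕ β) :=
  ⟨by rintro (i | i); exacts [hA.1 i, hB.1 i], by simpa using add_pos hA.2 hB.2⟩

theorem mix_mem_stdSimplex {A : α → ℝ} (hA : A ∈ stdSimplex ℝ α) {B : β → ℝ}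
    (hB : B ∈ stdSimplex ℝ β) (t : I) :
    Sum.elim ((t : ℝ) • A) ((1 - t : ℝ) • B) ∈ stdSimplex ℝ (α ⊕ β) := by
  refine ⟨?_, by simp [← Finset.mul_sum, hA.2, hB.2]⟩
  rintro (i | i)
  · exact mul_nonneg t.2.1 (hA.1 i)
  · exact mul_nonneg (by linarith [t.2.2]) (hB.1 i)

theorem Bal.of_smul {A : α → ℝ} {B : β → ℝ} (hA : A ∈ measures α) (hB : B ∈ measures β) {a b : ℝ}
    (ha : 0 < a) (hb : 0 < b) (h : Opt S (Sum.elim (a • A) (b • B)) (sumSub A B)) :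
    Bal S (a • A) (b • B) := by
  refine ⟨(smul_mem_measures hA ha).2, (smul_mem_measures hB hb).2, h.mono fun Q _ _ hQ => ?_⟩
  obtain ⟨x, y, h⟩ := hQ
  exact ⟨x * a, y * b, by rw [h]; ext (i | i) <;> simp [mul_assoc]⟩

theorem Bal.opt_smul {A : α → ℝ} {B : β → ℝ} {a b : ℝ}
    (ha : 0 < a) (hb : 0 < b) (h : Bal S (a • A) (b • B)) :
    Opt S (Sum.elim (a • A) (b • B)) (sumSub A B) := by
  refine h.opt.mono fun Q _ _ hQ => ?_
  obtain ⟨x, y, h⟩ := hQ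
  exact ⟨x / a, y / b, by rw [h]; ext (i | i) <;> simp [smul_smul, ha.ne', hb.ne']⟩

/-- τ is the weight of the first measure in the optimal mixture. It may a priori be 0 or 1, in which
case no balance results; the connectedness argument below rules this out. -/
theorem exists_odds (hS : Admissible S) : ∃ τ : stdSimplex ℝ α × stdSimplex ℝ β → I,
    Continuous τ ∧ ∀ x t, t = τ x ↔
      Opt S (Sum.elim ((t : ℝ) • x.1.1) ((1 - t : ℝ) • x.2.1))
        (sumSub x.1.1 x.2.1) := by
  let m : stdSimplex ℝ α × stdSimplex ℝ β → I → (α ⊕ β → ℝ) := fun x t =>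
    Sum.elim ((t : ℝ) • x.1.1) ((1 - t : ℝ) • x.2.1)
  have hm : ∀ x t, m x t ∈ stdSimplex ℝ (α ⊕ β) := fun x t => mix_mem_stdSimplex x.1.2 x.2.2 t
  have hform : ∀ (x : stdSimplex ℝ α × stdSimplex ℝ β) (P : α ⊕ β → ℝ) (t₀ : I), (∀ i, 0 ≤ P i) →
      ∑ i, P i = 1 → P - m x t₀ ∈ sumSub x.1.1 x.2.1 → ∃ t : I, P = m x t := by
    rintro ⟨A, B⟩ P t₀ h0 h1 ⟨a, b, hab⟩
    rw [sub_eq_iff_eq_add] at hab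
    have hP : P = Sum.elim ((t₀ + a : ℝ) • A.1) ((1 - t₀ + b : ℝ) • B.1) := by
      rw [hab]
      ext (i | i) <;> simp [m] <;> ring
    have e1 : ∑ i, P (Sum.inl i) = t₀ + a := by
      simp only [hP, Sum.elim_inl, Pi.smul_apply, smul_eq_mul, ← Finset.mul_sum, A.2.2, mul_one]
    have e2 : ∑ i, P (Sum.inr i) = 1 - t₀ + b := by
      simp only [hP, Sum.elim_inr, Pi.smul_apply, smul_eq_mul, ← Finset.mul_sum, B.2.2, mul_one]
    have p1 : 0 ≤ t₀ + a := e1 ▸ Finset.sum_nonneg fun i _ => h0 _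
    have p2 : 0 ≤ 1 - t₀ + b := e2 ▸ Finset.sum_nonneg fun i _ => h0 _
    rw [Fintype.sum_sum_type, e1, e2] at h1
    refine ⟨⟨t₀ + a, p1, by linarith⟩, ?_⟩
    rw [hP]
    simp only [m]
    rw [show (1 - (t₀ + a) : ℝ) = 1 - t₀ + b by linarith]
  have hinj : ∀ x (s t : I), m x s = m x t → s = t := by
    intro x s t h
    have := congrArg (fun P : α ⊕ β → ℝ => ∑ i, P (Sum.inl i)) h
    simp only [m, Sum.elim_inl, Pi.smul_apply, smul_eq_mul, ← Finset.mul_sum, x.1.2.2, mul_one] at this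
    exact Subtype.ext this
  have hsub : ∀ x (s t : I), m x s - m x t ∈ sumSub x.1.1 x.2.1 :=
    fun x s t => sumSub_smul_sub _ _ _ _ _ _
  have hex : ∀ x, ∃ t : I, Opt S (m x t) (sumSub x.1.1 x.2.1) := by
    intro x
    have hx := hm x 0
    obtain ⟨P, hP, hs, hW⟩ := Opt.exists_of hS.uniq hx.1 (hx.2 ▸ one_pos)
      (sumSub x.1.1 x.2.1)
    obtain ⟨t, rfl⟩ := hform x P 0 hP.nonneg (hs.trans hx.2) hW
    exact ⟨t, hP⟩
  choose τ hτ using hex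
  have hiff : ∀ x t, t = τ x ↔ Opt S (m x t) (sumSub x.1.1 x.2.1) := by
    intro x t
    refine ⟨fun h => h ▸ hτ x, fun h => hinj x _ _ ?_⟩
    exact Opt.unique hS.uniq (hτ x) h ((hm x t).2.trans (hm x _).2.symm) (hsub _ _ _)
  refine ⟨τ, continuous_of_unique_max (Φ := fun z => ent S (m z.1 z.2)) ?_ fun x t => ?_, hiff⟩
  · refine (continuousOn_ent hS.cont).comp_continuous ?_ fun z => hm _ _
    refine continuous_pi ?_
    rintro (i | i)
    · simp only [m, Sum.elim_inl, Pi.smul_apply, smul_eq_mul]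
      exact (continuous_subtype_val.comp continuous_snd).mul ((continuous_apply i).comp
        (continuous_subtype_val.comp (continuous_fst.comp continuous_fst)))
    · simp only [m, Sum.elim_inr, Pi.smul_apply, smul_eq_mul]
      exact (continuous_const.sub (continuous_subtype_val.comp continuous_snd)).mul
        ((continuous_apply i).comp
          (continuous_subtype_val.comp (continuous_snd.comp continuous_fst)))
  · rw [hiff]
    constructor
    · intro h t'
      have := h.le _ (hm x t').1 ((hm x t').2.trans (hm x t).2.symm) (hsub _ _ _)
      simpa [(hm x t).2] using this
    · intro h
      refine ⟨(hm x t).1, (hm x t).2 ▸ one_pos, fun Q h0 h1 hQ => ?_⟩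
      rw [(hm x t).2] at h1 ⊢
      obtain ⟨t', rfl⟩ := hform x Q t h0 h1 hQ
      simpa using h t'

/-- Exchanging the two copies of A maps the optimum to an optimum, so the optimal weight equals its
complement and is 1/2. -/
theorem Bal.refl (hS : Admissible S) {A : α → ℝ} (hA : A ∈ measures α) : Bal S A A := by
  obtain ⟨τ, -, hτ⟩ := exists_odds (α := α) (β := α) hS
  set B : stdSimplex ℝ α := ⟨_, normalize_mem hA.1 hA.2⟩ with hB
  have h := (hτ (B, B) _).1 rfl
  have h2 := h.equiv hS.sub (Equiv.sumComm α α)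
  have h3 : σ (τ (B, B)) = τ (B, B) := by
    rw [hτ]
    convert h2.mono (W' := sumSub B.1 B.1) fun Q _ _ hQ => ?_ using 1
    · ext (i | i) <;> simp
    · obtain ⟨a, b, hab⟩ := hQ
      rw [hab]
      exact ⟨b, a, by ext (i | i) <;> simp [LinearMap.funLeft_apply]⟩
  have h4 : (τ (B, B) : ℝ) = 1 / 2 := by
    have := congrArg Subtype.val h3
    simp only [unitInterval.coe_symm_eq] at this
    linarith
  rw [h4] at h
  norm_num at h
  have h5 := Bal.of_smul (mem_measures_of_mem_stdSimplex B.2) (mem_measures_of_mem_stdSimplex B.2)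
    (by norm_num) (by norm_num) h
  have h6 := h5.smul (mul_pos two_pos hA.2)
  have h7 : (2 * ∑ i, A i) • ((1 / 2 : ℝ) • B.1) = A := by
    ext i
    have := hA.2.ne'
    simp only [hB, Pi.smul_apply, smul_eq_mul]
    field_simp
  rwa [h7] at h6

/-- Being balanced up to a factor is an equivalence relation. The optimal weight is 1/2 on the
diagonal, hence by continuity strictly between 0 and 1 nearby, so classes are open; the simplex is
connected, so there is only one. -/
theorem exists_bal_of_mem_stdSimplex (hS : Admissible S) {A B : α → ℝ}
    (hA : A ∈ stdSimplex ℝ α) (hB : B ∈ stdSimplex ℝ α) : ∃ c : ℝ, 0 < c ∧ Bal S (c • A) B := by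
  obtain ⟨τ, hc, hτ⟩ := exists_odds (α := α) (β := α) hS
  have hpre : IsPreconnected (stdSimplex ℝ α) := (convex_stdSimplex ℝ α).isPreconnected
  refine hpre.induction₂ (fun A B => ∃ c : ℝ, 0 < c ∧ Bal S (c • A) B) ?_ ?_ ?_ hA hB
  · intro A hA
    have hself : τ (⟨A, hA⟩, ⟨A, hA⟩) ∈ Ioo (0 : I) 1 := by
      have h := (Bal.refl hS (mem_measures_of_mem_stdSimplex hA)).smul (c := 1 / 2) (by norm_num)
      have h2 := h.opt_smul (by norm_num) (by norm_num)
      have : (⟨1 / 2, by norm_num, by norm_num⟩ : I) = τ (⟨A, hA⟩, ⟨A, hA⟩) := by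
        rw [hτ]
        norm_num
        norm_num at h2
        exact h2
      rw [← this]
      constructor <;> rw [← Subtype.coe_lt_coe] <;> norm_num
    have hev : ∀ᶠ B : stdSimplex ℝ α in 𝓝 ⟨A, hA⟩, τ (⟨A, hA⟩, B) ∈ Ioo (0 : I) 1 :=
      (hc.comp (Continuous.prodMk_right _)).continuousAt.eventually
        (isOpen_Ioo.mem_nhds hself)
    rw [nhdsWithin_eq_map_subtype_coe hA, eventually_map]
    filter_upwards [hev] with B hB
    have h := (hτ (⟨A, hA⟩, B) _).1 rfl
    set t := τ (⟨A, hA⟩, B)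
    have ht0 : (0 : ℝ) < t := hB.1
    have ht1 : (0 : ℝ) < 1 - t := sub_pos.2 hB.2
    have h2 := (Bal.of_smul (mem_measures_of_mem_stdSimplex hA)
      (mem_measures_of_mem_stdSimplex B.2) ht0 ht1 h).smul (inv_pos.2 ht1)
    refine ⟨(1 - t : ℝ)⁻¹ * t, by positivity, ?_⟩
    rwa [smul_smul, smul_smul, inv_mul_cancel₀ ht1.ne', one_smul] at h2
  · rintro A B C - - - ⟨c, hc, h⟩ ⟨d, hd, h'⟩
    refine ⟨d * c, mul_pos hd hc, ?_⟩
    rw [mul_smul]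
    have h1 : Bal S (d • c • A) (d • B) := h.smul hd
    exact h1.trans hS.uniq hS.sub h'
  · rintro A B - - ⟨c, hc, h⟩
    refine ⟨c⁻¹, inv_pos.2 hc, ?_⟩
    have := (h.symm hS.sub).smul (inv_pos.2 hc)
    rwa [smul_smul, inv_mul_cancel₀ hc.ne', one_smul] at this

end

end MaxEntInference

namespace MaxEntInference

open Topology Filter Set unitInterval

/-! ### The scale of a measure -/

section
variable {S : EntropyFunctional} {ι α β α' β' : Type} [Fintype ι] [Fintype α] [Fintype β]
  [Fintype α'] [Fintype β']

/-- Both measures, extended by zero, live on α ⊕ β, and null states do not affect balance. -/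
theorem exists_bal (hS : Admissible S) {A : α → ℝ} {B : β → ℝ}
    (hA : A ∈ measures α) (hB : B ∈ measures β) : ∃ c : ℝ, 0 < c ∧ Bal S (c • A) B := by
  set A₁ : α ⊕ β → ℝ := Sum.elim A 0 with hA₁
  set B₁ : α ⊕ β → ℝ := Sum.elim 0 B with hB₁
  have mA : A₁ ∈ measures (α ⊕ β) :=
    ⟨by rintro (i | i); exacts [hA.1 i, le_rfl], by simpa [hA₁] using hA.2⟩
  have mB : B₁ ∈ measures (α ⊕ β) :=
    ⟨by rintro (i | i); exacts [le_rfl, hB.1 i], by simpa [hB₁] using hB.2⟩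
  obtain ⟨c, hc, h⟩ := exists_bal_of_mem_stdSimplex hS (normalize_mem mA.1 mA.2)
    (normalize_mem mB.1 mB.2)
  have h1 := h.smul mB.2
  have e2 : (∑ i, B₁ i) • (∑ i, B₁ i)⁻¹ • B₁ = B₁ := by
    rw [smul_smul, mul_inv_cancel₀ mB.2.ne', one_smul]
  rw [e2, smul_smul, smul_smul] at h1
  set d := (∑ i, B₁ i) * c * (∑ i, A₁ i)⁻¹ with hd
  have hd0 : 0 < d := mul_pos (mul_pos mB.2 hc) (inv_pos.2 mA.2)
  refine ⟨d, hd0, ?_⟩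
  have h2 : Bal S (d • A) B₁ :=
    (Bal.comp_embedding hS.uniq hS.sub (j := (Sum.inl : α → α ⊕ β)) Sum.inl_injective
      (P := d • A₁) (smul_mem_measures mA hd0).1 (by
        rintro (i | i) hi
        · simp at hi
        · simp [hA₁])).2 h1
  have h3 : Bal S B (d • A) :=
    (Bal.comp_embedding hS.uniq hS.sub (j := (Sum.inr : β → α ⊕ β)) Sum.inr_injective
      (P := B₁) mB.1 (by
        rintro (i | i) hi
        · simp [hB₁]
        · simp at hi)).2 (h2.symm hS.sub)
  exact h3.symm hS.sub

open Classical in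
/-- The mass of a single state that is balanced with `A`. -/
noncomputable def eps (S : EntropyFunctional) (A : α → ℝ) : ℝ :=
  if h : ∃ c : ℝ, 0 < c ∧ Bal S A (fun _ : Unit => c) then h.choose else 0

theorem eps_spec (hS : Admissible S) {A : α → ℝ} (hA : A ∈ measures α) :
    0 < eps S A ∧ Bal S A (fun _ : Unit => eps S A) := by
  have h : ∃ c : ℝ, 0 < c ∧ Bal S A (fun _ : Unit => c) := by
    obtain ⟨c, hc, h⟩ := exists_bal hS hA (B := fun _ : Unit => 1) ⟨by simp, by simp⟩
    refine ⟨c⁻¹, inv_pos.2 hc, ?_⟩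
    have := h.smul (inv_pos.2 hc)
    rw [smul_smul, inv_mul_cancel₀ hc.ne', one_smul] at this
    convert this using 1
    ext
    simp
  rw [eps, dif_pos h]
  exact h.choose_spec

theorem eps_pos (hS : Admissible S) {A : α → ℝ} (hA : A ∈ measures α) : 0 < eps S A :=
  (eps_spec hS hA).1

theorem Bal.mem_left {A : α → ℝ} {B : β → ℝ} (h : Bal S A B) : A ∈ measures α :=
  ⟨h.nonneg_left, h.pos_left⟩

/-- Two point masses balanced with the same A would give mixtures of A and one point mass, both
optimal, with different odds. -/
theorem eps_eq_of_bal (hS : Admissible S) {A : α → ℝ} {c : ℝ}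
    (h : Bal S A (fun _ : Unit => c)) : eps S A = c := by
  obtain ⟨h0, h1⟩ := eps_spec hS h.mem_left
  have hc : 0 < c := by simpa using h.pos_right
  have : (1 : ℝ) = c / eps S A := by
    refine h1.eq_of_opt hS.uniq ?_
    have e : (c / eps S A) • (fun _ : Unit => eps S A) = fun _ : Unit => c := by
      ext
      simp [h0.ne']
    rw [e, one_smul]
    refine h.opt.mono fun Q _ _ hQ => ?_
    obtain ⟨a, b, hab⟩ := hQ
    refine ⟨a, b * (eps S A / c), ?_⟩
    rw [hab]
    ext (i | i)
    · simp
    · simp only [Sum.elim_inr, Pi.smul_apply, smul_eq_mul]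
      field_simp
  rw [eq_div_iff h0.ne', one_mul] at this
  exact this

theorem bal_iff (hS : Admissible S) {A : α → ℝ} {B : β → ℝ} (hA : A ∈ measures α)
    (hB : B ∈ measures β) : Bal S A B ↔ eps S A = eps S B := by
  constructor
  · intro h
    exact eps_eq_of_bal hS (h.trans hS.uniq hS.sub (eps_spec hS hB).2)
  · intro h
    refine (eps_spec hS hA).2.trans hS.uniq hS.sub ?_
    rw [h]
    exact (eps_spec hS hB).2.symm hS.sub

theorem eps_smul (hS : Admissible S) {A : α → ℝ} (hA : A ∈ measures α) {c : ℝ} (hc : 0 < c) :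
    eps S (c • A) = c * eps S A :=
  eps_eq_of_bal hS ((eps_spec hS hA).2.smul hc)

theorem eps_comp (hS : Admissible S) {j : α → ι} (hj : Function.Injective j) {P : ι → ℝ}
    (hP : P ∈ measures ι) (h0 : ∀ i, i ∉ Set.range j → P i = 0) : eps S (P ∘ j) = eps S P :=
  eps_eq_of_bal hS ((Bal.comp_embedding hS.uniq hS.sub hj hP.1 h0).2 (eps_spec hS hP).2)

theorem eps_const (hS : Admissible S) [Nonempty α] {c : ℝ} (hc : 0 < c) :
    eps S (fun _ : α => c) = c :=
  eps_eq_of_bal hS (Bal.const hS.max hc)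

theorem eps_single (hS : Admissible S) [DecidableEq α] (i : α) {c : ℝ} (hc : 0 < c) :
    eps S (Pi.single i c) = c := by
  have h : Pi.single i c ∈ measures α :=
    ⟨fun k => by by_cases h : k = i <;> simp [h, hc.le], by simpa using hc⟩
  rw [← eps_comp hS (j := fun _ : Unit => i) (fun _ _ _ => rfl) h fun k hk => ?_]
  · convert eps_const hS (α := Unit) hc using 1
    congr 1
    ext
    simp
  · rw [Pi.single_eq_of_ne]
    rintro rfl
    exact hk ⟨(), rfl⟩

theorem eps_sum_elim_of_eq (hS : Admissible S) {A : α → ℝ} {B : β → ℝ} (hA : A ∈ measures α)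
    (hB : B ∈ measures β) (h : eps S A = eps S B) : eps S (Sum.elim A B) = eps S A := by
  refine eps_eq_of_bal hS ((eps_spec hS hA).2.sum_left hS.uniq hS.sub ?_)
  rw [h]
  exact (eps_spec hS hB).2

/-- The scale of a sum depends on its summands only through their scales and the proportion of their
masses. -/
theorem eps_sum_elim_congr (hS : Admissible S) {A : α → ℝ} {B : β → ℝ} {A' : α' → ℝ} {B' : β' → ℝ}
    (hA : A ∈ measures α) (hB : B ∈ measures β) (hA' : A' ∈ measures α') (hB' : B' ∈ measures β')
    (h : eps S A = eps S A') (h' : eps S B = eps S B') {κ : ℝ}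
    (eA : ∑ i, A' i = κ * ∑ i, A i) (eB : ∑ i, B' i = κ * ∑ i, B i) :
    eps S (Sum.elim A B) = eps S (Sum.elim A' B') :=
  (bal_iff hS (sum_elim_mem_measures hA hB) (sum_elim_mem_measures hA' hB')).1
    (Bal.sum_sum hS.uniq hS.sub ((bal_iff hS hA hA').2 h) ((bal_iff hS hB hB').2 h') eA eB)

/-- Up to normalization, balance with a point mass is optimality of a mixture with the unit mass u,
so `eps` is the odds ratio (1 - τ) / τ. -/
theorem continuous_eps_stdSimplex (hS : Admissible S) :
    Continuous fun A : stdSimplex ℝ α => eps S A.1 := by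
  obtain ⟨τ, hc, hτ⟩ := exists_odds (α := α) (β := Unit) hS
  let u : stdSimplex ℝ Unit := ⟨fun _ => 1, by simp, by simp⟩
  have key : ∀ A : stdSimplex ℝ α, (0 : ℝ) < τ (A, u) ∧
      eps S A.1 = (1 - τ (A, u) : ℝ) / τ (A, u) := by
    intro A
    obtain ⟨h0, h⟩ := eps_spec hS (mem_measures_of_mem_stdSimplex A.2)
    set c := eps S A.1 with hcdef
    have hc0 : 0 < (1 + c)⁻¹ := by positivity
    have h1 := h.smul hc0
    have e : (1 + c)⁻¹ • (fun _ : Unit => c) = (1 - (1 + c)⁻¹) • fun _ : Unit => (1 : ℝ) := by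
      ext
      simp only [Pi.smul_apply, smul_eq_mul]
      field_simp
      ring
    have hc1 : 0 < 1 - (1 + c)⁻¹ := by
      have : (1 + c)⁻¹ * c = 1 - (1 + c)⁻¹ := by field_simp; ring
      rw [← this]
      positivity
    rw [e] at h1
    have h2 := h1.opt_smul hc0 hc1
    have h3 : (⟨(1 + c)⁻¹, hc0.le, by linarith⟩ : I) = τ (A, u) := (hτ (A, u) _).2 h2
    rw [← h3]
    refine ⟨hc0, ?_⟩
    simp only
    field_simp
    ring
  have : (fun A : stdSimplex ℝ α => eps S A.1)
      = fun A => (1 - τ (A, u) : ℝ) / τ (A, u) := funext fun A => (key A).2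
  rw [this]
  have hcont : Continuous fun A : stdSimplex ℝ α => (τ (A, u) : ℝ) :=
    continuous_subtype_val.comp (hc.comp (Continuous.prodMk_left u))
  exact (continuous_const.sub hcont).div hcont fun A => (key A).1.ne'

theorem continuousOn_eps (hS : Admissible S) : ContinuousOn (eps S) (measures α) := by
  rw [continuousOn_iff_continuous_domRestrict]
  let N : measures α → stdSimplex ℝ α := fun A => ⟨_, normalize_mem A.2.1 A.2.2⟩
  have hsum : Continuous fun A : measures α => ∑ i, A.1 i := by fun_prop
  have hN : Continuous N := Continuous.subtype_mk
    ((hsum.inv₀ fun A => A.2.2.ne').smul continuous_subtype_val) _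
  have : (measures α).domRestrict (eps S) = fun A => (∑ i, A.1 i) * eps S (N A).1 := by
    ext A
    have := eps_smul hS (mem_measures_of_mem_stdSimplex (N A).2) A.2.2
    rw [← this]
    simp [N, smul_smul, A.2.2.ne', domRestrict]
  rw [this]
  exact hsum.mul ((continuous_eps_stdSimplex hS).comp hN)

/-- Intermediate values between the uniform distribution, of scale 1/n by maximality, and a vertex,
of scale 1. -/
theorem exists_eps_eq (hS : Admissible S) {n : ℕ} (hn : 0 < n) {v : ℝ} (h0 : (n : ℝ)⁻¹ ≤ v)
    (h1 : v ≤ 1) : ∃ A ∈ stdSimplex ℝ (Fin n), eps S A = v := by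
  have : Nonempty (Fin n) := ⟨⟨0, hn⟩⟩
  have hn' : (0 : ℝ) < n := by exact_mod_cast hn
  have hu : (fun _ : Fin n => (n : ℝ)⁻¹) ∈ stdSimplex ℝ (Fin n) :=
    ⟨fun _ => by positivity, by simp [hn'.ne']⟩
  have hs : (Pi.single ⟨0, hn⟩ 1 : Fin n → ℝ) ∈ stdSimplex ℝ (Fin n) := single_mem_stdSimplex _ _
  have := (convex_stdSimplex ℝ (Fin n)).isPreconnected.intermediate_value hu hs
    ((continuousOn_eps hS).mono fun A hA => mem_measures_of_mem_stdSimplex hA)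
  rw [eps_const hS (by positivity), eps_single hS _ one_pos] at this
  exact this ⟨h0, h1⟩

end

end MaxEntInference

namespace MaxEntInference

open Topology Filter Set

/-! ### The mean of two values -/

section
variable {S : EntropyFunctional} {ι α β α' β' : Type} [Fintype ι] [Fintype α] [Fintype β]
  [Fintype α'] [Fintype β']

/-- `A` has mass `t`, and value `x` unless it vanishes. -/
structure HasEps (S : EntropyFunctional) (A : α → ℝ) (t x : ℝ) : Prop where
  nonneg : ∀ i, 0 ≤ A i
  sum : ∑ i, A i = t
  eps : 0 < t → eps S A = x

theorem HasEps.mem {A : α → ℝ} {t x : ℝ} (h : HasEps S A t x) (ht : 0 < t) : A ∈ measures α :=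
  ⟨h.nonneg, h.sum ▸ ht⟩

theorem HasEps.mass_nonneg {A : α → ℝ} {t x : ℝ} (h : HasEps S A t x) : 0 ≤ t :=
  h.sum ▸ Finset.sum_nonneg fun i _ => h.nonneg i

theorem HasEps.eq_zero {A : α → ℝ} {x : ℝ} (h : HasEps S A 0 x) : A = 0 := by
  ext i
  exact (Finset.sum_eq_zero_iff_of_nonneg fun i _ => h.nonneg i).1 h.sum i (Finset.mem_univ i)

theorem hasEps_of_mem {A : α → ℝ} (hA : A ∈ measures α) : HasEps S A (∑ i, A i) (eps S A) :=
  ⟨hA.1, rfl, fun _ => rfl⟩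

theorem HasEps.smul (hS : Admissible S) {A : α → ℝ} {t x c : ℝ} (h : HasEps S A t x) (hc : 0 < c) :
    HasEps S (c • A) (c * t) (c * x) := by
  refine ⟨fun i => mul_nonneg hc.le (h.nonneg i), by simp [← Finset.mul_sum, h.sum], fun ht => ?_⟩
  have ht' := pos_of_mul_pos_right ht hc.le
  rw [eps_smul hS (h.mem ht') hc, h.eps ht']

theorem exists_hasEps (hS : Admissible S) {t x : ℝ} (hx : 0 < x) (h : t = 0 ∨ x ≤ t) :
    ∃ (n : ℕ) (A : Fin n → ℝ), HasEps S A t x := by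
  rcases h with rfl | h
  · exact ⟨0, 0, fun _ => le_rfl, by simp, fun h => (lt_irrefl _ h).elim⟩
  · have ht : 0 < t := hx.trans_le h
    obtain ⟨n, hn⟩ := exists_nat_gt (t / x)
    have hn0 : (0 : ℝ) < n := lt_trans (by positivity) hn
    obtain ⟨A, hA, he⟩ := exists_eps_eq hS (n := n) (v := x / t) (by exact_mod_cast hn0)
      (by rw [inv_le_comm₀ hn0 (by positivity), inv_div]; exact hn.le) ((div_le_one ht).2 h)
    have := (hasEps_of_mem (S := S) (mem_measures_of_mem_stdSimplex hA)).smul hS ht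
    rw [hA.2, he, mul_one, mul_div_cancel₀ _ ht.ne'] at this
    exact ⟨n, _, this⟩

theorem HasEps.sum_elim_zero_left (hS : Admissible S) {A : α → ℝ} {B : β → ℝ} {x y t : ℝ}
    (hA : HasEps S A 0 x) (hB : HasEps S B t y) : HasEps S (Sum.elim A B) t y := by
  have hA0 := hA.eq_zero
  subst hA0
  refine ⟨?_, by simp [hB.sum], fun ht => ?_⟩
  · rintro (i | i)
    exacts [le_rfl, hB.nonneg i]
  · rw [← hB.eps ht, ← eps_comp hS (j := (Sum.inr : β → α ⊕ β)) Sum.inr_injective]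
    · rfl
    · refine ⟨?_, by simpa using (hB.mem ht).2⟩
      rintro (i | i)
      exacts [le_rfl, hB.nonneg i]
    · rintro (i | i) hi
      · simp
      · simp at hi

theorem HasEps.comp_equiv (hS : Admissible S) (e : α ≃ ι) {P : ι → ℝ} {t x : ℝ}
    (h : HasEps S P t x) : HasEps S (P ∘ e) t x := by
  refine ⟨fun i => h.nonneg _, (e.sum_comp P).trans h.sum, fun ht => ?_⟩
  rw [eps_comp hS e.injective (h.mem ht) fun i hi => (hi ⟨e.symm i, by simp⟩).elim, h.eps ht]

theorem HasEps.swap (hS : Admissible S) {A : α → ℝ} {B : β → ℝ} {x t : ℝ}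
    (h : HasEps S (Sum.elim A B) t x) : HasEps S (Sum.elim B A) t x := by
  convert h.comp_equiv hS (Equiv.sumComm β α) using 1
  ext (i | i) <;> rfl

theorem HasEps.sum_elim_zero_right (hS : Admissible S) {A : α → ℝ} {B : β → ℝ} {x y t : ℝ}
    (hA : HasEps S A t x) (hB : HasEps S B 0 y) : HasEps S (Sum.elim A B) t x :=
  (hB.sum_elim_zero_left hS hA).swap hS

theorem HasEps.sum_elim (hS : Admissible S) {A : α → ℝ} {B : β → ℝ} {x s t : ℝ}
    (hA : HasEps S A s x) (hB : HasEps S B t x) : HasEps S (Sum.elim A B) (s + t) x := by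
  rcases hA.mass_nonneg.lt_or_eq with hs | rfl
  · rcases hB.mass_nonneg.lt_or_eq with ht | rfl
    · have mA := hA.mem hs
      have mB := hB.mem ht
      refine ⟨(sum_elim_mem_measures mA mB).1, by simp [hA.sum, hB.sum], fun _ => ?_⟩
      rw [eps_sum_elim_of_eq hS mA mB (by rw [hA.eps hs, hB.eps ht]), hA.eps hs]
    · rw [add_zero]
      exact hA.sum_elim_zero_right hS hB
  · rw [zero_add]
    exact hA.sum_elim_zero_left hS hB

open Classical in
/-- The value of the sum of measures of values `x` and `y`, the proportion of the first being `l`. -/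
noncomputable def mean (S : EntropyFunctional) (l x y : ℝ) : ℝ :=
  if h : ∃ z, ∃ (m n : ℕ) (A : Fin m → ℝ) (B : Fin n → ℝ) (s t : ℝ),
    HasEps S A s x ∧ HasEps S B t y ∧ 0 < s ∧ 0 < t ∧ l = s / (s + t) ∧ eps S (Sum.elim A B) = z
  -- Positive s and t force 0 < l < 1; at the endpoints the default supplies the value of the only
  -- part that is left.
  then h.choose else if l = 0 then y else x

theorem HasEps.sum_elim_mean (hS : Admissible S) {A : α → ℝ} {B : β → ℝ} {x y s t : ℝ} (hx : 0 < x)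
    (hy : 0 < y) (hA : HasEps S A s x) (hB : HasEps S B t y) :
    HasEps S (Sum.elim A B) (s + t) (mean S (s / (s + t)) x y) := by
  rcases hA.mass_nonneg.lt_or_eq with hs | rfl
  · rcases hB.mass_nonneg.lt_or_eq with ht | rfl
    · have mA := hA.mem hs
      have mB := hB.mem ht
      refine ⟨(sum_elim_mem_measures mA mB).1, by simp [hA.sum, hB.sum], fun _ => ?_⟩
      have hex : ∃ z, ∃ (m n : ℕ) (A : Fin m → ℝ) (B : Fin n → ℝ) (s' t' : ℝ),
          HasEps S A s' x ∧ HasEps S B t' y ∧ 0 < s' ∧ 0 < t' ∧ s / (s + t) = s' / (s' + t') ∧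
            MaxEntInference.eps S (Sum.elim A B) = z := by
        -- The common factor T keeps the proportion and gives T s ≥ x and T t ≥ y, so that measures
        -- of these masses and scales exist.
        set T := x / s + y / t with hT
        have hT0 : 0 < T := by positivity
        obtain ⟨m, A', hA'⟩ := exists_hasEps hS (t := T * s) hx (Or.inr (by
          rw [hT, add_mul, div_mul_cancel₀ _ hs.ne']
          exact le_add_of_nonneg_right (by positivity)))
        obtain ⟨n, B', hB'⟩ := exists_hasEps hS (t := T * t) hy (Or.inr (by
          rw [hT, add_mul, div_mul_cancel₀ _ ht.ne']
          exact le_add_of_nonneg_left (by positivity)))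
        refine ⟨_, m, n, A', B', _, _, hA', hB', by positivity, by positivity, ?_, rfl⟩
        rw [← mul_add, mul_div_mul_left _ _ hT0.ne']
      rw [MaxEntInference.mean, dif_pos hex]
      obtain ⟨m, n, A', B', s', t', hA', hB', hs', ht', hl, hz⟩ := hex.choose_spec
      rw [← hz]
      rw [div_eq_div_iff (by positivity) (by positivity)] at hl
      have hl' : s * t' = s' * t := by linarith
      refine eps_sum_elim_congr hS mA mB (hA'.mem hs') (hB'.mem ht') ?_ ?_ (κ := s' / s) ?_ ?_
      · rw [hA.eps hs, hA'.eps hs']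
      · rw [hB.eps ht, hB'.eps ht']
      · rw [hA.sum, hA'.sum, div_mul_cancel₀ _ hs.ne']
      · rw [hB.sum, hB'.sum]
        field_simp
        linarith
    · have : MaxEntInference.mean S 1 x y = x := by
        rw [MaxEntInference.mean, dif_neg, if_neg one_ne_zero]
        rintro ⟨z, m, n, A, B, s', t', -, -, hs', ht', h, -⟩
        rw [eq_div_iff (by positivity)] at h
        linarith
      rw [add_zero, div_self hs.ne', this]
      exact hA.sum_elim_zero_right hS hB
  · have : MaxEntInference.mean S 0 x y = y := by
      rw [MaxEntInference.mean, dif_neg, if_pos rfl]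
      rintro ⟨z, m, n, A, B, s', t', -, -, hs', ht', h, -⟩
      rw [eq_div_iff (by positivity)] at h
      linarith
    rw [zero_add, zero_div, this]
    exact hA.sum_elim_zero_left hS hB

/-- A homogeneous weighted mean of pairs of positive numbers, which is not assumed to be internal. -/
structure IsWeightedMean (M : ℝ → ℝ → ℝ → ℝ) : Prop where
  pos : ∀ {l x y}, l ∈ Icc (0 : ℝ) 1 → 0 < x → 0 < y → 0 < M l x y
  zero : ∀ {x y}, 0 < x → 0 < y → M 0 x y = y
  one : ∀ {x y}, 0 < x → 0 < y → M 1 x y = x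
  bisymm : ∀ {m l l' x y}, m ∈ Icc (0 : ℝ) 1 → l ∈ Icc (0 : ℝ) 1 → l' ∈ Icc (0 : ℝ) 1 → 0 < x →
    0 < y → M m (M l x y) (M l' x y) = M (m * l + (1 - m) * l') x y
  homog : ∀ {l x y k}, l ∈ Icc (0 : ℝ) 1 → 0 < x → 0 < y → 0 < k → M l (k * x) (k * y) = k * M l x y
  cont : ∀ {x y}, 0 < x → 0 < y → ContinuousOn (fun l => M l x y) (Ioo 0 1)
  cont_scale : ∀ {a b x y}, 0 < a → 0 < b → 0 < x → 0 < y →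
    ContinuousOn (fun c => M (a / (a + c * b)) x (c * y)) (Ioi 0)
  exists_ne : ∀ {x y}, 0 < x → 0 < y → x ≠ y → ∃ l ∈ Ioo (0 : ℝ) 1, ∃ l' ∈ Ioo (0 : ℝ) 1,
    M l x y ≠ M l' x y

theorem mean_zero (hS : Admissible S) {x y : ℝ} (hx : 0 < x) (hy : 0 < y) : mean S 0 x y = y := by
  obtain ⟨m, A, hA⟩ := exists_hasEps hS hx (Or.inl rfl)
  obtain ⟨n, B, hB⟩ := exists_hasEps hS hy (Or.inr le_rfl)
  have h := hA.sum_elim_mean hS hx hy hB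
  have h' := hA.sum_elim_zero_left hS hB
  rw [zero_add, zero_div] at h
  rw [← h.eps hy, h'.eps hy]

theorem mean_one (hS : Admissible S) {x y : ℝ} (hx : 0 < x) (hy : 0 < y) : mean S 1 x y = x := by
  obtain ⟨m, A, hA⟩ := exists_hasEps hS hx (Or.inr le_rfl)
  obtain ⟨n, B, hB⟩ := exists_hasEps hS hy (Or.inl rfl)
  have h := hA.sum_elim_mean hS hx hy hB
  have h' := hA.sum_elim_zero_right hS hB
  rw [add_zero, div_self hx.ne'] at h
  rw [← h.eps hx, h'.eps hx]

theorem mul_eq_zero_or_le {w T x : ℝ} (hw : 0 ≤ w) (hT : 0 < w → x / w ≤ T) :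
    w * T = 0 ∨ x ≤ w * T := by
  rcases hw.lt_or_eq with h | h
  · right
    have := hT h
    rwa [div_le_iff₀' h] at this
  · left
    simp [← h]

/-- Measures of prescribed values whose masses are proportional to prescribed weights. -/
theorem exists_hasEps_family (hS : Admissible S) {κ : Type} [Finite κ] (w x : κ → ℝ)
    (hw : ∀ i, 0 ≤ w i) (hx : ∀ i, 0 < x i) :
    ∃ T : ℝ, 0 < T ∧ ∀ i, ∃ (n : ℕ) (A : Fin n → ℝ), HasEps S A (w i * T) (x i) := by
  have : ∃ T : ℝ, ∀ i, x i / w i ≤ T := by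
    obtain ⟨T, hT⟩ := (Set.finite_range fun i => x i / w i).bddAbove
    exact ⟨T, fun i => hT ⟨i, rfl⟩⟩
  obtain ⟨T, hT⟩ := this
  refine ⟨max T 1, by positivity, fun i => exists_hasEps hS (hx i) ?_⟩
  exact mul_eq_zero_or_le (hw i) fun _ => (hT i).trans (le_max_left _ _)

theorem mean_pos (hS : Admissible S) {l x y : ℝ} (hl : l ∈ Icc (0 : ℝ) 1) (hx : 0 < x)
    (hy : 0 < y) : 0 < mean S l x y := by
  obtain ⟨T, hT, h⟩ := exists_hasEps_family hS ![l, 1 - l] ![x, y]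
    (by intro i; fin_cases i <;> simp [hl.1, hl.2]) (by intro i; fin_cases i <;> simp [hx, hy])
  obtain ⟨m, A, hA⟩ := h 0
  obtain ⟨n, B, hB⟩ := h 1
  have h := HasEps.sum_elim_mean hS hx hy hA hB
  have e : l * T + (1 - l) * T = T := by ring
  have e2 : l * T / T = l := by field_simp
  simp only [Matrix.cons_val_zero, Matrix.cons_val_one, e, e2] at h
  rw [← h.eps hT]
  exact eps_pos hS (h.mem hT)

theorem mean_homog (hS : Admissible S) {l x y k : ℝ} (hl : l ∈ Icc (0 : ℝ) 1) (hx : 0 < x)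
    (hy : 0 < y) (hk : 0 < k) : mean S l (k * x) (k * y) = k * mean S l x y := by
  obtain ⟨T, hT, h⟩ := exists_hasEps_family hS ![l, 1 - l] ![x, y]
    (by intro i; fin_cases i <;> simp [hl.1, hl.2]) (by intro i; fin_cases i <;> simp [hx, hy])
  obtain ⟨m, A, hA⟩ := h 0
  obtain ⟨n, B, hB⟩ := h 1
  have h1 := (HasEps.sum_elim_mean hS hx hy hA hB).smul hS hk
  have h2 := HasEps.sum_elim_mean hS (mul_pos hk hx) (mul_pos hk hy) (hA.smul hS hk) (hB.smul hS hk)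
  have e : l * T + (1 - l) * T = T := by ring
  have e2 : l * T / T = l := by field_simp
  have e3 : k * (l * T) + k * ((1 - l) * T) = k * T := by ring
  have e4 : k * (l * T) / (k * T) = l := by field_simp
  simp only [Matrix.cons_val_zero, Matrix.cons_val_one, e, e2, e3, e4] at h1 h2
  rw [← h1.eps (by positivity), ← h2.eps (by positivity)]
  congr 1
  ext (i | i) <;> simp

/-- Four measures of scales x, y, x, y are added in two ways: pairing x with y first gives the left
side, and merging the two of scale x and the two of scale y first gives the right side. -/
theorem mean_bisymm (hS : Admissible S) {m l l' x y : ℝ} (hm : m ∈ Icc (0 : ℝ) 1)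
    (hl : l ∈ Icc (0 : ℝ) 1) (hl' : l' ∈ Icc (0 : ℝ) 1) (hx : 0 < x) (hy : 0 < y) :
    mean S m (mean S l x y) (mean S l' x y) = mean S (m * l + (1 - m) * l') x y := by
  have hm1 : 0 ≤ 1 - m := sub_nonneg.2 hm.2
  have hl1 : 0 ≤ 1 - l := sub_nonneg.2 hl.2
  have hl1' : 0 ≤ 1 - l' := sub_nonneg.2 hl'.2
  obtain ⟨T, hT, h⟩ := exists_hasEps_family hS ![m * l, m * (1 - l), (1 - m) * l', (1 - m) * (1 - l')]
    ![x, y, x, y]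
    (by intro i; fin_cases i; exacts [mul_nonneg hm.1 hl.1, mul_nonneg hm.1 hl1,
          mul_nonneg hm1 hl'.1, mul_nonneg hm1 hl1'])
    (by intro i; fin_cases i <;> simp [hx, hy])
  obtain ⟨_, A, hA⟩ := h 0
  obtain ⟨_, B, hB⟩ := h 1
  obtain ⟨_, A', hA'⟩ := h 2
  obtain ⟨_, B', hB'⟩ := h 3
  simp only [Matrix.cons_val] at hA hB hA' hB'
  have h1 : HasEps S (Sum.elim A B) (m * T) (mean S l x y) := by
    have := hA.sum_elim_mean hS hx hy hB
    rw [show m * l * T + m * (1 - l) * T = m * T by ring] at this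
    refine ⟨this.nonneg, this.sum, fun h => ?_⟩
    rw [this.eps h]
    congr 1
    field_simp [left_ne_zero_of_mul h.ne']
  have h2 : HasEps S (Sum.elim A' B') ((1 - m) * T) (mean S l' x y) := by
    have := hA'.sum_elim_mean hS hx hy hB'
    rw [show (1 - m) * l' * T + (1 - m) * (1 - l') * T = (1 - m) * T by ring] at this
    refine ⟨this.nonneg, this.sum, fun h => ?_⟩
    rw [this.eps h]
    congr 1
    have := left_ne_zero_of_mul h.ne'
    field_simp
  have h3 := h1.sum_elim_mean hS (mean_pos hS hl hx hy) (mean_pos hS hl' hx hy) h2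
  have h4 := (hA.sum_elim hS hA').sum_elim_mean hS hx hy (hB.sum_elim hS hB')
  have h5 := h4.comp_equiv hS (Equiv.sumSumSumComm _ _ _ _)
  rw [show m * T + (1 - m) * T = T by ring, show m * T / T = m by field_simp] at h3
  rw [show m * l * T + (1 - m) * l' * T + (m * (1 - l) * T + (1 - m) * (1 - l') * T) = T by ring,
    show (m * l * T + (1 - m) * l' * T) / T = m * l + (1 - m) * l' by field_simp] at h5
  rw [← h3.eps hT, ← h5.eps hT]
  congr 1
  ext ((i | i) | (i | i)) <;> rfl

/-- A continuous map from a compact space is closed onto its range, so continuity of g can be tested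
after composing with f. -/
theorem continuousOn_range_of_comp {K : Type*} [TopologicalSpace K] [CompactSpace K]
    {g : ℝ → ℝ} {f h : K → ℝ} (hf : Continuous f) (hh : Continuous h) (hg : ∀ k, g (f k) = h k) :
    ContinuousOn g (range f) := by
  rw [continuousOn_iff_isClosed]
  intro F hF
  refine ⟨f '' (h ⁻¹' F), ((hF.preimage hh).isCompact.image hf).isClosed, ?_⟩
  ext r
  constructor
  · rintro ⟨hr, k, rfl⟩
    exact ⟨⟨k, by rw [mem_preimage, ← hg]; exact hr, rfl⟩, k, rfl⟩
  · rintro ⟨⟨k, hk, rfl⟩, hr⟩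
    refine ⟨?_, hr⟩
    rw [mem_preimage, hg]
    exact hk

/-- Fix B of scale y and mass b, and rescale each distribution θ to scale x. Its mass x / eps θ
takes all values from x to n x, so l is a continuous function of θ, and so is the scale of the sum.
-/
theorem continuousOn_mean (hS : Admissible S) {x y : ℝ} (hx : 0 < x) (hy : 0 < y) :
    ContinuousOn (fun l => mean S l x y) (Ioo 0 1) := by
  intro l hl
  have hl0 : 0 < l := hl.1
  have hl1 : 0 < 1 - l := sub_pos.2 hl.2
  -- The first measure must have mass b l / (1 - l) = y l / (1 - l) + 2 x. This exceeds x, and n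
  -- below is taken so that it is less than n x: thus l is interior to the range.
  set b := y + 2 * x * (1 - l) / l with hb
  have hb0 : 0 < b := by positivity
  obtain ⟨_, B, hB⟩ := exists_hasEps hS hy (t := b)
    (Or.inr (le_add_of_nonneg_right (by positivity)))
  obtain ⟨n, hn⟩ := exists_nat_gt (b * l / (1 - l) / x)
  have hn0 : (0 : ℝ) < n := lt_trans (by positivity) hn
  have hn0' : 0 < n := by exact_mod_cast hn0
  let A : stdSimplex ℝ (Fin n) → (Fin n → ℝ) := fun θ => (x / eps S θ.1) • θ.1
  have hepos : ∀ θ : stdSimplex ℝ (Fin n), 0 < eps S θ.1 := fun θ =>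
    eps_pos hS (mem_measures_of_mem_stdSimplex θ.2)
  have hA : ∀ θ, HasEps S (A θ) (x / eps S θ.1) x := by
    intro θ
    have := (hasEps_of_mem (S := S) (mem_measures_of_mem_stdSimplex θ.2)).smul hS
      (div_pos hx (hepos θ))
    rwa [θ.2.2, mul_one, div_mul_cancel₀ _ (hepos θ).ne'] at this
  have hce := continuous_eps_stdSimplex (α := Fin n) hS
  have hcu : Continuous fun θ : stdSimplex ℝ (Fin n) => x / eps S θ.1 :=
    continuous_const.div hce fun θ => (hepos θ).ne'
  have hcl : Continuous fun θ : stdSimplex ℝ (Fin n) => x / eps S θ.1 / (x / eps S θ.1 + b) :=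
    hcu.div (hcu.add continuous_const) fun θ => by
      have := hepos θ
      positivity
  have hch : Continuous fun θ : stdSimplex ℝ (Fin n) => eps S (Sum.elim (A θ) B) := by
    refine (continuousOn_eps hS).comp_continuous ?_ fun θ =>
      sum_elim_mem_measures ((hA θ).mem (div_pos hx (hepos θ))) (hB.mem hb0)
    refine continuous_pi ?_
    rintro (i | i)
    · exact hcu.mul ((continuous_apply i).comp continuous_subtype_val)
    · exact continuous_const
  have := continuousOn_range_of_comp (g := fun l => mean S l x y) hcl hch fun θ => by
    have := (hA θ).sum_elim_mean hS hx hy hB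
    refine (this.eps ?_).symm
    have := hepos θ
    positivity
  refine (this.continuousAt ?_).continuousWithinAt
  have hev : ∀ᶠ r in 𝓝 l, r < 1 ∧ x < b * r / (1 - r) ∧ b * r / (1 - r) < n * x := by
    have hc : ContinuousAt (fun r => b * r / (1 - r)) l := by
      refine ContinuousAt.div (by fun_prop) (by fun_prop) hl1.ne'
    refine (eventually_lt_nhds hl.2).and ((hc.eventually_const_lt ?_).and (hc.eventually_lt_const ?_))
    · rw [lt_div_iff₀ hl1, hb]
      have : 2 * x * (1 - l) / l * l = 2 * x * (1 - l) := by field_simp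
      nlinarith [mul_pos hx hl1, mul_pos hy hl0]
    · rwa [div_lt_iff₀ hx] at hn
  filter_upwards [hev] with r ⟨hr1, hr2, hr3⟩
  have hr1' : 0 < 1 - r := sub_pos.2 hr1
  set u := b * r / (1 - r) with hu
  have hu0 : 0 < u := hx.trans hr2
  obtain ⟨θ, hθ, he⟩ := exists_eps_eq hS hn0' (v := x / u)
    (by rw [inv_le_comm₀ hn0 (by positivity), inv_div, div_le_iff₀ hx]; exact hr3.le)
    ((div_le_one hu0).2 hr2.le)
  refine ⟨⟨θ, hθ⟩, ?_⟩
  simp only [he]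
  rw [div_div_cancel₀ hx.ne']
  have h1 : u * (1 - r) = b * r := by rw [hu, div_mul_cancel₀ _ hr1'.ne']
  rw [div_eq_iff (by positivity)]
  linarith

theorem continuousOn_mean_scale (hS : Admissible S) {a b x y : ℝ} (ha : 0 < a) (hb : 0 < b)
    (hx : 0 < x) (hy : 0 < y) :
    ContinuousOn (fun c => mean S (a / (a + c * b)) x (c * y)) (Ioi 0) := by
  obtain ⟨T, hT, h⟩ := exists_hasEps_family hS ![a, b] ![x, y]
    (by intro i; fin_cases i <;> simp [ha.le, hb.le]) (by intro i; fin_cases i <;> simp [hx, hy])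
  obtain ⟨m, A, hA⟩ := h 0
  obtain ⟨n, B, hB⟩ := h 1
  simp only [Matrix.cons_val] at hA hB
  have key : ∀ c ∈ Ioi (0 : ℝ), mean S (a / (a + c * b)) x (c * y) = eps S (Sum.elim A (c • B)) := by
    intro c hc
    have hc : 0 < c := hc
    have := hA.sum_elim_mean hS hx (mul_pos hc hy) (hB.smul hS hc)
    rw [this.eps (by positivity)]
    congr 1
    field_simp
  refine ContinuousOn.congr ?_ key
  refine (continuousOn_eps hS).comp (Continuous.continuousOn ?_) fun c hc =>
    sum_elim_mem_measures (hA.mem (by positivity)) (smul_mem_measures (hB.mem (by positivity)) hc)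
  refine continuous_pi ?_
  rintro (i | i)
  · exact continuous_const
  · exact continuous_id.mul continuous_const

end

end MaxEntInference

namespace MaxEntInference

open Topology Filter Set

/-! ### Optimality under redistribution between single states -/

section
variable {S : EntropyFunctional} {ι κ I J : Type} [Fintype ι] [Fintype κ] [Fintype I] [Fintype J]

/-- For each `i`, one state of mass `z i` together with states of masses `A i k`. -/
def pointed (z : ι → ℝ) (A : ι → κ → ℝ) : ι × Option κ → ℝ :=
  fun p => p.2.elim (z p.1) (A p.1)

/-- Each state of mass z i is in balance with its companion A i. Moving mass within blocks cannot
help unless the blocks are rescaled along s, and `V₀` excludes that; hence `pointed z A` is optimal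
in the larger space V. Among the moves in V are those that leave the companions alone and change
only the distinguished states, by multiples of s i times the block mass. -/
theorem Opt.of_pointed (hS : Admissible S) {z s : ι → ℝ} {A : ι → κ → ℝ} (hz : ∀ i, 0 < z i)
    (hA : ∀ i, A i ∈ measures κ) (he : ∀ i, eps S (A i) = z i) {V₀ : Submodule ℝ (ι × Option κ → ℝ)}
    (hV₀ : ∀ c : ℝ, (fun p => c * s p.1 * pointed z A p) ∈ V₀) (h : Opt S (pointed z A) V₀)
    [Nonempty ι] :
    Opt S z (Submodule.span ℝ {fun i => s i * (z i + ∑ k, A i k)}) := by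
  classical
  set m : ι → ℝ := fun i => z i + ∑ k, A i k with hm
  have hm0 : ∀ i, 0 < m i := fun i => add_pos (hz i) (hA i).2
  have hbal : ∀ i, Bal S (A i) (fun _ : Unit => z i) := fun i => he i ▸ (eps_spec hS (hA i)).2
  -- Rescale the state by a i and its companion by b i independently, subject only to the total
  -- change of block i being c times s i times its mass.
  let V : Submodule ℝ (ι × Option κ → ℝ) :=
    { carrier := {D | ∃ (c : ℝ) (a b : ι → ℝ), (∀ i, D (i, none) = a i * z i) ∧
        (∀ i k, D (i, some k) = b i * A i k) ∧
        ∀ i, a i * z i + b i * ∑ k, A i k = c * s i * m i}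
      add_mem' := by
        rintro D D' ⟨c, a, b, h1, h2, h3⟩ ⟨c', a', b', h1', h2', h3'⟩
        refine ⟨c + c', a + a', b + b', fun i => ?_, fun i k => ?_, fun i => ?_⟩
        · simp [h1, h1', add_mul]
        · simp [h2, h2', add_mul]
        · simp only [Pi.add_apply]
          linear_combination h3 i + h3' i
      zero_mem' := ⟨0, 0, 0, by simp, by simp, by simp⟩
      smul_mem' := by
        rintro t D ⟨c, a, b, h1, h2, h3⟩
        refine ⟨t * c, t • a, t • b, fun i => ?_, fun i k => ?_, fun i => ?_⟩
        · simp [h1, mul_assoc]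
        · simp [h2, mul_assoc]
        · simp only [Pi.smul_apply, smul_eq_mul]
          linear_combination t * h3 i }
  obtain ⟨P, hP, hs, c, a, b, ha, hb, hab⟩ := Opt.exists_of hS.uniq h.nonneg h.pos V
  have hPa : ∀ i, P (i, none) = (1 + a i) * z i := fun i => by
    have := ha i
    simp only [Pi.sub_apply, pointed, Option.elim] at this
    linarith
  have hPb : ∀ i k, P (i, some k) = (1 + b i) * A i k := fun i k => by
    have := hb i k
    simp only [Pi.sub_apply, pointed, Option.elim] at this
    linarith
  have key : ∀ i, 1 + b i = 1 + a i := by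
    intro i
    have na : 0 ≤ 1 + a i := nonneg_of_mul_nonneg_left (hPa i ▸ hP.nonneg _) (hz i)
    have nb : 0 ≤ 1 + b i := by
      refine nonneg_of_mul_nonneg_left (b := ∑ k, A i k) ?_ (hA i).2
      rw [Finset.mul_sum]
      exact Finset.sum_nonneg fun k _ => hPb i k ▸ hP.nonneg _
    by_cases hpos : 0 < (1 + b i) * ∑ k, A i k + (1 + a i) * z i
    · refine (hbal i).eq_of_opt hS.uniq ?_
      let j : κ ⊕ Unit → ι × Option κ := Sum.elim (fun k => (i, some k)) fun _ => (i, none)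
      have hj : Function.Injective j := by
        rintro (x | x) (y | y) hxy <;> simp_all [j]
      have hcomp : P ∘ j = Sum.elim ((1 + b i) • A i) ((1 + a i) • fun _ : Unit => z i) := by
        ext (k | k)
        · simp [j, hPb]
        · simp [j, hPa]
      rw [← hcomp]
      refine Opt.restrict hS.sub hj (hP.mono fun Q _ hsQ hQ => ?_) ?_
      · obtain ⟨⟨u, v, huv⟩, h0⟩ := hQ
        have huv1 : ∀ k, (Q - P) (i, some k) = u * A i k := fun k => congrFun huv (Sum.inl k)
        have huv2 : (Q - P) (i, none) = v * z i := congrFun huv (Sum.inr ())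
        have h0' : ∀ i' o, i' ≠ i → (Q - P) (i', o) = 0 := fun i' o hi => h0 _ (by
          rintro ⟨x | x, hx⟩ <;> simp [j] at hx <;> exact hi hx.1.symm)
        refine ⟨0, Pi.single i v, Pi.single i u, fun i' => ?_, fun i' k => ?_, fun i' => ?_⟩
        · by_cases hi : i' = i
          · subst hi
            simp [huv2]
          · simp [h0' _ _ hi, hi]
        · by_cases hi : i' = i
          · subst hi
            simp [huv1]
          · simp [h0' _ _ hi, hi]
        · by_cases hi : i' = i
          · subst hi
            have hsum : ∑ p, (Q - P) p = 0 := by simp [hsQ]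
            rw [← sum_comp_eq_of_injective hj h0] at hsum
            simp only [Fintype.sum_sum_type, j, Sum.elim_inl, Sum.elim_inr, huv1, huv2,
              ← Finset.mul_sum, Finset.univ_unique, Finset.sum_singleton] at hsum
            simp only [Pi.single_eq_same]
            linarith
          · simp [hi]
      · have : ∑ x, P (j x) = ∑ x, (P ∘ j) x := rfl
        rw [this, hcomp]
        simpa [← Finset.mul_sum] using hpos
    -- Balance says nothing about an emptied block, but there both factors are zero and agree.
    · have h1 : 0 ≤ (1 + b i) * ∑ k, A i k := mul_nonneg nb (hA i).2.le
      have h2 : 0 ≤ (1 + a i) * z i := mul_nonneg na (hz i).le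
      have e1 : (1 + b i) * ∑ k, A i k = 0 := by linarith
      have e2 : (1 + a i) * z i = 0 := by linarith
      rw [(mul_eq_zero.1 e1).resolve_right (hA i).2.ne', (mul_eq_zero.1 e2).resolve_right (hz i).ne']
  have hba : ∀ i, b i = a i := fun i => by linarith [key i]
  have hac : ∀ i, a i = c * s i := fun i => by
    refine mul_right_cancel₀ (hm0 i).ne' ?_
    rw [← hab i, hba i, hm]
    ring
  have hdiff : P - pointed z A = fun p => c * s p.1 * pointed z A p := by
    ext ⟨i, o⟩
    cases o with
    | none => rw [ha, hac]; rfl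
    | some k => rw [hb, hba, hac]; rfl
  have hmem : ∀ c : ℝ, (fun p => c * s p.1 * pointed z A p) ∈ V := fun c =>
    ⟨c, fun i => c * s i, fun i => c * s i, fun i => rfl, fun i k => rfl, fun i => by rw [hm]; ring⟩
  -- The optimum in V differs from `pointed z A` by a rescaling of blocks, which lies in both
  -- spaces; both measures are optimal in the intersection.
  have hPP : P = pointed z A := by
    have h1 : Opt S P (V ⊓ V₀) := hP.mono fun Q _ _ hQ => hQ.1
    have h2 : Opt S (pointed z A) (V ⊓ V₀) := h.mono fun Q _ _ hQ => hQ.2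
    exact Opt.unique hS.uniq h2 h1 hs (hdiff ▸ ⟨hmem c, hV₀ c⟩)
  rw [hPP] at hP
  have hz' : z = pointed z A ∘ fun i => (i, none) := rfl
  rw [hz']
  refine Opt.restrict hS.sub (fun i i' hi => (Prod.mk.inj hi).1) (hP.mono fun Q _ _ hQ => ?_)
    (Finset.sum_pos (fun i _ => hz i) Finset.univ_nonempty)
  obtain ⟨h1, h0⟩ := hQ
  obtain ⟨t, ht⟩ := Submodule.mem_span_singleton.1 h1
  have ht' : ∀ i, (Q - pointed z A) (i, none) = t * (s i * m i) := fun i => (congrFun ht i).symm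
  -- The whole change of the block is charged to the distinguished state.
  refine ⟨t, fun i => t * (s i * m i) / z i, 0, fun i => ?_, fun i k => ?_, fun i => ?_⟩
  · rw [ht', div_mul_cancel₀ _ (hz i).ne']
  · rw [h0 _ (by simp)]
    simp
  · rw [div_mul_cancel₀ _ (hz i).ne']
    simp [mul_assoc]

/-- Equal scales mean that the two composite measures are balanced, which is the hypothesis of
`Opt.of_pointed` with s = 1 on I and s = -1 on J. -/
theorem Opt.of_eps_pointed (hS : Admissible S) [Nonempty I] [Nonempty J] {x : I → ℝ} {y : J → ℝ}
    {A : I → κ → ℝ} {B : J → κ → ℝ}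
    (hx : ∀ i, 0 < x i) (hy : ∀ i, 0 < y i) (hA : ∀ i, A i ∈ measures κ)
    (hB : ∀ i, B i ∈ measures κ) (eA : ∀ i, eps S (A i) = x i) (eB : ∀ i, eps S (B i) = y i)
    (h : eps S (pointed x A) = eps S (pointed y B)) :
    Opt S (Sum.elim x y)
      (Submodule.span ℝ {Sum.elim (fun i => x i + ∑ k, A i k) fun i => -(y i + ∑ k, B i k)}) := by
  have hmem : ∀ {I : Type} [Fintype I] [Nonempty I] {x : I → ℝ} {A : I → κ → ℝ},
      (∀ i, 0 < x i) → (∀ i, A i ∈ measures κ) → pointed x A ∈ measures (I × Option κ) := by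
    intro I _ _ x A hx hA
    have h0 : ∀ p, 0 ≤ pointed x A p := by
      rintro ⟨i, _ | k⟩
      exacts [(hx i).le, (hA i).1 k]
    obtain ⟨i⟩ := ‹Nonempty I›
    exact ⟨h0, Finset.sum_pos' (fun p _ => h0 p) ⟨(i, none), Finset.mem_univ _, hx i⟩⟩
  have hbal := (bal_iff hS (hmem hx hA) (hmem hy hB)).2 h
  let e : (I ⊕ J) × Option κ ≃ (I × Option κ) ⊕ (J × Option κ) := Equiv.sumProdDistrib _ _ _
  have hpt : pointed (Sum.elim x y) (Sum.elim A B)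
      = Sum.elim (pointed x A) (pointed y B) ∘ e := by
    ext ⟨i | i, _ | k⟩ <;> rfl
  have := Opt.of_pointed hS (ι := I ⊕ J) (z := Sum.elim x y) (A := Sum.elim A B)
    (s := Sum.elim (fun _ => 1) fun _ => -1) (by rintro (i | i); exacts [hx i, hy i])
    (by rintro (i | i); exacts [hA i, hB i]) (by rintro (i | i); exacts [eA i, eB i])
    (V₀ := (sumSub (pointed x A) (pointed y B)).comap (LinearMap.funLeft ℝ ℝ e.symm))
    (fun c => ⟨c, -c, by
      ext (⟨i, o⟩ | ⟨i, o⟩) <;> simp [LinearMap.funLeft_apply, e] <;> exact Or.inl rfl⟩)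
    (hpt ▸ hbal.opt.equiv hS.sub e)
  convert this using 3
  ext (i | i) <;> simp

theorem exists_hasEps_fin (hS : Admissible S) {t x : ℝ} (hx : 0 < x) (h : x ≤ t) {n : ℕ}
    (hn : t ≤ n * x) : ∃ A : Fin n → ℝ, HasEps S A t x := by
  have ht : 0 < t := hx.trans_le h
  have hn0 : (0 : ℝ) < n := pos_of_mul_pos_left (ht.trans_le hn) hx.le
  obtain ⟨A, hA, he⟩ := exists_eps_eq hS (n := n) (v := x / t) (by exact_mod_cast hn0)
    (by rw [inv_le_comm₀ hn0 (by positivity), inv_div, div_le_iff₀ hx]; exact hn)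
    ((div_le_one ht).2 h)
  have := (hasEps_of_mem (S := S) (mem_measures_of_mem_stdSimplex hA)).smul hS ht
  rw [hA.2, he, mul_one, mul_div_cancel₀ _ ht.ne'] at this
  exact ⟨_, this⟩

theorem hasEps_option (hS : Admissible S) {x t : ℝ} (hx : 0 < x) {A : κ → ℝ}
    (hA : HasEps S A t x) :
    HasEps S (fun o : Option κ => o.elim x A) (t + x) x := by
  have h1 : HasEps S (fun _ : Unit => x) x x := ⟨fun _ => hx.le, by simp, fun _ => eps_const hS hx⟩
  have h2 := (hA.sum_elim hS h1).comp_equiv hS (Equiv.optionEquivSumPUnit κ)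
  convert h2 using 1
  ext (_ | k) <;> simp

/-- Masses of the given proportions that exceed given values can be completed to pointed blocks. -/
theorem exists_pointed (hS : Admissible S) {w x : ι → ℝ} (hw : ∀ i, 0 < w i) (hx : ∀ i, 0 < x i) :
    ∃ T₀ : ℝ, ∀ T ≥ T₀, ∃ N : ℕ, ∀ n ≥ N, ∃ A : ι → Fin n → ℝ,
      ∀ i, HasEps S (A i) (w i * T - x i) (x i) := by
  obtain ⟨T₀, hT₀⟩ := (Set.finite_range fun i => 2 * x i / w i).bddAbove
  refine ⟨T₀, fun T hT => ?_⟩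
  obtain ⟨r, hr⟩ := (Set.finite_range fun i => (w i * T - x i) / x i).bddAbove
  obtain ⟨N, hN⟩ := exists_nat_ge r
  refine ⟨N, fun n hn => ?_⟩
  have : ∀ i, ∃ A : Fin n → ℝ, HasEps S A (w i * T - x i) (x i) := by
    intro i
    refine exists_hasEps_fin hS (hx i) ?_ ?_
    · have : 2 * x i / w i ≤ T := (hT₀ ⟨i, rfl⟩).trans hT
      rw [div_le_iff₀' (hw i)] at this
      linarith
    · rw [← div_le_iff₀ (hx i)]
      exact ((hr ⟨i, rfl⟩).trans hN).trans (by exact_mod_cast hn)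
  choose A hA using this
  exact ⟨A, hA⟩

theorem hasEps_pointed_bool (hS : Admissible S) {x y l : ℝ} (hx : 0 < x) (hy : 0 < y)
    {T : ℝ} (hT : 0 < T) {A : Bool → κ → ℝ} (hA : HasEps S (A false) (l * T - x) x)
    (hB : HasEps S (A true) ((1 - l) * T - y) y) :
    eps S (pointed (fun b => bif b then y else x) A) = mean S l x y := by
  have h1 := hasEps_option hS hx hA
  have h2 := hasEps_option hS hy hB
  have h3 := (h1.sum_elim_mean hS hx hy h2).comp_equiv hS (Equiv.boolProdEquivSum _)
  rw [sub_add_cancel, sub_add_cancel, show l * T + (1 - l) * T = T by ring,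
    show l * T / T = l by field_simp] at h3
  rw [← h3.eps hT]
  congr 1
  ext ⟨_ | _, _ | k⟩ <;> rfl

/-- If the mean did not depend on l, then (x, y | x, y) would be optimal in every direction (1 - δ,
δ | -δ, -(1 - δ)) with 0 < δ < 1. By continuity it would be at least as good as its displacement in
the limiting direction δ = 0, which replaces the first x and the last y by their average. But equal
masses on these two states are the unique optimum there, so x = y. -/
theorem exists_mean_ne (hS : Admissible S) {x y : ℝ} (hx : 0 < x) (hy : 0 < y) (hxy : x ≠ y) :
    ∃ l ∈ Ioo (0 : ℝ) 1, ∃ l' ∈ Ioo (0 : ℝ) 1, mean S l x y ≠ mean S l' x y := by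
  by_contra hcon
  push Not at hcon
  let f : Bool → ℝ := fun b => bif b then y else x
  have hf : ∀ b, 0 < f b := by rintro (_ | _); exacts [hx, hy]
  let P : Bool ⊕ Bool → ℝ := Sum.elim f f
  -- With this step length `Q 0` has the mass (x + y) / 2 on both states that change.
  set η := (y - x) / 2 with hη
  let D : ℝ → (Bool ⊕ Bool → ℝ) := fun δ => Sum.elim (fun b => bif b then δ else 1 - δ)
    fun b => -(bif b then 1 - δ else δ)
  have hopt : ∀ δ ∈ Ioo (0 : ℝ) 1, Opt S P (Submodule.span ℝ {D δ}) := by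
    intro δ hδ
    have hδ1 : 0 < 1 - δ := sub_pos.2 hδ.2
    let w : Bool → ℝ := fun b => bif b then δ else 1 - δ
    let w' : Bool → ℝ := fun b => bif b then 1 - δ else δ
    obtain ⟨T₁, h1⟩ := exists_pointed hS (w := w) (x := f)
      (by rintro (_ | _); exacts [hδ1, hδ.1]) hf
    obtain ⟨T₂, h2⟩ := exists_pointed hS (w := w') (x := f)
      (by rintro (_ | _); exacts [hδ.1, hδ1]) hf
    set T := max (max T₁ T₂) (max (2 * x / (1 - δ) + 2 * y / δ) (2 * x / δ + 2 * y / (1 - δ))) with hT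
    have hT0 : 0 < T := by
      have : 0 < 2 * x / δ + 2 * y / (1 - δ) := by
        have := hδ.1
        positivity
      exact this.trans_le ((le_max_right _ _).trans (le_max_right _ _))
    obtain ⟨N₁, h1⟩ := h1 T ((le_max_left _ _).trans (le_max_left _ _))
    obtain ⟨N₂, h2⟩ := h2 T ((le_max_right _ _).trans (le_max_left _ _))
    obtain ⟨A, hA⟩ := h1 (max N₁ N₂) (le_max_left _ _)
    obtain ⟨B, hB⟩ := h2 (max N₁ N₂) (le_max_right _ _)
    have hTa : ∀ v > 0, v < 1 → ∀ u, 2 * u / v ≤ T → 0 < u → 0 < v * T - u := by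
      intro v hv _ u hu hu0
      rw [div_le_iff₀' hv] at hu
      linarith
    have b1 : 2 * x / (1 - δ) + 2 * y / δ ≤ T := (le_max_left _ _).trans (le_max_right _ _)
    have b2 : 2 * x / δ + 2 * y / (1 - δ) ≤ T := (le_max_right _ _).trans (le_max_right _ _)
    have p1 : 0 < 2 * x / (1 - δ) := by positivity
    have p2 : 0 < 2 * y / δ := div_pos (by positivity) hδ.1
    have p3 : 0 < 2 * x / δ := div_pos (by positivity) hδ.1
    have p4 : 0 < 2 * y / (1 - δ) := by positivity
    have hw : ∀ b, 0 < w b * T - f b := by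
      rintro (_ | _)
      · exact hTa _ hδ1 (by linarith [hδ.1]) x (by linarith) hx
      · exact hTa _ hδ.1 hδ.2 y (by linarith) hy
    have hw' : ∀ b, 0 < w' b * T - f b := by
      rintro (_ | _)
      · exact hTa _ hδ.1 hδ.2 x (by linarith) hx
      · exact hTa _ hδ1 (by linarith [hδ.1]) y (by linarith) hy
    have e1 : eps S (pointed f A) = mean S (1 - δ) x y :=
      hasEps_pointed_bool hS hx hy hT0 (hA false) (by
        have := hA true
        simpa [w, f] using this)
    have e2 : eps S (pointed f B) = mean S δ x y :=
      hasEps_pointed_bool hS hx hy hT0 (hB false) (hB true)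
    have := Opt.of_eps_pointed hS (I := Bool) (J := Bool) hf hf (fun b => (hA b).mem (hw b))
      (fun b => (hB b).mem (hw' b)) (fun b => (hA b).eps (hw b)) (fun b => (hB b).eps (hw' b))
      (by rw [e1, e2]; exact hcon _ ⟨hδ1, by linarith [hδ.1]⟩ _ hδ)
    refine this.mono fun Q _ _ hQ => ?_
    obtain ⟨t, ht⟩ := Submodule.mem_span_singleton.1 hQ
    refine Submodule.mem_span_singleton.2 ⟨t / T, ?_⟩
    rw [← ht]
    ext (_ | _ | _) <;> simp [D, (hA _).sum, (hB _).sum, w, w'] <;> field_simp <;> ring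
  have hP0 : ∀ i, 0 < P i := by rintro (b | b); exacts [hf b, hf b]
  have hPs : 0 < ∑ i, P i := Finset.sum_pos (fun i _ => hP0 i) Finset.univ_nonempty
  let Q : ℝ → (Bool ⊕ Bool → ℝ) := fun δ => P + η • D δ
  have hQs : ∀ δ, ∑ i, Q δ i = ∑ i, P i := by
    intro δ
    simp [Q, D, Finset.sum_add_distrib, ← Finset.mul_sum]
  have hQ0 : ∀ i, 0 < Q 0 i := by
    rintro ((_ | _) | (_ | _)) <;> simp [Q, P, D, f, hη] <;> linarith
  have hQc : Continuous Q := by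
    refine continuous_pi ?_
    rintro ((_ | _) | (_ | _)) <;> simp [Q, P, D] <;> fun_prop
  have hle : ent S ((∑ i, P i)⁻¹ • Q 0) ≤ ent S ((∑ i, P i)⁻¹ • P) := by
    have hev : ∀ᶠ δ in 𝓝[>] (0 : ℝ), ∀ i, 0 < Q δ i := by
      refine nhdsWithin_le_nhds (eventually_all.2 fun i => ?_)
      exact ((continuous_apply i).comp hQc).continuousAt.eventually_const_lt (hQ0 i)
    have hmem : ∀ δ, (∀ i, 0 < Q δ i) → (∑ i, P i)⁻¹ • Q δ ∈ stdSimplex ℝ (Bool ⊕ Bool) := by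
      intro δ hδ
      rw [← hQs δ]
      exact normalize_mem (fun i => (hδ i).le) (hQs δ ▸ hPs)
    have hlim : Tendsto (fun δ => ent S ((∑ i, P i)⁻¹ • Q δ)) (𝓝[>] 0)
        (𝓝 (ent S ((∑ i, P i)⁻¹ • Q 0))) := by
      refine ((continuousOn_ent hS.cont) _ (hmem 0 hQ0)).tendsto.comp
        (tendsto_nhdsWithin_iff.2 ⟨?_, hev.mono hmem⟩)
      have : Continuous fun δ => (∑ i, P i)⁻¹ • Q δ := hQc.const_smul (∑ i, P i)⁻¹
      exact (this.tendsto 0).mono_left nhdsWithin_le_nhds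
    refine le_of_tendsto hlim ?_
    filter_upwards [hev, Ioo_mem_nhdsGT (zero_lt_one (α := ℝ))] with δ hδ hδ'
    refine (hopt δ hδ').le _ (fun i => (hδ i).le) (hQs δ) ?_
    simp only [Q, add_sub_cancel_left]
    exact Submodule.smul_mem _ _ (Submodule.mem_span_singleton_self _)
  -- The two states on which P and `Q 0` differ.
  let j : Bool → Bool ⊕ Bool := fun b => bif b then Sum.inr true else Sum.inl false
  have hj : Function.Injective j := by
    rintro (_ | _) (_ | _) h <;> simp_all [j]
  have hQj : Q 0 ∘ j = fun _ => (x + y) / 2 := by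
    ext (_ | _) <;> simp [Q, P, D, j, f, hη] <;> ring
  have hoptQ : Opt S (Q 0) (extendSub j ⊤) :=
    Opt.extend hS.uniq hS.sub hj (fun i => (hQ0 i).le) (hQj ▸ Opt.const hS.max (by positivity))
  have hPQ : P - Q 0 ∈ extendSub j ⊤ := by
    refine ⟨trivial, ?_⟩
    rintro ((_ | _) | (_ | _)) hi
    · exact (hi ⟨false, rfl⟩).elim
    · simp [Q, D]
    · simp [Q, D]
    · exact (hi ⟨true, rfl⟩).elim
  have hoptP : Opt S P (extendSub j ⊤) := by
    refine ⟨fun i => (hP0 i).le, hPs, fun R h0 h1 h2 => ?_⟩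
    have := hoptQ.le R h0 (h1.trans (hQs 0).symm) (by
      have := Submodule.add_mem _ h2 hPQ
      rwa [sub_add_sub_cancel] at this)
    rw [hQs 0] at this
    exact this.trans hle
  have := congrFun (Opt.unique hS.uniq hoptQ hoptP (hQs 0).symm hPQ) (Sum.inl false)
  simp [Q, P, D, f, hη] at this
  exact hxy (by linarith)

theorem isWeightedMean_mean (hS : Admissible S) : IsWeightedMean (mean S) where
  pos := mean_pos hS
  zero := mean_zero hS
  one := mean_one hS
  bisymm := mean_bisymm hS
  homog := mean_homog hS
  cont := continuousOn_mean hS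
  cont_scale := continuousOn_mean_scale hS
  exists_ne := exists_mean_ne hS

end

end MaxEntInference

namespace MaxEntInference

open Topology Filter Set

/-! ### Weighted means are quasi-arithmetic -/

namespace IsWeightedMean

variable {M : ℝ → ℝ → ℝ → ℝ} {l m x y : ℝ}

theorem self (hM : IsWeightedMean M) (hl : l ∈ Icc (0 : ℝ) 1) (hx : 0 < x) : M l x x = x := by
  have := hM.bisymm (l := 1) (l' := 1) hl (by simp) (by simp) hx hx
  rwa [hM.one hx hx, mul_one, mul_one, add_sub_cancel, hM.one hx hx] at this

theorem swap (hM : IsWeightedMean M) (hl : l ∈ Icc (0 : ℝ) 1) (hx : 0 < x) (hy : 0 < y) :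
    M (1 - l) y x = M l x y := by
  have := hM.bisymm (m := 1 - l) (l := 0) (l' := 1) (by constructor <;> linarith [hl.1, hl.2])
    (by simp) (by simp) hx hy
  rwa [hM.zero hx hy, hM.one hx hy, mul_zero, mul_one, zero_add, sub_sub_cancel] at this

/-- If M takes the same value at a < b, it is constant on [a, b] by bisymmetry. Contracting this
interval towards 0 or 1 yields a neighbourhood of any point of (0, 1) on which M is constant, so M
is constant on (0, 1), against `exists_ne`. -/
theorem injOn (hM : IsWeightedMean M) (hx : 0 < x) (hy : 0 < y) (hxy : x ≠ y) :
    InjOn (fun l => M l x y) (Icc 0 1) := by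
  have key : ∀ a ∈ Icc (0 : ℝ) 1, ∀ b ∈ Icc (0 : ℝ) 1, a < b → M a x y ≠ M b x y := by
    intro a ha b hb hab heq
    have hconst : ∀ s ∈ Icc a b, M s x y = M a x y := by
      intro s hs
      have hba : 0 < b - a := sub_pos.2 hab
      have := hM.bisymm (m := (b - s) / (b - a)) (l := a) (l' := b) ⟨div_nonneg (by linarith [hs.2])
        hba.le, (div_le_one hba).2 (by linarith [hs.1])⟩ ha hb hx hy
      rw [← heq, hM.self ⟨div_nonneg (by linarith [hs.2]) hba.le,
        (div_le_one hba).2 (by linarith [hs.1])⟩ (hM.pos ha hx hy)] at this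
      rw [this]
      congr 1
      field_simp
      ring
    -- Bisymmetry writes M at m s + (1 - m) t through M s and M t; as s runs through [a, b] the
    -- value stays fixed.
    have hloc : ∀ t ∈ Icc (0 : ℝ) 1, ∀ m ∈ Ioc (0 : ℝ) 1,
        (fun l => M l x y) =ᶠ[𝓝 (m * ((a + b) / 2) + (1 - m) * t)]
          fun _ => M (m * a + (1 - m) * t) x y := by
      intro t ht m hm
      have h1 : m * a + (1 - m) * t < m * ((a + b) / 2) + (1 - m) * t := by
        have := mul_lt_mul_of_pos_left (show a < (a + b) / 2 by linarith) hm.1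
        linarith
      have h2 : m * ((a + b) / 2) + (1 - m) * t < m * b + (1 - m) * t := by
        have := mul_lt_mul_of_pos_left (show (a + b) / 2 < b by linarith) hm.1
        linarith
      filter_upwards [Ioo_mem_nhds h1 h2] with p hp
      have hs : (p - (1 - m) * t) / m ∈ Icc a b := by
        constructor
        · rw [le_div_iff₀ hm.1]
          linarith [hp.1]
        · rw [div_le_iff₀ hm.1]
          linarith [hp.2]
      have hm' : m ∈ Icc (0 : ℝ) 1 := ⟨hm.1.le, hm.2⟩
      have e1 := hM.bisymm hm' ⟨ha.1.trans hs.1, hs.2.trans hb.2⟩ ht hx hy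
      have e2 := hM.bisymm hm' ha ht hx hy
      rw [hconst _ hs, e2, mul_div_cancel₀ _ hm.1.ne', sub_add_cancel] at e1
      exact e1.symm
    have hloc' : ∀ p ∈ Ioo (0 : ℝ) 1, ∃ c, (fun l => M l x y) =ᶠ[𝓝 p] fun _ => c := by
      intro p hp
      have h0 : 0 < (a + b) / 2 := by linarith [ha.1]
      have h1 : 0 < 1 - (a + b) / 2 := by linarith [hb.2]
      rcases le_total p ((a + b) / 2) with h | h
      · have := hloc 0 (by simp) (p / ((a + b) / 2)) ⟨div_pos hp.1 h0, (div_le_one h0).2 h⟩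
        rw [div_mul_cancel₀ _ h0.ne', mul_zero, add_zero] at this
        exact ⟨_, this⟩
      · have := hloc 1 (by simp) ((1 - p) / (1 - (a + b) / 2))
          ⟨div_pos (by linarith [hp.2]) h1, (div_le_one h1).2 (by linarith)⟩
        rw [show (1 - p) / (1 - (a + b) / 2) * ((a + b) / 2) + (1 - (1 - p) / (1 - (a + b) / 2)) * 1
          = 1 - (1 - p) / (1 - (a + b) / 2) * (1 - (a + b) / 2) by ring, div_mul_cancel₀ _ h1.ne',
          sub_sub_cancel] at this
        exact ⟨_, this⟩
    obtain ⟨s, hs, t, ht, hne⟩ := hM.exists_ne hx hy hxy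
    refine hne (isOpen_Ioo.is_const_of_deriv_eq_zero (𝕜 := ℝ) (f := fun l => M l x y)
      isPreconnected_Ioo (fun p hp => ?_) (fun p hp => ?_) hs ht)
    · obtain ⟨c, hc⟩ := hloc' p hp
      exact ((differentiableAt_const c).congr_of_eventuallyEq hc).differentiableWithinAt
    · obtain ⟨c, hc⟩ := hloc' p hp
      simpa using hc.deriv_eq
  intro a ha b hb hab
  by_contra hne
  rcases lt_or_gt_of_ne hne with h | h
  · exact key a ha b hb h hab
  · exact key b hb a ha h hab.symm

theorem ne_left (hM : IsWeightedMean M) (hx : 0 < x) (hy : 0 < y) (hxy : x ≠ y)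
    (hl : l ∈ Ioo (0 : ℝ) 1) : M l x y ≠ x := fun h =>
  hl.2.ne (hM.injOn hx hy hxy (Ioo_subset_Icc_self hl) (by simp) (h.trans (hM.one hx hy).symm))

theorem ne_right (hM : IsWeightedMean M) (hx : 0 < x) (hy : 0 < y) (hxy : x ≠ y)
    (hl : l ∈ Ioo (0 : ℝ) 1) : M l x y ≠ y := fun h =>
  hl.1.ne' (hM.injOn hx hy hxy (Ioo_subset_Icc_self hl) (by simp) (h.trans (hM.zero hx hy).symm))

/-- On (0, 1) the map l ↦ M l 1 2 is continuous and injective, hence monotone; two of its values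
serve as u and v. Nothing is known yet about continuity at 0 and 1, so 1 and 2 themselves would not
do. -/
theorem exists_internal (hM : IsWeightedMean M) :
    ∃ u v, 0 < u ∧ u < v ∧ ∀ m ∈ Ioo (0 : ℝ) 1, M m u v ∈ Ioo u v := by
  have hinj : InjOn (fun l => M l 1 2) (Ioo 0 1) :=
    (hM.injOn one_pos two_pos (by norm_num)).mono Ioo_subset_Icc_self
  have hsub : ∀ p : ℝ, p = 1 / 3 ∨ p = 2 / 3 → p ∈ Ioo (0 : ℝ) 1 := by
    rintro p (rfl | rfl) <;> constructor <;> norm_num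
  have h3 := hsub (1 / 3) (Or.inl rfl)
  have h4 := hsub (2 / 3) (Or.inr rfl)
  have hpos := fun {p} (hp : p ∈ Ioo (0 : ℝ) 1) =>
    hM.pos (Ioo_subset_Icc_self hp) one_pos (two_pos (α := ℝ))
  have hb : ∀ m ∈ Ioo (0 : ℝ) 1, ∀ s ∈ Ioo (0 : ℝ) 1, ∀ t ∈ Ioo (0 : ℝ) 1,
      M m (M s 1 2) (M t 1 2) = M (m * s + (1 - m) * t) 1 2 := fun m hm s hs t ht =>
    hM.bisymm (Ioo_subset_Icc_self hm) (Ioo_subset_Icc_self hs) (Ioo_subset_Icc_self ht)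
      one_pos two_pos
  rcases (hM.cont one_pos two_pos).strictMonoOn_of_injOn_Ioo zero_lt_one hinj with h | h
  · refine ⟨_, _, hpos h3, h h3 h4 (by norm_num), fun m hm => ?_⟩
    rw [hb m hm _ h3 _ h4]
    have h5 : m * (1 / 3) + (1 - m) * (2 / 3) ∈ Ioo (0 : ℝ) 1 := by
      constructor <;> linarith [hm.1, hm.2]
    exact ⟨h h3 h5 (by linarith [hm.2]), h h5 h4 (by linarith [hm.1])⟩
  · refine ⟨_, _, hpos h4, h h3 h4 (by norm_num), fun m hm => ?_⟩
    rw [hb m hm _ h4 _ h3]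
    have h5 : m * (2 / 3) + (1 - m) * (1 / 3) ∈ Ioo (0 : ℝ) 1 := by
      constructor <;> linarith [hm.1, hm.2]
    exact ⟨h h5 h4 (by linarith [hm.2]), h h3 h5 (by linarith [hm.1])⟩

theorem _root_.MaxEntInference.pos_of_continuousOn_Ioi {f : ℝ → ℝ} {a b c : ℝ}
    (hf : ContinuousOn f (Ioi a)) (h0 : ∀ z ∈ Ioi a, f z ≠ 0) (hb : b ∈ Ioi a) (hfb : 0 < f b)
    (hc : c ∈ Ioi a) : 0 < f c := by
  by_contra hneg
  obtain ⟨z, hz, hfz⟩ := isPreconnected_Ioi.intermediate_value hc hb hf ⟨not_lt.1 hneg, hfb.le⟩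
  exact h0 z hz hfz

/-- Deform the pair (x, y) to (x, c y) with c > x / y, the weight changing along. By injectivity M
never meets x or c y, so both strict inequalities hold for all such c once they hold for one. -/
theorem mem_Ioo (hM : IsWeightedMean M) (hx : 0 < x) (hxy : x < y) (hl : l ∈ Ioo (0 : ℝ) 1) :
    M l x y ∈ Ioo x y := by
  obtain ⟨u, v, hu, huv, huv'⟩ := hM.exists_internal
  have hy := hx.trans hxy
  have hv := hu.trans huv
  have hl1 : 0 < 1 - l := sub_pos.2 hl.2
  have hw : ∀ c ∈ Ioi (x / y), 0 < c ∧ l / (l + c * (1 - l)) ∈ Ioo (0 : ℝ) 1 ∧ x < c * y := by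
    intro c hc
    have hc0 : 0 < c := (div_pos hx hy).trans hc
    have hl0 := hl.1
    refine ⟨hc0, ⟨by positivity, (div_lt_one (by positivity)).2 ?_⟩, (div_lt_iff₀ hy).1 hc⟩
    linarith [mul_pos hc0 hl1]
  have hF : ContinuousOn (fun c => M (l / (l + c * (1 - l))) x (c * y)) (Ioi (x / y)) :=
    (hM.cont_scale hl.1 hl1 hx hy).mono (Ioi_subset_Ioi (div_pos hx hy).le)
  have h1 : (1 : ℝ) ∈ Ioi (x / y) := (div_lt_one hy).2 hxy
  -- At this c the pair is (x / u) (u, v), where homogeneity transfers `exists_internal`.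
  have hc0 : v / u * (x / y) ∈ Ioi (x / y) :=
    lt_mul_of_one_lt_left (div_pos hx hy) ((one_lt_div hu).2 huv)
  obtain ⟨-, hw0, -⟩ := hw _ hc0
  have hM0 : M (l / (l + v / u * (x / y) * (1 - l))) x (v / u * (x / y) * y)
      = x / u * M (l / (l + v / u * (x / y) * (1 - l))) u v := by
    rw [← hM.homog (Ioo_subset_Icc_self hw0) hu hv (div_pos hx hu)]
    congr 1 <;> field_simp
  have hint := huv' _ hw0
  have hl' : l / (l + 1 * (1 - l)) = l := by rw [one_mul, add_sub_cancel, div_one]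
  constructor
  · have := pos_of_continuousOn_Ioi (hF.sub continuousOn_const) (fun c hc => sub_ne_zero.2 <|
      hM.ne_left hx (hx.trans (hw c hc).2.2) (hw c hc).2.2.ne (hw c hc).2.1) hc0 (by
        change 0 < M _ _ _ - x
        rw [hM0, sub_pos]
        calc x = x / u * u := by field_simp
          _ < _ := mul_lt_mul_of_pos_left hint.1 (div_pos hx hu)) h1
    simpa [hl'] using this
  · have := pos_of_continuousOn_Ioi (f := fun c => c * y - M (l / (l + c * (1 - l))) x (c * y))
      ((continuousOn_id.mul continuousOn_const).sub hF) (fun c hc => sub_ne_zero.2 <|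
      (hM.ne_right hx (hx.trans (hw c hc).2.2) (hw c hc).2.2.ne (hw c hc).2.1).symm) hc0 (by
        rw [hM0, sub_pos]
        calc _ < x / u * v := mul_lt_mul_of_pos_left hint.2 (div_pos hx hu)
          _ = _ := by field_simp) h1
    simpa [hl'] using this

/-- For s < t, bisymmetry makes M t x y a proper mean of x and M s x y, so it lies strictly below
the latter. -/
theorem strictAntiOn (hM : IsWeightedMean M) (hx : 0 < x) (hxy : x < y) :
    StrictAntiOn (fun l => M l x y) (Icc 0 1) := by
  have hy := hx.trans hxy
  have hgt : ∀ s ∈ Ico (0 : ℝ) 1, x < M s x y := by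
    intro s hs
    rcases hs.1.eq_or_lt with rfl | h
    · rwa [hM.zero hx hy]
    · exact (hM.mem_Ioo hx hxy ⟨h, hs.2⟩).1
  intro s hs t ht hst
  have hs1 : s < 1 := hst.trans_le ht.2
  rcases ht.2.eq_or_lt with rfl | h
  · simpa [hM.one hx hy] using hgt s ⟨hs.1, hs1⟩
  · have h1s : 0 < 1 - s := sub_pos.2 hs1
    have hm : (t - s) / (1 - s) ∈ Ioo (0 : ℝ) 1 :=
      ⟨div_pos (sub_pos.2 hst) h1s, (div_lt_one h1s).2 (by linarith)⟩
    have := hM.bisymm (l := 1) (l' := s) (Ioo_subset_Icc_self hm) (by simp) hs hx hy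
    rw [hM.one hx hy, show (t - s) / (1 - s) * 1 + (1 - (t - s) / (1 - s)) * s = t by
      field_simp; ring] at this
    change M t x y < M s x y
    rw [← this]
    exact (hM.mem_Ioo hx (hgt s ⟨hs.1, hs1⟩) hm).2

/-- Suppose the infimum L of the values over (0, 1) exceeds x. Values v slightly above L are
attained, and a mean of x and v is again attained, hence at least L. Letting v = c L decrease to L
gives M (1/2) x L ≥ L, against internality. -/
theorem exists_lt (hM : IsWeightedMean M) (hx : 0 < x) (hxy : x < y) {z : ℝ} (hz : x < z) :
    ∃ l ∈ Ioo (0 : ℝ) 1, M l x y < z := by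
  by_contra! hcon
  have hanti := (hM.strictAntiOn hx hxy).mono Ioo_subset_Icc_self
  have hy := hx.trans hxy
  set L := sInf ((fun l => M l x y) '' Ioo 0 1) with hL
  have hbdd : BddBelow ((fun l => M l x y) '' Ioo 0 1) := ⟨z, by rintro _ ⟨l, hl, rfl⟩; exact hcon l hl⟩
  have hhalf : (1 / 2 : ℝ) ∈ Ioo (0 : ℝ) 1 := by constructor <;> norm_num
  have h34 : (3 / 4 : ℝ) ∈ Ioo (0 : ℝ) 1 := by constructor <;> norm_num
  have hLle : ∀ l ∈ Ioo (0 : ℝ) 1, L ≤ M l x y := fun l hl => csInf_le hbdd ⟨l, hl, rfl⟩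
  have hxL : x < L := hz.trans_le (le_csInf ⟨_, mem_image_of_mem _ hhalf⟩
    (by rintro _ ⟨l, hl, rfl⟩; exact hcon l hl))
  have hL2 : L < M (1 / 2) x y := (hLle _ h34).trans_lt (hanti hhalf h34 (by norm_num))
  have hL0 := hx.trans hxL
  have hge : ∀ v ∈ Ioo L (M (1 / 2) x y), ∀ m ∈ Ioo (0 : ℝ) 1, L ≤ M m x v := by
    intro v hv m hm
    obtain ⟨_, ⟨l₁, hl₁, rfl⟩, hlt⟩ := exists_lt_of_csInf_lt ⟨_, mem_image_of_mem _ hhalf⟩ hv.1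
    obtain ⟨l, hl, rfl⟩ := isPreconnected_Ioo.intermediate_value hl₁ hhalf (hM.cont hx hy)
      ⟨hlt.le, hv.2.le⟩
    have := hM.bisymm (l := 1) (Ioo_subset_Icc_self hm) (by simp) (Ioo_subset_Icc_self hl) hx hy
    rw [hM.one hx hy] at this
    simp only [this]
    exact hLle _ ⟨by nlinarith [hm.1, hm.2, hl.1, hl.2], by nlinarith [hm.1, hm.2, hl.1, hl.2]⟩
  have hF := (hM.cont_scale one_pos one_pos hx hL0).continuousAt (Ioi_mem_nhds one_pos)
  have := ge_of_tendsto (hF.tendsto.mono_left (nhdsWithin_le_nhds (s := Ioi 1))) (b := L) (by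
    filter_upwards [Ioo_mem_nhdsGT ((one_lt_div hL0).2 hL2)] with c hc
    have hc0 : 0 < c := one_pos.trans hc.1
    refine hge _ ⟨lt_mul_of_one_lt_left hL0 hc.1, (lt_div_iff₀ hL0).1 hc.2⟩ _
      ⟨by positivity, (div_lt_one (by positivity)).2 (by linarith)⟩)
  simp only [one_mul, mul_one] at this
  exact absurd (hM.mem_Ioo hx hxL (l := 1 / (1 + 1)) (by constructor <;> norm_num)).2 (not_lt.2 this)

/-- Mirror image of `exists_lt`: y replaces x, the supremum replaces the infimum, and c increases to
1. -/
theorem exists_gt (hM : IsWeightedMean M) (hx : 0 < x) (hxy : x < y) {z : ℝ} (hz : z < y) :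
    ∃ l ∈ Ioo (0 : ℝ) 1, z < M l x y := by
  by_contra! hcon
  have hanti := (hM.strictAntiOn hx hxy).mono Ioo_subset_Icc_self
  have hy := hx.trans hxy
  set L := sSup ((fun l => M l x y) '' Ioo 0 1) with hL
  have hbdd : BddAbove ((fun l => M l x y) '' Ioo 0 1) := ⟨z, by rintro _ ⟨l, hl, rfl⟩; exact hcon l hl⟩
  have hhalf : (1 / 2 : ℝ) ∈ Ioo (0 : ℝ) 1 := by constructor <;> norm_num
  have h14 : (1 / 4 : ℝ) ∈ Ioo (0 : ℝ) 1 := by constructor <;> norm_num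
  have hLle : ∀ l ∈ Ioo (0 : ℝ) 1, M l x y ≤ L := fun l hl => le_csSup hbdd ⟨l, hl, rfl⟩
  have hyL : L < y := (csSup_le ⟨_, mem_image_of_mem _ hhalf⟩
    (by rintro _ ⟨l, hl, rfl⟩; exact hcon l hl)).trans_lt hz
  have hL2 : M (1 / 2) x y < L := (hanti h14 hhalf (by norm_num)).trans_le (hLle _ h14)
  have hL0 : 0 < L := (hM.pos (Ioo_subset_Icc_self hhalf) hx hy).trans hL2
  have hge : ∀ v ∈ Ioo (M (1 / 2) x y) L, ∀ m ∈ Ioo (0 : ℝ) 1, M m y v ≤ L := by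
    intro v hv m hm
    obtain ⟨_, ⟨l₁, hl₁, rfl⟩, hlt⟩ := exists_lt_of_lt_csSup ⟨_, mem_image_of_mem _ hhalf⟩ hv.2
    obtain ⟨l, hl, rfl⟩ := isPreconnected_Ioo.intermediate_value hhalf hl₁ (hM.cont hx hy)
      ⟨hv.1.le, hlt.le⟩
    have := hM.bisymm (l := 0) (Ioo_subset_Icc_self hm) (by simp) (Ioo_subset_Icc_self hl) hx hy
    rw [hM.zero hx hy] at this
    simp only [this]
    exact hLle _ ⟨by nlinarith [hm.1, hm.2, hl.1, hl.2], by nlinarith [hm.1, hm.2, hl.1, hl.2]⟩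
  have hF := (hM.cont_scale one_pos one_pos hy hL0).continuousAt (Ioi_mem_nhds one_pos)
  have := le_of_tendsto (hF.tendsto.mono_left (nhdsWithin_le_nhds (s := Iio 1))) (b := L) (by
    filter_upwards [Ioo_mem_nhdsLT ((div_lt_one hL0).2 hL2)] with c hc
    have hc0 : 0 < c := (div_pos (hM.pos (Ioo_subset_Icc_self hhalf) hx hy) hL0).trans hc.1
    refine hge _ ⟨(div_lt_iff₀ hL0).1 hc.1, mul_lt_of_lt_one_left hL0 hc.2⟩ _
      ⟨by positivity, (div_lt_one (by positivity)).2 (by linarith)⟩)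
  simp only [one_mul, mul_one] at this
  have h2 := (hM.mem_Ioo hL0 hyL hhalf).1
  rw [← hM.swap (Ioo_subset_Icc_self hhalf) hL0 hy] at h2
  norm_num at h2 this
  linarith

theorem exists_eq (hM : IsWeightedMean M) (hx : 0 < x) (hxy : x < y) {z : ℝ} (hz : z ∈ Icc x y) :
    ∃ l ∈ Icc (0 : ℝ) 1, M l x y = z := by
  have hy := hx.trans hxy
  rcases hz.1.eq_or_lt with rfl | h1
  · exact ⟨1, by simp, hM.one hx hy⟩
  rcases hz.2.eq_or_lt with rfl | h2
  · exact ⟨0, by simp, hM.zero hx hy⟩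
  obtain ⟨s, hs, hs'⟩ := hM.exists_lt hx hxy h1
  obtain ⟨t, ht, ht'⟩ := hM.exists_gt hx hxy h2
  obtain ⟨l, hl, h⟩ := isPreconnected_Ioo.intermediate_value hs ht (hM.cont hx hy) ⟨hs'.le, ht'.le⟩
  exact ⟨l, Ioo_subset_Icc_self hl, h⟩

end IsWeightedMean

/-- `f` turns the weighted mean `M` on `s` into the arithmetic one. -/
def Linearizes (M : ℝ → ℝ → ℝ → ℝ) (f : ℝ → ℝ) (s : Set ℝ) : Prop :=
  ∀ l ∈ Icc (0 : ℝ) 1, ∀ x ∈ s, ∀ y ∈ s, f (M l x y) = l * f x + (1 - l) * f y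

namespace Linearizes

variable {M : ℝ → ℝ → ℝ → ℝ} {f g : ℝ → ℝ} {s t : Set ℝ}

theorem mono (h : Linearizes M f s) (hts : t ⊆ s) : Linearizes M f t :=
  fun l hl x hx y hy => h l hl x (hts hx) y (hts hy)

theorem affine (hf : Linearizes M f s) (hg : Linearizes M g s) (a b c : ℝ) :
    Linearizes M (fun x => a * f x + b * g x + c) s := by
  intro l hl x hx y hy
  simp only [hf l hl x hx y hy, hg l hl x hx y hy]
  ring

/-- Of the three points u, v, z, the middle one is a mean of the outer two, and f is affine in the
weight. Linearizers are thus determined up to affine maps. -/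
theorem eq_zero (hM : IsWeightedMean M) (hs0 : s ⊆ Ioi 0)
    (hf : Linearizes M f s) {u v : ℝ} (hu : u ∈ s) (hv : v ∈ s) (huv : u < v) (hfu : f u = 0)
    (hfv : f v = 0) {z : ℝ} (hz : z ∈ s) : f z = 0 := by
  have hu0 : 0 < u := hs0 hu
  have hz0 : 0 < z := hs0 hz
  rcases lt_or_ge z u with h | h
  · obtain ⟨l, hl, he⟩ := hM.exists_eq hz0 (h.trans huv) ⟨h.le, huv.le⟩
    have := hf l hl z hz v hv
    rw [he, hfu, hfv, mul_zero, add_zero] at this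
    refine (mul_eq_zero.1 this.symm).resolve_left ?_
    rintro rfl
    rw [hM.zero hz0 (hz0.trans (h.trans huv))] at he
    exact huv.ne' he
  rcases le_or_gt z v with h' | h'
  · obtain ⟨l, hl, he⟩ := hM.exists_eq hu0 huv ⟨h, h'⟩
    rw [← he, hf l hl u hu v hv, hfu, hfv]
    ring
  · obtain ⟨l, hl, he⟩ := hM.exists_eq hu0 (huv.trans h') ⟨huv.le, h'.le⟩
    have := hf l hl u hu z hz
    rw [he, hfu, hfv, mul_zero, zero_add] at this
    refine (mul_eq_zero.1 this.symm).resolve_left fun h0 => ?_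
    rw [show l = 1 by linarith, hM.one hu0 hz0] at he
    exact huv.ne he

end Linearizes

/-- The inverse of l ↦ M l x y linearizes M by bisymmetry; the sign makes it increasing. -/
theorem IsWeightedMean.exists_linearizes_Icc {M : ℝ → ℝ → ℝ → ℝ} (hM : IsWeightedMean M) {x y : ℝ}
    (hx : 0 < x) (hxy : x < y) : ∃ f, Linearizes M f (Icc x y) ∧ StrictMonoOn f (Icc x y) := by
  choose! h hh hh' using fun z (hz : z ∈ Icc x y) => hM.exists_eq hx hxy hz
  have hanti := hM.strictAntiOn hx hxy
  have hy := hx.trans hxy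
  refine ⟨fun z => -h z, fun l hl u hu v hv => ?_, fun u hu v hv huv => neg_lt_neg ?_⟩
  · have hc : l * h u + (1 - l) * h v ∈ Icc (0 : ℝ) 1 := by
      have := (convex_Icc (0 : ℝ) 1) (hh u hu) (hh v hv) hl.1 (sub_nonneg.2 hl.2) (by ring)
      simpa using this
    have e := hM.bisymm hl (hh u hu) (hh v hv) hx hy
    rw [hh' u hu, hh' v hv] at e
    have hmem : M l u v ∈ Icc x y := by
      rw [e]
      refine ⟨?_, ?_⟩
      · have := hanti.antitoneOn hc (by simp) hc.2
        simpa [hM.one hx hy] using this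
      · have := hanti.antitoneOn (by simp) hc hc.1
        simpa [hM.zero hx hy] using this
    have := hM.injOn hx hy hxy.ne (hh _ hmem) hc ((hh' _ hmem).trans e)
    simp only [this]
    ring
  · refine (hanti.lt_iff_gt (hh u hu) (hh v hv)).1 ?_
    simpa [hh' u hu, hh' v hv] using huv

/-- Normalization at 1 and 2 makes the linearizers on an exhaustion by compact intervals agree, so
they glue. -/
theorem IsWeightedMean.exists_linearizes {M : ℝ → ℝ → ℝ → ℝ} (hM : IsWeightedMean M) :
    ∃ f, Linearizes M f (Ioi 0) ∧ StrictMonoOn f (Ioi 0) ∧ f 1 = 0 ∧ f 2 = 1 := by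
  let I : ℕ → Set ℝ := fun n => Icc ((n + 2 : ℝ)⁻¹) (n + 2)
  have hI0 : ∀ n : ℕ, (0 : ℝ) < (n + 2 : ℝ)⁻¹ := fun n => by positivity
  have hI1 : ∀ n : ℕ, (1 : ℝ) ∈ I n := fun n =>
    ⟨inv_le_one_of_one_le₀ (by linarith [n.cast_nonneg (α := ℝ)]),
      by linarith [n.cast_nonneg (α := ℝ)]⟩
  have hI2 : ∀ n : ℕ, (2 : ℝ) ∈ I n := fun n =>
    ⟨(hI1 n).1.trans one_le_two, by linarith [n.cast_nonneg (α := ℝ)]⟩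
  have hmono : ∀ {n m : ℕ}, n ≤ m → I n ⊆ I m := by
    intro n m hnm
    have : (n : ℝ) + 2 ≤ m + 2 := by exact_mod_cast Nat.add_le_add_right hnm 2
    exact Icc_subset_Icc (inv_anti₀ (by positivity) this) this
  have hex : ∀ n : ℕ, ∃ f, Linearizes M f (I n) ∧ StrictMonoOn f (I n) ∧ f 1 = 0 ∧ f 2 = 1 := by
    intro n
    obtain ⟨f, h1, h2⟩ := hM.exists_linearizes_Icc (hI0 n)
      (show (n + 2 : ℝ)⁻¹ < n + 2 by
        have := (hI1 n).1
        linarith [n.cast_nonneg (α := ℝ)])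
    have h12 : 0 < f 2 - f 1 := sub_pos.2 (h2 (hI1 n) (hI2 n) one_lt_two)
    refine ⟨_, h1.affine h1 (f 2 - f 1)⁻¹ 0 (-((f 2 - f 1)⁻¹ * f 1)), fun u hu v hv huv => ?_,
      by ring, by field_simp; ring⟩
    have := mul_lt_mul_of_pos_left (h2 hu hv huv) (inv_pos.2 h12)
    simpa using this
  choose F hF1 hF2 hF3 hF4 using hex
  have hcoh : ∀ {n m : ℕ}, n ≤ m → ∀ z ∈ I n, F n z = F m z := by
    intro n m hnm z hz
    have := ((hF1 n).affine ((hF1 m).mono (hmono hnm)) 1 (-1) 0).eq_zero hM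
      (fun z hz => (hI0 n).trans_le hz.1) (hI1 n) (hI2 n) one_lt_two (by simp [hF3]) (by simp [hF4])
      hz
    linarith
  have hcov : ∀ z : ℝ, 0 < z → ∃ n, z ∈ I n := by
    intro z hz
    obtain ⟨n, hn⟩ := exists_nat_ge (max z z⁻¹)
    refine ⟨n, ?_, ?_⟩
    · rw [inv_le_comm₀ (by positivity) hz]
      linarith [le_max_right z z⁻¹]
    · linarith [le_max_left z z⁻¹]
  choose! N hN using hcov
  have hF : ∀ n z, z ∈ I n → F (N z) z = F n z := by
    intro n z hz
    have hz0 : 0 < z := (hI0 n).trans_le hz.1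
    rcases le_total (N z) n with h | h
    · exact hcoh h z (hN z hz0)
    · exact (hcoh h z hz).symm
  have hcov2 : ∀ x y : ℝ, 0 < x → 0 < y → ∃ n, x ∈ I n ∧ y ∈ I n := fun x y hx hy =>
    ⟨max (N x) (N y), hmono (le_max_left _ _) (hN x hx), hmono (le_max_right _ _) (hN y hy)⟩
  refine ⟨fun z => F (N z) z, fun l hl x hx y hy => ?_, fun x hx y hy hxy => ?_,
    (hF 0 1 (hI1 0)).trans (hF3 0), (hF 0 2 (hI2 0)).trans (hF4 0)⟩
  · change F (N _) _ = l * F (N x) x + (1 - l) * F (N y) y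
    obtain ⟨n, h1, h2⟩ := hcov2 x y hx hy
    obtain ⟨k, hk⟩ : ∃ k, M l x y ∈ I k := ⟨_, hN _ (hM.pos hl hx hy)⟩
    rw [hF (max n k) _ (hmono (le_max_right _ _) hk), hF (max n k) x (hmono (le_max_left _ _) h1),
      hF (max n k) y (hmono (le_max_left _ _) h2)]
    exact hF1 _ l hl x (hmono (le_max_left _ _) h1) y (hmono (le_max_left _ _) h2)
  · obtain ⟨n, h1, h2⟩ := hcov2 x y hx hy
    simp only [hF n x h1, hF n y h2]
    exact hF2 n h1 h2 hxy

/-- The generators of the homogeneous quasi-arithmetic means. -/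
noncomputable def powGen (r x : ℝ) : ℝ := if r = 0 then -Real.log x else (1 - x ^ r) / r

/-- By homogeneity z ↦ f (k z) is another linearizer, hence affine in f. The resulting functional
equation makes f a multiple of the logarithm or 1 + κ f a power. -/
theorem IsWeightedMean.exists_powGen {M : ℝ → ℝ → ℝ → ℝ} (hM : IsWeightedMean M) :
    ∃ r, Linearizes M (powGen r) (Ioi 0) := by
  obtain ⟨f, hf, hmono, hf1, hf2⟩ := hM.exists_linearizes
  -- The values of f at the means of a / 2 and 2 a fill an interval around f a, and f is monotone.
  have hcont : ContinuousOn f (Ioi 0) := by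
    intro a ha
    have ha0 : 0 < a := ha
    refine (hmono.continuousAt_of_image_mem_nhds (Ioi_mem_nhds ha0) ?_).continuousWithinAt
    have h1 : a / 2 < a := by linarith
    have h2 : a < 2 * a := by linarith
    have ha2 : (0 : ℝ) < a / 2 := by positivity
    refine mem_of_superset (Icc_mem_nhds (hmono ha2 ha h1) (hmono ha (ha0.trans h2) h2)) ?_
    rw [← segment_eq_Icc (hmono.monotoneOn ha2 (ha0.trans h2) (h1.trans h2).le)]
    rintro _ ⟨s, t, hs, ht, hst, rfl⟩
    have hl : s ∈ Icc (0 : ℝ) 1 := ⟨hs, by linarith⟩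
    refine ⟨_, hM.pos hl ha2 (ha0.trans h2), ?_⟩
    rw [hf s hl _ ha2 _ (ha0.trans h2), ← hst]
    simp
  have hscale : ∀ k > 0, ∀ z > 0, f (k * z) = (f (k * 2) - f k) * f z + f k := by
    intro k hk z hz
    have hk' : Linearizes M (fun x => f (k * x)) (Ioi 0) := by
      intro l hl x hx y hy
      simp only
      rw [← hM.homog hl hx hy hk]
      exact hf l hl _ (mul_pos hk hx) _ (mul_pos hk hy)
    have := (hk'.affine hf 1 (-(f (k * 2) - f k)) (-f k)).eq_zero hM subset_rfl
      (u := 1) (v := 2) (mem_Ioi.2 one_pos) (mem_Ioi.2 two_pos) one_lt_two (by simp [hf1]) (by simp [hf2]) hz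
    linarith
  -- Evaluate f (2 k) as f (k · 2) and as f (2 · k).
  have hcomm : ∀ k > 0, f (k * 2) - f k = 1 + (f (2 * 2) - f 2 - 1) * f k := by
    intro k hk
    have h2 := hscale 2 two_pos k hk
    rw [mul_comm, h2, hf2]
    ring
  set κ := f (2 * 2) - f 2 - 1
  have hexp : Continuous fun s => f (Real.exp s) :=
    hcont.comp_continuous Real.continuous_exp Real.exp_pos
  by_cases hκ : κ = 0
  · have hadd : ∀ s t, f (Real.exp (s + t)) = f (Real.exp s) + f (Real.exp t) := by
      intro s t
      rw [Real.exp_add, hscale _ (Real.exp_pos s) _ (Real.exp_pos t), hcomm _ (Real.exp_pos s), hκ]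
      ring
    let φ : ℝ →+ ℝ := AddMonoidHom.mk' (fun s => f (Real.exp s)) hadd
    have hlin : ∀ s, f (Real.exp s) = s * f (Real.exp 1) := by
      intro s
      have := map_real_smul φ hexp s 1
      rwa [smul_eq_mul, mul_one] at this
    refine ⟨0, fun l hl x hx y hy => ?_⟩
    have hlog : ∀ z > 0, f z = Real.log z * f (Real.exp 1) := fun z hz => by
      rw [← hlin, Real.exp_log hz]
    have he : 0 < f (Real.exp 1) := by
      rw [← hf1]
      exact hmono (mem_Ioi.2 one_pos) (Real.exp_pos 1) (by simp)
    have := hf l hl x hx y hy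
    rw [hlog _ (hM.pos hl hx hy), hlog x hx, hlog y hy] at this
    have h3 : Real.log (M l x y) = l * Real.log x + (1 - l) * Real.log y :=
      mul_right_cancel₀ he.ne' (by linarith)
    simp only [powGen, if_true, h3]
    ring
  · let α : ℝ → ℝ := fun s => 1 + κ * f (Real.exp s)
    have hα : ∀ s t, α (s + t) = α s * α t := by
      intro s t
      simp only [α]
      rw [Real.exp_add, hscale _ (Real.exp_pos s) _ (Real.exp_pos t), hcomm _ (Real.exp_pos s)]
      ring
    have hα0 : α 0 = 1 := by simp [α, hf1]
    have hαpos : ∀ s, 0 < α s := by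
      intro s
      have h1 : α s = α (s / 2) * α (s / 2) := by rw [← hα, add_halves]
      have h2 : α s * α (-s) = 1 := by rw [← hα, add_neg_cancel, hα0]
      have h3 : α s ≠ 0 := fun h => by simp [h] at h2
      exact lt_of_le_of_ne (h1 ▸ mul_self_nonneg _) h3.symm
    have hαc : Continuous α := continuous_const.add (continuous_const.mul hexp)
    let φ : ℝ →+ ℝ := AddMonoidHom.mk' (fun s => Real.log (α s)) fun s t => by
      rw [hα, Real.log_mul (hαpos s).ne' (hαpos t).ne']
    have hφ : Continuous φ := hαc.log fun s => (hαpos s).ne'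
    set r := Real.log (α 1) with hr
    have hpow : ∀ z > 0, 1 + κ * f z = z ^ r := by
      intro z hz
      have := map_real_smul φ hφ (Real.log z) 1
      simp only [smul_eq_mul, mul_one] at this
      have h2 : Real.log (α (Real.log z)) = Real.log z * r := this
      rw [Real.rpow_def_of_pos hz, ← h2, Real.exp_log (hαpos _)]
      simp only [α, Real.exp_log hz]
    have hr0 : r ≠ 0 := by
      intro h
      have := hpow 2 two_pos
      rw [h, hf2, Real.rpow_zero] at this
      apply hκ
      linarith
    refine ⟨r, fun l hl x hx y hy => ?_⟩
    simp only [powGen, hr0, if_false, ← hpow _ (hM.pos hl hx hy), ← hpow x hx, ← hpow y hy,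
      hf l hl x hx y hy]
    field_simp
    ring

end MaxEntInference

namespace MaxEntInference

open Topology Filter Set

/-! ### The additive form of the scale, and stationary measures -/

theorem powGen_one (r : ℝ) : powGen r 1 = 0 := by
  simp [powGen]

theorem strictAntiOn_powGen (r : ℝ) : StrictAntiOn (powGen r) (Ioi 0) := by
  intro x hx y hy hxy
  unfold powGen
  split_ifs with hr
  · exact neg_lt_neg (Real.log_lt_log hx hxy)
  rcases lt_or_gt_of_ne hr with h | h
  · exact div_lt_div_of_neg_of_lt h (sub_lt_sub_left (Real.rpow_lt_rpow_of_neg hx hxy h) _)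
  · exact div_lt_div_of_pos_right (sub_lt_sub_left (Real.rpow_lt_rpow hx.le hxy h) _) h

theorem continuousOn_powGen (r : ℝ) : ContinuousOn (powGen r) (Ioi 0) := by
  unfold powGen
  split_ifs with hr
  · exact (Real.continuousOn_log.mono fun x hx => ne_of_gt hx).neg
  · exact (continuousOn_const.sub
      (continuousOn_id.rpow_const fun x hx => Or.inl (ne_of_gt hx))).div_const _

section
variable {S : EntropyFunctional} {r : ℝ}

/-- Adding one state at a time: the scale of P is the weighted mean of the scale of the rest and of
the mass of the new state, and ψ linearizes that mean. -/
theorem mul_powGen_eps (hS : Admissible S) (hr : Linearizes (mean S) (powGen r) (Ioi 0))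
    (ι : Type) [Fintype ι] : ∀ P ∈ measures ι,
      (∑ i, P i) * powGen r (eps S P) = ∑ i, P i * powGen r (P i) := by
  refine Fintype.induction_empty_option (P := fun ι _ => ∀ P ∈ measures ι,
    (∑ i, P i) * powGen r (eps S P) = ∑ i, P i * powGen r (P i)) ?_ ?_ ?_ ι
  · intro α β _ e ih P hP
    let _ := Fintype.ofEquiv β e.symm
    have h1 := ih (P ∘ e) ⟨fun i => hP.1 _, by
      have := hP.2
      rwa [← e.sum_comp] at this⟩
    rw [eps_comp hS e.injective hP fun i hi => (hi (e.surjective i)).elim] at h1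
    rw [← e.sum_comp, ← e.sum_comp (fun i => P i * powGen r (P i))]
    exact h1
  · intro P hP
    simp [measures] at hP
  · intro α _ ih P hP
    have h0 := hP.1
    have hsum := hP.2
    rw [Fintype.sum_option] at hsum
    rw [Fintype.sum_option, Fintype.sum_option]
    have hs0 : 0 ≤ ∑ i, P (some i) := Finset.sum_nonneg fun i _ => h0 _
    rcases (h0 none).eq_or_lt with hn | hn
    · rw [← hn, zero_add] at hsum
      have h1 := ih (P ∘ some) ⟨fun i => h0 _, hsum⟩
      rw [eps_comp hS (Option.some_injective α) hP (by
        rintro (_ | i) hi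
        · exact hn.symm
        · exact (hi ⟨i, rfl⟩).elim)] at h1
      rw [← hn, zero_add, zero_mul, zero_add]
      exact h1
    rcases hs0.eq_or_lt with hz | hz
    · have hz' : ∀ i, P (some i) = 0 := fun i =>
        (Finset.sum_eq_zero_iff_of_nonneg fun i _ => h0 _).1 hz.symm i (Finset.mem_univ i)
      classical
      have : P = Pi.single none (P none) := by
        ext (_ | i)
        · simp
        · simp [hz']
      rw [this, eps_single hS none hn]
      simp
    · have hA : P ∘ some ∈ measures α := ⟨fun i => h0 _, hz⟩
      have hB : (fun _ : Unit => P none) ∈ measures Unit := ⟨fun _ => hn.le, by simpa using hn⟩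
      have e1 : eps S (fun _ : Unit => P none) = P none := eps_const hS hn
      have hm := ((hasEps_of_mem hA).sum_elim_mean hS (eps_pos hS hA) (eps_pos hS hB)
        (hasEps_of_mem hB)).comp_equiv hS (Equiv.optionEquivSumPUnit α)
      have hP' : Sum.elim (P ∘ some) (fun _ : Unit => P none) ∘ Equiv.optionEquivSumPUnit α = P := by
        ext (_ | i) <;> simp
      simp only [hP', e1, Finset.univ_unique, Finset.sum_singleton, Function.comp_apply] at hm
      have ht : 0 < ∑ i, P (some i) + P none := by linarith
      rw [hm.eps ht, hr _ ⟨by positivity, (div_le_one ht).2 (by linarith)⟩ _ (eps_pos hS hA) _ hn]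
      have h1 := ih _ hA
      simp only [Function.comp_apply] at h1
      rw [← h1]
      field_simp
      ring

theorem HasEps.mul_powGen (hS : Admissible S) (hr : Linearizes (mean S) (powGen r) (Ioi 0))
    {ι : Type} [Fintype ι] {A : ι → ℝ} {t x : ℝ} (h : HasEps S A t x) (ht : 0 < t) :
    ∑ i, A i * powGen r (A i) = t * powGen r x := by
  rw [← mul_powGen_eps hS hr ι A (h.mem ht), h.sum, h.eps ht]

/-- For (1 - p, p) with p → 0 the scale tends to 1, so p ψ(p) → 0. If r ≤ -1, then p ψ(p) ≥ (1 - p)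
/ (-r), which stays away from 0. -/
theorem neg_one_lt_of_linearizes (hS : Admissible S)
    (hr : Linearizes (mean S) (powGen r) (Ioi 0)) : -1 < r := by
  by_contra! hr1
  have hr0 : r ≠ 0 := by
    rintro rfl
    linarith
  let P : ℝ → Bool → ℝ := fun p b => bif b then p else 1 - p
  have hP : ∀ p ∈ Icc (0 : ℝ) 1, P p ∈ measures Bool := by
    intro p hp
    refine ⟨?_, by simp [P]⟩
    rintro (_ | _)
    exacts [sub_nonneg.2 hp.2, hp.1]
  have hPc : Continuous P := by
    refine continuous_pi ?_
    rintro (_ | _) <;> simp [P] <;> fun_prop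
  have hP0 : P 0 = Pi.single false 1 := by
    ext (_ | _) <;> simp [P]
  have hIcc : Ioo (0 : ℝ) 1 ∈ 𝓝[>] 0 := Ioo_mem_nhdsGT one_pos
  have hlim : Tendsto (fun p => eps S (P p)) (𝓝[>] 0) (𝓝 1) := by
    have h1 := (continuousOn_eps hS (P 0) (hP 0 (by simp))).tendsto.comp
      (tendsto_nhdsWithin_iff.2 ⟨(hPc.tendsto 0).mono_left nhdsWithin_le_nhds, by
        filter_upwards [hIcc] with p hp using hP p (Ioo_subset_Icc_self hp)⟩ :
        Tendsto P (𝓝[>] 0) _)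
    rwa [hP0, eps_single hS false one_pos] at h1
  have hψ : Tendsto (powGen r) (𝓝 1) (𝓝 0) := by
    have := ((continuousOn_powGen r).continuousAt (Ioi_mem_nhds one_pos)).tendsto
    rwa [powGen_one] at this
  have h2 : Tendsto (fun p : ℝ => (1 - p) * powGen r (1 - p)) (𝓝[>] 0) (𝓝 0) := by
    have : Tendsto (fun p : ℝ => 1 - p) (𝓝[>] 0) (𝓝 1) := by
      have : Tendsto (fun p : ℝ => 1 - p) (𝓝 0) (𝓝 (1 - 0)) := tendsto_const_nhds.sub tendsto_id
      rw [sub_zero] at this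
      exact this.mono_left nhdsWithin_le_nhds
    simpa using this.mul (hψ.comp this)
  have h3 : Tendsto (fun p : ℝ => p * powGen r p) (𝓝[>] 0) (𝓝 0) := by
    have := (hψ.comp hlim).sub h2
    rw [sub_zero] at this
    refine this.congr' ?_
    filter_upwards [hIcc] with p hp
    have := mul_powGen_eps hS hr Bool (P p) (hP p (Ioo_subset_Icc_self hp))
    simp only [Fintype.sum_bool, P, cond_true, cond_false, add_sub_cancel, one_mul] at this
    simp only [Function.comp_apply, P, this, add_sub_cancel_right]
  have h4 : Tendsto (fun p : ℝ => (1 - p) / -r) (𝓝[>] 0) (𝓝 ((1 - 0) / -r)) :=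
    ((tendsto_const_nhds.sub tendsto_id).div_const _ : Tendsto _ (𝓝 (0 : ℝ)) _).mono_left
      nhdsWithin_le_nhds
  have h5 := le_of_tendsto_of_tendsto h4 h3 (by
    filter_upwards [hIcc] with p hp
    have h6 : 1 ≤ p ^ (r + 1) :=
      Real.one_le_rpow_of_pos_of_le_one_of_nonpos hp.1 hp.2.le (by linarith)
    rw [Real.rpow_add_one hp.1.ne'] at h6
    simp only [powGen, hr0, if_false, mul_div_assoc']
    rw [← neg_div_neg_eq (p * (1 - p ^ r))]
    refine div_le_div_of_nonneg_right ?_ (by linarith)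
    linarith)
  have : 0 < (1 - 0) / -r := div_pos (by norm_num) (by linarith)
  linarith

theorem eps_pointed_powGen (hS : Admissible S) (hr : Linearizes (mean S) (powGen r) (Ioi 0))
    {I κ : Type} [Fintype I] [Fintype κ] [Nonempty I] {x w : I → ℝ} {A : I → κ → ℝ} {T : ℝ}
    (hT : 0 < T) (hx : ∀ i, 0 < x i) (hw : ∀ i, 0 < w i) (hwx : ∀ i, 0 < w i * T - x i)
    (hA : ∀ i, HasEps S (A i) (w i * T - x i) (x i)) :
    0 < eps S (pointed x A) ∧
      (∑ i, w i) * powGen r (eps S (pointed x A)) = ∑ i, w i * powGen r (x i) := by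
  have hsum : ∑ p, pointed x A p = (∑ i, w i) * T := by
    rw [Fintype.sum_prod_type, Finset.sum_mul]
    refine Finset.sum_congr rfl fun i _ => ?_
    simp [pointed, Fintype.sum_option, (hA i).sum]
  have hmem : pointed x A ∈ measures (I × Option κ) := by
    refine ⟨?_, ?_⟩
    · rintro ⟨i, _ | k⟩
      exacts [(hx i).le, (hA i).nonneg k]
    · rw [hsum]
      exact mul_pos (Finset.sum_pos (fun i _ => hw i) Finset.univ_nonempty) hT
  refine ⟨eps_pos hS hmem, mul_right_cancel₀ hT.ne' ?_⟩
  have := mul_powGen_eps hS hr _ _ hmem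
  rw [hsum, Fintype.sum_prod_type] at this
  rw [mul_right_comm, this, Finset.sum_mul]
  refine Finset.sum_congr rfl fun i _ => ?_
  simp only [pointed, Fintype.sum_option, Option.elim_none, Option.elim_some,
    (hA i).mul_powGen hS hr (hwx i)]
  ring

/-- A positive measure at which the derivative of `∑ i, ∫ powGen r (P i)` along `d` vanishes is
optimal in the direction `d`. -/
theorem Opt.of_stationary (hS : Admissible S) (hr : Linearizes (mean S) (powGen r) (Ioi 0))
    {ι : Type} [Fintype ι] {z d : ι → ℝ} (hz : ∀ i, 0 < z i) (hd : ∑ i, d i = 0)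
    (hdz : ∑ i, d i * powGen r (z i) = 0) (hd0 : d ≠ 0) : Opt S z (Submodule.span ℝ {d}) := by
  classical
  -- Gaining and losing states form the two sides of `Opt.of_eps_pointed`. Each state gets a
  -- companion such that the block mass is T |d i|, with T large enough for the companions to exist.
  let j : {i // 0 < d i} ⊕ {i // d i < 0} → ι := Sum.elim Subtype.val Subtype.val
  have hj : Function.Injective j := by
    rintro (⟨a, ha⟩ | ⟨a, ha⟩) (⟨b, hb⟩ | ⟨b, hb⟩) hab <;> simp only [j, Sum.elim_inl, Sum.elim_inr] at hab
    · subst hab; rfl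
    · subst hab; exact (ha.asymm hb).elim
    · subst hab; exact (ha.asymm hb).elim
    · subst hab; rfl
  have hrange : ∀ i, i ∉ range j → d i = 0 := by
    intro i hi
    by_contra h
    rcases lt_or_gt_of_ne h with h | h
    · exact hi ⟨Sum.inr ⟨i, h⟩, rfl⟩
    · exact hi ⟨Sum.inl ⟨i, h⟩, rfl⟩
  have hsplit : ∀ f : ι → ℝ, ∑ i : {i // 0 < d i}, d i * f i - ∑ i : {i // d i < 0}, -d i * f i
      = ∑ i, d i * f i := by
    intro f
    rw [← sum_comp_eq_of_injective hj (P := fun i => d i * f i) fun i hi => by simp [hrange i hi],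
      Fintype.sum_sum_type]
    simp [j]
  have hI : Nonempty {i // 0 < d i} := by
    by_contra hne
    rw [not_nonempty_iff, isEmpty_subtype] at hne
    refine hd0 (funext fun i => ?_)
    exact (Finset.sum_eq_zero_iff_of_nonpos fun i _ => not_lt.1 (hne i)).1 hd i (Finset.mem_univ i)
  have hJ : Nonempty {i // d i < 0} := by
    by_contra hne
    rw [not_nonempty_iff, isEmpty_subtype] at hne
    refine hd0 (funext fun i => ?_)
    exact (Finset.sum_eq_zero_iff_of_nonneg fun i _ => not_lt.1 (hne i)).1 hd i (Finset.mem_univ i)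
  have hw : ∀ i, 0 < |d (j i)| := by
    rintro (⟨i, hi⟩ | ⟨i, hi⟩)
    exacts [abs_pos.2 hi.ne', abs_pos.2 hi.ne]
  obtain ⟨T₀, hT₀⟩ := exists_pointed hS (w := fun i => |d (j i)|) (x := z ∘ j) hw fun i => hz _
  obtain ⟨T₁, hT₁⟩ := (Set.finite_range fun i => (z ∘ j) i / |d (j i)|).bddAbove
  set T := max (max T₀ (T₁ + 1)) 1
  have hT : 0 < T := one_pos.trans_le (le_max_right _ _)
  have hwT : ∀ i, 0 < |d (j i)| * T - (z ∘ j) i := by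
    intro i
    have h1 : (z ∘ j) i / |d (j i)| < T := by
      have := hT₁ ⟨i, rfl⟩
      have h2 : T₁ + 1 ≤ T := (le_max_right _ _).trans (le_max_left _ _)
      simp only at this
      linarith
    rw [div_lt_iff₀' (hw i)] at h1
    linarith
  obtain ⟨n, hn⟩ := hT₀ T ((le_max_left _ _).trans (le_max_left _ _))
  obtain ⟨A, hA⟩ := hn n le_rfl
  obtain ⟨p1, e1⟩ := eps_pointed_powGen hS hr hT (fun i => hz _) (fun i => hw (Sum.inl i))
    (fun i => hwT (Sum.inl i)) fun i => hA (Sum.inl i)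
  obtain ⟨p2, e2⟩ := eps_pointed_powGen hS hr hT (fun i => hz _) (fun i => hw (Sum.inr i))
    (fun i => hwT (Sum.inr i)) fun i => hA (Sum.inr i)
  have hl : ∀ i : {i // 0 < d i}, |d (j (Sum.inl i))| = d i := fun i => abs_of_pos i.2
  have hr' : ∀ i : {i // d i < 0}, |d (j (Sum.inr i))| = -d i := fun i => abs_of_neg i.2
  -- The two sides have equal total weight because d sums to 0, and equal ψ-averages because d is
  -- stationary; as ψ is injective their scales coincide.
  have heps : eps S (pointed (fun i => (z ∘ j) (Sum.inl i)) fun i => A (Sum.inl i))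
      = eps S (pointed (fun i => (z ∘ j) (Sum.inr i)) fun i => A (Sum.inr i)) := by
    refine (strictAntiOn_powGen r).injOn p1 p2 ?_
    have hm : 0 < ∑ i : {i // 0 < d i}, d i := Finset.sum_pos (fun i _ => i.2) Finset.univ_nonempty
    have h1 := hsplit fun i => powGen r (z i)
    have h2 := hsplit fun _ => 1
    simp only [mul_one] at h2
    rw [hdz] at h1
    rw [hd] at h2
    simp only [hl, hr'] at e1 e2
    rw [← sub_eq_zero.1 h2] at e2
    exact mul_left_cancel₀ hm.ne' ((e1.trans (sub_eq_zero.1 h1)).trans e2.symm)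
  have hopt := Opt.of_eps_pointed hS (fun i => hz _) (fun i => hz _)
    (fun i => (hA (Sum.inl i)).mem (hwT _)) (fun i => (hA (Sum.inr i)).mem (hwT _))
    (fun i => (hA (Sum.inl i)).eps (hwT _)) (fun i => (hA (Sum.inr i)).eps (hwT _)) heps
  have hzj : (Sum.elim (fun i => z (j (Sum.inl i))) fun i => z (j (Sum.inr i))) = z ∘ j := by
    ext (i | i) <;> rfl
  rw [hzj] at hopt
  refine (Opt.extend hS.uniq hS.sub hj (fun i => (hz i).le) hopt).mono fun Q _ _ hQ => ?_
  obtain ⟨t, ht⟩ := Submodule.mem_span_singleton.1 hQ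
  refine ⟨Submodule.mem_span_singleton.2 ⟨t / T, ?_⟩, fun i hi => ?_⟩
  · rw [← ht]
    ext (i | i)
    · simp only [(hA _).sum, hl, Pi.smul_apply, Sum.elim_inl, smul_eq_mul, Function.comp_apply]
      simp only [j, Sum.elim_inl]
      field_simp
      ring
    · simp only [(hA _).sum, hr', Pi.smul_apply, Sum.elim_inr, smul_eq_mul, Function.comp_apply]
      simp only [j, Sum.elim_inr]
      field_simp
      ring
  · rw [← ht, Pi.smul_apply, hrange i hi, smul_zero]

end

end MaxEntInference

namespace MaxEntInference

open Topology Filter Set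

/-! ### The concave potential and its ascent lines -/

/-- An antiderivative of `powGen r`. -/
noncomputable def powPot (r x : ℝ) : ℝ :=
  if r = 0 then Real.negMulLog x + x else (x - x ^ (r + 1) / (r + 1)) / r

theorem hasDerivAt_powPot {r x : ℝ} (hr : -1 < r) (hx : 0 < x) :
    HasDerivAt (powPot r) (powGen r x) x := by
  unfold powPot powGen
  split_ifs with h
  · have := (Real.hasDerivAt_negMulLog hx.ne').add (hasDerivAt_id x)
    exact this.congr_deriv (by ring)
  · have h1 : r + 1 ≠ 0 := by linarith
    have := ((hasDerivAt_id x).sub ((Real.hasDerivAt_rpow_const (p := r + 1)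
      (Or.inl hx.ne')).div_const (r + 1))).div_const r
    refine this.congr_deriv ?_
    rw [add_sub_cancel_right, mul_div_cancel_left₀ _ h1]

theorem continuousOn_powPot {r : ℝ} (hr : -1 < r) : ContinuousOn (powPot r) (Ici 0) := by
  unfold powPot
  split_ifs with h
  · exact (Real.continuous_negMulLog.add continuous_id).continuousOn
  · exact (continuousOn_id.sub ((continuousOn_id.rpow_const fun x _ => Or.inr
      (by linarith)).div_const _)).div_const _

theorem strictConcaveOn_powPot {r : ℝ} (hr : -1 < r) : StrictConcaveOn ℝ (Ici 0) (powPot r) := by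
  refine StrictAntiOn.strictConcaveOn_of_deriv (convex_Ici 0) (continuousOn_powPot hr) ?_
  rw [interior_Ici]
  intro x hx y hy hxy
  rw [(hasDerivAt_powPot hr hx).deriv, (hasDerivAt_powPot hr hy).deriv]
  exact strictAntiOn_powGen r hx hy hxy

theorem powPot_sub_le {r x y : ℝ} (hr : -1 < r) (hx : 0 < x) (hy : 0 ≤ y) :
    powPot r y - powPot r x ≤ powGen r x * (y - x) := by
  have hc := (strictConcaveOn_powPot hr).concaveOn
  rcases lt_trichotomy x y with h | rfl | h
  · have := hc.slope_le_of_hasDerivAt (mem_Ici.2 hx.le) hy h (hasDerivAt_powPot hr hx)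
    rwa [slope_def_field, div_le_iff₀ (sub_pos.2 h)] at this
  · simp
  · have := hc.le_slope_of_hasDerivAt hy (mem_Ici.2 hx.le) h (hasDerivAt_powPot hr hx)
    rw [slope_def_field, le_div_iff₀ (sub_pos.2 h)] at this
    linarith

variable {ι : Type} [Fintype ι] {S : EntropyFunctional} {r : ℝ}

noncomputable def pot (r : ℝ) (p : ι → ℝ) : ℝ := ∑ i, powPot r (p i)

theorem strictConcaveOn_pot (hr : -1 < r) :
    StrictConcaveOn ℝ {p : ι → ℝ | ∀ i, 0 ≤ p i} (pot r) := by
  refine ⟨fun p hp q hq a b ha hb _ i => ?_, fun p hp q hq hpq a b ha hb hab => ?_⟩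
  · simpa using add_nonneg (mul_nonneg ha (hp i)) (mul_nonneg hb (hq i))
  · obtain ⟨i, hi⟩ := Function.ne_iff.1 hpq
    simp only [pot, smul_eq_mul, Finset.mul_sum, ← Finset.sum_add_distrib]
    exact Finset.sum_lt_sum
      (fun j _ => (strictConcaveOn_powPot hr).concaveOn.2 (hp j) (hq j) ha.le hb.le hab)
      ⟨i, Finset.mem_univ i, (strictConcaveOn_powPot hr).2 (hp i) (hq i) hi ha hb hab⟩

theorem continuousOn_pot (hr : -1 < r) : ContinuousOn (pot r) {p : ι → ℝ | ∀ i, 0 ≤ p i} :=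
  continuousOn_finsetSum _ fun i _ =>
    (continuousOn_powPot hr).comp (continuous_apply i).continuousOn fun _ hp => hp i

theorem pot_sub_le (hr : -1 < r) {p q : ι → ℝ} (hp : ∀ i, 0 < p i) (hq : ∀ i, 0 ≤ q i) :
    pot r q - pot r p ≤ ∑ i, (q i - p i) * powGen r (p i) := by
  rw [pot, pot, ← Finset.sum_sub_distrib]
  refine Finset.sum_le_sum fun i _ => ?_
  rw [mul_comm]
  exact powPot_sub_le hr (hp i) (hq i)

theorem ent_add_le_of_stationary (hS : Admissible S)
    (hr : Linearizes (mean S) (powGen r) (Ioi 0)) {z d : ι → ℝ} (hz : ∀ i, 0 < z i)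
    (hz1 : ∑ i, z i = 1) (hd : ∑ i, d i = 0) (hdz : ∑ i, d i * powGen r (z i) = 0)
    (h0 : ∀ i, 0 ≤ z i + d i) : ent S (z + d) ≤ ent S z := by
  by_cases hd0 : d = 0
  · simp [hd0]
  have := (Opt.of_stationary hS hr hz hd hdz hd0).le (z + d) h0
    (by simp [Finset.sum_add_distrib, hd])
    (by simp)
  simpa [hz1] using this

theorem exists_tangent (hι : 3 ≤ Fintype.card ι) (g : ι → ℝ) :
    ∃ τ : ι → ℝ, τ ≠ 0 ∧ ∑ i, τ i = 0 ∧ ∑ i, τ i * g i = 0 := by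
  let f : (ι → ℝ) →ₗ[ℝ] ℝ × ℝ :=
    (∑ i, LinearMap.proj i).prod (∑ i, g i • LinearMap.proj i)
  have hf : LinearMap.ker f ≠ ⊥ := LinearMap.ker_ne_bot_of_finrank_lt (by simp; omega)
  obtain ⟨τ, hτ, h0⟩ := Submodule.exists_mem_ne_zero_of_ne_bot hf
  have h1 := LinearMap.mem_ker.1 hτ
  simp only [f, LinearMap.prod_apply, Function.prod_apply, Prod.mk_eq_zero, LinearMap.sum_apply,
    LinearMap.smul_apply, LinearMap.proj_apply, smul_eq_mul] at h1
  exact ⟨τ, h0, h1.1, by simpa [mul_comm] using h1.2⟩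

theorem continuousAt_powGen {x : ℝ} (hx : 0 < x) : ContinuousAt (powGen r) x :=
  (continuousOn_powGen r).continuousAt (Ioi_mem_nhds hx)

/-- Stationarity only shows that S does not increase when leaving a point along a line tangent there
to a level set of Φ. To compare z with z' = z + ε d, choose w on a tangent line at z' such that z
lies on a tangent line at w; then S z ≤ S w ≤ S z'. A tangent direction τ at z exists because there
are at least three states. -/
theorem eventually_ent_le (hS : Admissible S) (hr : Linearizes (mean S) (powGen r) (Ioi 0))
    (hι : 3 ≤ Fintype.card ι) {z d : ι → ℝ} (hz : ∀ i, 0 < z i) (hz1 : ∑ i, z i = 1)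
    (hd : ∑ i, d i = 0) (hD : 0 < ∑ i, d i * powGen r (z i)) :
    ∀ᶠ ε in 𝓝[>] (0 : ℝ), ent S z ≤ ent S (z + ε • d) := by
  obtain ⟨τ, hτ0, hτ, hτz⟩ := exists_tangent hι fun i => powGen r (z i)
  obtain ⟨ρ₀, hρz, hρ₀⟩ : ∃ ρ₀ : ℝ, (∀ i, 0 < z i + ρ₀ * τ i) ∧ 0 < ρ₀ := by
    have : ∀ᶠ ρ in 𝓝[>] (0 : ℝ), ∀ i, 0 < z i + ρ * τ i := by
      refine nhdsWithin_le_nhds (eventually_all.2 fun i => ?_)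
      have : ContinuousAt (fun ρ : ℝ => z i + ρ * τ i) 0 := by fun_prop
      exact this.eventually_const_lt (by simpa using hz i)
    exact (this.and self_mem_nhdsWithin).exists
  let z' : ℝ → ι → ℝ := fun ε i => z i + ε * d i
  let D' : ℝ → ℝ := fun ε => ∑ i, d i * powGen r (z' ε i)
  -- Corrects τ by a multiple of d so that it is tangent at z' instead of z.
  let c : ℝ → ℝ := fun ε => -(∑ i, τ i * powGen r (z' ε i)) / D' ε
  let w : ℝ → ℝ → ι → ℝ := fun ε ρ i => z' ε i + ρ * (τ i + c ε * d i)
  -- F is the derivative of Φ at w towards z. It is negative at ρ = 0 for small ε > 0. At ε = 0, ρ =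
  -- ρ₀ it is positive, since ψ is strictly decreasing, and remains so for small ε; a zero in
  -- between is the required w.
  let F : ℝ → ℝ → ℝ := fun ε ρ => ∑ i, (z i - w ε ρ i) * powGen r (w ε ρ i)
  have hz'0 : z' 0 = z := by ext i; simp [z']
  have hc0 : c 0 = 0 := by simp [c, hz'0, hτz]
  have hw0 : ∀ ρ i, w 0 ρ i = z i + ρ * τ i := fun ρ i => by simp [w, hc0, hz'0]
  have cz : ∀ i, ContinuousAt (fun ε => z' ε i) 0 := fun i => by
    simp only [z']
    fun_prop
  have cψ : ∀ i, ContinuousAt (fun ε => powGen r (z' ε i)) 0 := fun i =>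
    ContinuousAt.comp (g := powGen r) (by rw [hz'0]; exact continuousAt_powGen (hz i)) (cz i)
  have cD : ContinuousAt D' 0 := tendsto_finsetSum _ fun i _ => continuousAt_const.mul (cψ i)
  have hD0 : 0 < D' 0 := by simpa [D', hz'0] using hD
  have cc : ContinuousAt c 0 :=
    ContinuousAt.div (ContinuousAt.neg (tendsto_finsetSum _ fun i _ =>
      continuousAt_const.mul (cψ i))) cD hD0.ne'
  have cw : ∀ i, ContinuousAt (fun ε => w ε ρ₀ i) 0 := fun i =>
    (cz i).add (continuousAt_const.mul (continuousAt_const.add (cc.mul continuousAt_const)))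
  have cF : ContinuousAt (fun ε => F ε ρ₀) 0 := tendsto_finsetSum _ fun i _ =>
    (continuousAt_const.sub (cw i)).mul <| ContinuousAt.comp (g := powGen r)
      (by rw [hw0]; exact continuousAt_powGen (hρz i)) (cw i)
  have hF0 : 0 < F 0 ρ₀ := by
    obtain ⟨i, hi⟩ := Function.ne_iff.1 hτ0
    have key : ∀ i, τ i ≠ 0 → ρ₀ * (τ i * powGen r (z i + ρ₀ * τ i)) < ρ₀ * (τ i * powGen r (z i)) := by
      intro i hi
      refine mul_lt_mul_of_pos_left ?_ hρ₀
      rcases lt_or_gt_of_ne hi with h | h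
      · refine mul_lt_mul_of_neg_left (strictAntiOn_powGen r (hρz i) (hz i) ?_) h
        linarith [mul_neg_of_pos_of_neg hρ₀ h]
      · refine mul_lt_mul_of_pos_left (strictAntiOn_powGen r (hz i) (hρz i) ?_) h
        linarith [mul_pos hρ₀ h]
    have : ∑ i, ρ₀ * (τ i * powGen r (z i + ρ₀ * τ i)) < ∑ i, ρ₀ * (τ i * powGen r (z i)) := by
      refine Finset.sum_lt_sum (fun i _ => ?_) ⟨i, Finset.mem_univ i, key i hi⟩
      by_cases h : τ i = 0
      · simp [h]
      · exact (key i h).le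
    rw [← Finset.mul_sum, ← Finset.mul_sum, hτz, mul_zero, Finset.mul_sum] at this
    have e : F 0 ρ₀ = -∑ i, ρ₀ * (τ i * powGen r (z i + ρ₀ * τ i)) := by
      rw [← Finset.sum_neg_distrib]
      refine Finset.sum_congr rfl fun i _ => ?_
      rw [hw0]
      ring
    rw [e]
    linarith
  have hev : ∀ᶠ ε in 𝓝 (0 : ℝ), (∀ i, 0 < z' ε i) ∧ 0 < D' ε ∧ (∀ i, 0 < w ε ρ₀ i) ∧ 0 < F ε ρ₀ :=
    (eventually_all.2 fun i => (cz i).eventually_const_lt (by simpa [hz'0] using hz i)).and <|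
      (cD.eventually_const_lt hD0).and <|
      (eventually_all.2 fun i => (cw i).eventually_const_lt (by simpa [hw0] using hρz i)).and <|
      cF.eventually_const_lt hF0
  filter_upwards [nhdsWithin_le_nhds hev, self_mem_nhdsWithin] with ε ⟨h1, h2, h3, h4⟩ hε
  have hε0 : 0 < ε := hε
  have hwpos : ∀ ρ ∈ Icc 0 ρ₀, ∀ i, 0 < w ε ρ i := by
    intro ρ hρ i
    have e : ρ₀ * w ε ρ i = (ρ₀ - ρ) * z' ε i + ρ * w ε ρ₀ i := by
      simp only [w]
      ring
    refine pos_of_mul_pos_right (a := ρ₀) ?_ hρ₀.le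
    rw [e]
    rcases hρ.1.eq_or_lt with h | h
    · rw [← h]
      simpa using mul_pos hρ₀ (h1 i)
    · have := mul_pos h (h3 i)
      have := mul_nonneg (sub_nonneg.2 hρ.2) (h1 i).le
      linarith
  have hFc : ContinuousOn (F ε) (Icc 0 ρ₀) := by
    refine continuousOn_finsetSum _ fun i _ => ?_
    have hc : ContinuousOn (fun ρ => w ε ρ i) (Icc 0 ρ₀) := by
      simp only [w]
      fun_prop
    exact (continuousOn_const.sub hc).mul ((continuousOn_powGen r).comp hc fun ρ hρ => hwpos ρ hρ i)
  have hF00 : F ε 0 ≤ 0 := by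
    have : F ε 0 = -(ε * D' ε) := by
      simp only [F, D', Finset.mul_sum, ← Finset.sum_neg_distrib]
      refine Finset.sum_congr rfl fun i _ => ?_
      simp only [w, zero_mul, add_zero]
      simp only [z']
      ring
    rw [this]
    have := mul_pos hε0 h2
    linarith
  obtain ⟨ρ, hρ, hFρ⟩ := intermediate_value_Icc hρ₀.le hFc ⟨hF00, h4.le⟩
  have hz's : ∑ i, z' ε i = 1 := by
    simp [z', Finset.sum_add_distrib, ← Finset.mul_sum, hz1, hd]
  have hws : ∑ i, w ε ρ i = 1 := by
    simp only [w, Finset.sum_add_distrib, ← Finset.mul_sum, hz's, hd, hτ]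
    ring
  have hzw : ent S z ≤ ent S (w ε ρ) := by
    have := ent_add_le_of_stationary hS hr (hwpos ρ hρ) hws (d := z - w ε ρ)
      (by simp [hz1, hws]) hFρ (fun i => by simpa using (hz i).le)
    simpa using this
  have hwz : ent S (w ε ρ) ≤ ent S (z' ε) := by
    refine ent_add_le_of_stationary hS hr h1 hz's (d := fun i => ρ * (τ i + c ε * d i)) ?_ ?_
      fun i => (hwpos ρ hρ i).le
    · simp only [← Finset.mul_sum, Finset.sum_add_distrib, hd, hτ]
      ring
    · have : ∑ i, ρ * (τ i + c ε * d i) * powGen r (z' ε i)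
          = ρ * (∑ i, τ i * powGen r (z' ε i) + c ε * D' ε) := by
        simp only [D', Finset.mul_sum, ← Finset.sum_add_distrib]
        refine Finset.sum_congr rfl fun i _ => ?_
        ring
      rw [this]
      simp only [c]
      rw [div_mul_cancel₀ _ h2.ne', add_neg_cancel, mul_zero]
  exact hzw.trans hwz

end MaxEntInference

namespace MaxEntInference

open Topology Filter Set

/-! ### Maximizers of the potential are optimal -/

section
variable {ι : Type} [Fintype ι] {S : EntropyFunctional} {r : ℝ}

theorem line_mem_stdSimplex {z₀ z₁ : ι → ℝ} (h0 : z₀ ∈ stdSimplex ℝ ι) (h1 : z₁ ∈ stdSimplex ℝ ι)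
    {s : ℝ} (hs : s ∈ Icc (0 : ℝ) 1) : z₀ + s • (z₁ - z₀) ∈ stdSimplex ℝ ι :=
  (convex_stdSimplex ℝ ι).add_smul_sub_mem h0 h1 hs

theorem line_pos {ι : Type} {z₀ z₁ : ι → ℝ} (h0 : ∀ i, 0 < z₀ i) (h1 : ∀ i, 0 < z₁ i)
    {s : ℝ} (hs : s ∈ Icc (0 : ℝ) 1) (i : ι) : 0 < (z₀ + s • (z₁ - z₀)) i :=
  (convex_Ioi (0 : ℝ)).add_smul_sub_mem (h0 i) (h1 i) hs

/-- Continuous induction along the segment. Concavity keeps Φ below its value at z₁ up to time t, so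
its derivative towards z₁ is positive and `eventually_ent_le` extends the inequality to the right.
-/
theorem ent_le_of_pot_lt (hS : Admissible S) (hr : Linearizes (mean S) (powGen r) (Ioi 0))
    (hι : 3 ≤ Fintype.card ι) {z₀ z₁ : ι → ℝ} (h0 : z₀ ∈ stdSimplex ℝ ι) (h1 : z₁ ∈ stdSimplex ℝ ι)
    (p0 : ∀ i, 0 < z₀ i) (p1 : ∀ i, 0 < z₁ i) {t : ℝ} (ht : t ∈ Ico (0 : ℝ) 1)
    (hlt : pot r (z₀ + t • (z₁ - z₀)) < pot r z₁) : ent S z₀ ≤ ent S (z₀ + t • (z₁ - z₀)) := by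
  have hr1 := neg_one_lt_of_linearizes hS hr
  let ℓ : ℝ → ι → ℝ := fun s => z₀ + s • (z₁ - z₀)
  have hℓc : Continuous ℓ := by fun_prop
  have hlt' : ∀ s ∈ Icc 0 t, pot r (ℓ s) < pot r z₁ := by
    intro s hs
    by_contra! hge
    have hs1 : 0 < 1 - s := by linarith [hs.2, ht.2]
    have hs' : s ∈ Icc (0 : ℝ) 1 := ⟨hs.1, by linarith⟩
    have hmem : ℓ t ∈ segment ℝ (ℓ s) z₁ := by
      refine ⟨(1 - t) / (1 - s), (t - s) / (1 - s), div_nonneg (by linarith [ht.2]) hs1.le,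
        div_nonneg (by linarith [hs.2]) hs1.le, by field_simp; ring, ?_⟩
      ext i
      simp only [ℓ, Pi.add_apply, Pi.smul_apply, Pi.sub_apply, smul_eq_mul]
      field_simp
      ring
    have := (strictConcaveOn_pot hr1).concaveOn.ge_on_segment
      (fun i => (line_pos p0 p1 hs' i).le) (fun i => (p1 i).le) hmem
    rw [min_eq_right hge] at this
    exact absurd hlt (not_lt.2 this)
  have hfc : ContinuousOn (fun s => ent S (ℓ s)) (Icc 0 1) :=
    (continuousOn_ent hS.cont).comp hℓc.continuousOn fun s hs => line_mem_stdSimplex h0 h1 hs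
  have hsub : Icc 0 t ⊆ {s | ent S z₀ ≤ ent S (ℓ s)} := by
    refine IsClosed.Icc_subset_of_forall_exists_gt ?_ (by simp [ℓ]) ?_
    · rw [inter_comm]
      exact ((hfc.mono (Icc_subset_Icc_right ht.2.le)).preimage_isClosed_of_isClosed isClosed_Icc
        isClosed_Ici : IsClosed (Icc 0 t ∩ (fun s => ent S (ℓ s)) ⁻¹' Ici (ent S z₀)))
    · rintro s ⟨hs, hs0, hst⟩ u hu
      have hs1 : 0 < 1 - s := by linarith [ht.2]
      have hs' : s ∈ Icc (0 : ℝ) 1 := ⟨hs0, by linarith⟩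
      have hpos := line_pos p0 p1 hs'
      have hz := line_mem_stdSimplex h0 h1 hs'
      have hD : 0 < ∑ i, (z₁ - z₀) i * powGen r (ℓ s i) := by
        refine pos_of_mul_pos_right (a := 1 - s) ?_ hs1.le
        have h2 := pot_sub_le hr1 hpos fun i => (p1 i).le
        have h3 : ∑ i, (z₁ i - ℓ s i) * powGen r (ℓ s i)
            = (1 - s) * ∑ i, (z₁ - z₀) i * powGen r (ℓ s i) := by
          rw [Finset.mul_sum]
          refine Finset.sum_congr rfl fun i _ => ?_
          simp only [ℓ, Pi.add_apply, Pi.smul_apply, Pi.sub_apply, smul_eq_mul]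
          ring
        have h4 := hlt' s ⟨hs0, hst.le⟩
        rw [← h3]
        exact (sub_pos.2 h4).trans_le h2
      have hev := eventually_ent_le hS hr hι hpos hz.2 (d := z₁ - z₀)
        (by simp [h0.2, h1.2]) hD
      obtain ⟨ε, hε, hεu⟩ := (hev.and (Ioo_mem_nhdsGT (sub_pos.2 hu))).exists
      refine ⟨s + ε, ?_, by linarith [hεu.1], by linarith [hεu.2]⟩
      refine hs.trans (hε.trans_eq ?_)
      congr 1
      ext i
      simp only [ℓ, Pi.add_apply, Pi.smul_apply, Pi.sub_apply, smul_eq_mul]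
      ring
  exact hsub ⟨ht.1, le_rfl⟩

theorem pot_lt_of_isMax (hr : -1 < r) {m y : ι → ℝ} (hm : m ∈ stdSimplex ℝ ι)
    (hy : y ∈ stdSimplex ℝ ι) {W : Submodule ℝ (ι → ℝ)} (hW : y - m ∈ W) (hne : y ≠ m)
    (hmax : ∀ p ∈ stdSimplex ℝ ι, p - m ∈ W → pot r p ≤ pot r m) : pot r y < pot r m := by
  by_contra! hge
  have h2 : (0 : ℝ) < 1 / 2 := by norm_num
  have := (strictConcaveOn_pot hr).2 hy.1 hm.1 hne h2 h2 (by norm_num)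
  have h3 := hmax _ ((convex_stdSimplex ℝ ι) hy hm h2.le h2.le (by norm_num)) (by
    have : (1 / 2 : ℝ) • y + (1 / 2 : ℝ) • m - m = (1 / 2 : ℝ) • (y - m) := by
      ext i
      simp
      ring
    rw [this]
    exact W.smul_mem _ hW)
  simp only [smul_eq_mul] at this
  linarith

/-- Follow the segment from y to m. Endpoints on the boundary are first mixed with the uniform
distribution, where the strict inequality of potentials survives a small mixing; then the mixing
tends to 0 and the endpoint is approached. -/
theorem ent_le_of_isMax (hS : Admissible S) (hr : Linearizes (mean S) (powGen r) (Ioi 0))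
    (hι : 3 ≤ Fintype.card ι) {m y : ι → ℝ} (hm : m ∈ stdSimplex ℝ ι)
    (hy : y ∈ stdSimplex ℝ ι) {W : Submodule ℝ (ι → ℝ)} (hW : y - m ∈ W)
    (hmax : ∀ p ∈ stdSimplex ℝ ι, p - m ∈ W → pot r p ≤ pot r m) : ent S y ≤ ent S m := by
  by_cases hne : y = m
  · rw [hne]
  have hr1 := neg_one_lt_of_linearizes hS hr
  have hcont : ContinuousOn (ent S) (stdSimplex ℝ ι) := continuousOn_ent hS.cont
  have hpotc : ContinuousOn (pot r) (stdSimplex ℝ ι) :=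
    (continuousOn_pot hr1).mono fun p hp => hp.1
  let u : ι → ℝ := fun _ => (Fintype.card ι : ℝ)⁻¹
  have hc : (0 : ℝ) < Fintype.card ι := by
    exact_mod_cast (show 0 < Fintype.card ι by omega)
  have hu : u ∈ stdSimplex ℝ ι := ⟨fun i => (inv_pos.2 hc).le, by simp [u, hc.ne']⟩
  have hmix : ∀ p ∈ stdSimplex ℝ ι, ∀ δ ∈ Ioc (0 : ℝ) 1, ∀ i, 0 < (p + δ • (u - p)) i := by
    intro p hp δ hδ i
    have h1 : 0 < δ * u i := mul_pos hδ.1 (inv_pos.2 hc)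
    have h2 : 0 ≤ (1 - δ) * p i := mul_nonneg (by linarith [hδ.2]) (hp.1 i)
    simp only [Pi.add_apply, Pi.smul_apply, Pi.sub_apply, smul_eq_mul]
    linarith
  have hIoc : Ioc (0 : ℝ) 1 ∈ 𝓝[>] 0 := Ioc_mem_nhdsGT one_pos
  have hlim : ∀ p ∈ stdSimplex ℝ ι,
      Tendsto (fun δ : ℝ => p + δ • (u - p)) (𝓝[>] 0) (𝓝[stdSimplex ℝ ι] p) := by
    intro p hp
    refine tendsto_nhdsWithin_iff.2 ⟨?_, ?_⟩
    · have : Continuous fun δ : ℝ => p + δ • (u - p) := by fun_prop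
      have := this.tendsto 0
      rw [zero_smul, add_zero] at this
      exact this.mono_left nhdsWithin_le_nhds
    · filter_upwards [hIoc] with δ hδ using line_mem_stdSimplex hp hu (Ioc_subset_Icc_self hδ)
  have key : ∀ t ∈ Ico (0 : ℝ) 1, ent S y ≤ ent S (y + t • (m - y)) := by
    intro t ht
    have ht' := Ico_subset_Icc_self ht
    have hyt := line_mem_stdSimplex hy hm ht'
    have hlt : pot r (y + t • (m - y)) < pot r m := by
      have e : y + t • (m - y) - m = (1 - t) • (y - m) := by
        ext i
        simp
        ring
      refine pot_lt_of_isMax hr1 hm hyt (e ▸ W.smul_mem _ hW) (fun h => ?_) hmax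
      rw [h, sub_self, eq_comm, smul_eq_zero, sub_eq_zero, sub_eq_zero] at e
      exact e.elim (fun h => ht.2.ne' h) hne
    -- Mixing with u commutes with moving along the segment.
    have hcomm : ∀ δ : ℝ, (y + δ • (u - y)) + t • ((m + δ • (u - m)) - (y + δ • (u - y)))
        = (y + t • (m - y)) + δ • (u - (y + t • (m - y))) := by
      intro δ
      ext i
      simp
      ring
    have h1 := (hpotc _ hm).tendsto.comp (hlim m hm)
    have h2 := (hpotc _ hyt).tendsto.comp (hlim _ hyt)
    have h3 := (hcont _ hy).tendsto.comp (hlim y hy)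
    have h4 := (hcont _ hyt).tendsto.comp (hlim _ hyt)
    refine le_of_tendsto_of_tendsto h3 h4 ?_
    filter_upwards [h2.eventually_lt h1 hlt, hIoc] with δ hδ hδ'
    have hδ'' := Ioc_subset_Icc_self hδ'
    have := ent_le_of_pot_lt hS hr hι (line_mem_stdSimplex hy hu hδ'')
      (line_mem_stdSimplex hm hu hδ'') (hmix y hy δ hδ') (hmix m hm δ hδ') ht
      (by rw [hcomm]; exact hδ)
    rwa [hcomm] at this
  have hfin : Tendsto (fun t : ℝ => y + t • (m - y)) (𝓝[<] 1) (𝓝[stdSimplex ℝ ι] m) := by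
    refine tendsto_nhdsWithin_iff.2 ⟨?_, ?_⟩
    · have : Continuous fun δ : ℝ => y + δ • (m - y) := by fun_prop
      have := this.tendsto 1
      rw [one_smul, add_sub_cancel] at this
      exact this.mono_left nhdsWithin_le_nhds
    · filter_upwards [Ico_mem_nhdsLT (zero_lt_one (α := ℝ))] with δ hδ
        using line_mem_stdSimplex hy hm (Ico_subset_Icc_self hδ)
  refine ge_of_tendsto ((hcont _ hm).tendsto.comp hfin) ?_
  filter_upwards [Ico_mem_nhdsLT (zero_lt_one (α := ℝ))] with t ht using key t ht

/-- Three null states are adjoined to guarantee the three states needed for tangent directions;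
restriction removes them again. -/
theorem Opt.of_isMax (hS : Admissible S) (hr : Linearizes (mean S) (powGen r) (Ioi 0))
    {m : ι → ℝ} (hm : m ∈ stdSimplex ℝ ι) {W : Submodule ℝ (ι → ℝ)}
    (hmax : ∀ p ∈ stdSimplex ℝ ι, p - m ∈ W → pot r p ≤ pot r m) : Opt S m W := by
  let m' : ι ⊕ Fin 3 → ℝ := Sum.elim m 0
  have hm' : m' ∈ stdSimplex ℝ (ι ⊕ Fin 3) := by
    refine ⟨?_, by simp [m', hm.2]⟩
    rintro (i | i)
    exacts [hm.1 i, le_rfl]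
  have hinj : Function.Injective (Sum.inl : ι → ι ⊕ Fin 3) := Sum.inl_injective
  have hopt : Opt S m' (extendSub Sum.inl W) := by
    refine ⟨hm'.1, by rw [hm'.2]; exact one_pos, fun Q h0 h1 hQ => ?_⟩
    rw [hm'.2] at h1 ⊢
    simp only [inv_one, one_smul]
    refine ent_le_of_isMax hS hr (by simp) hm' ⟨h0, h1⟩ hQ fun p hp hpW => ?_
    have hp0 : ∀ i, p (Sum.inr i) = 0 := fun i => by
      simpa [m'] using hpW.2 (Sum.inr i) (by simp)
    have hps : p ∘ Sum.inl ∈ stdSimplex ℝ ι := by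
      refine ⟨fun i => hp.1 _, ?_⟩
      have := hp.2
      simpa [hp0] using this
    have := hmax (p ∘ Sum.inl) hps hpW.1
    simp only [pot, Fintype.sum_sum_type, m', hp0, Sum.elim_inl, Sum.elim_inr, Pi.zero_apply]
    simpa [pot] using this
  have := Opt.restrict hS.sub hinj hopt (by simp [m', hm.2])
  exact this

end

/-! ### Constrained maxima of the potential -/

theorem Constraints.isCompact_feasible {n : ℕ} (C : Constraints n) : IsCompact C.feasible := by
  have : C.feasible = stdSimplex ℝ (Fin n) ∩ ⋂ k, {p | ∑ i, C.obs k i * p i = C.val k} := by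
    ext p
    simp [Constraints.feasible]
  rw [this]
  exact (isCompact_stdSimplex ℝ (Fin n)).inter_right
    (isClosed_iInter fun k => isClosed_eq (by fun_prop) continuous_const)

/-- The differences of solutions of the constraints. -/
def Constraints.direction {n : ℕ} (C : Constraints n) : Submodule ℝ (Fin n → ℝ) where
  carrier := {d | ∀ k, ∑ i, C.obs k i * d i = 0}
  add_mem' := fun {a b} ha hb k => by simp [mul_add, Finset.sum_add_distrib, ha k, hb k]
  zero_mem' := fun k => by simp
  smul_mem' := fun c a ha k => by
    simp only [Pi.smul_apply, smul_eq_mul, mul_left_comm _ c, ← Finset.mul_sum, ha k, mul_zero]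

theorem Constraints.mem_feasible_iff {n : ℕ} {C : Constraints n} {m p : Fin n → ℝ}
    (hm : m ∈ C.feasible) :
    p ∈ C.feasible ↔ p ∈ stdSimplex ℝ (Fin n) ∧ p - m ∈ C.direction := by
  refine and_congr_right fun _ => forall_congr' fun k => ?_
  simp only [Pi.sub_apply, mul_sub, Finset.sum_sub_distrib, sub_eq_zero, hm.2 k]

/-- The potential as an entropy functional. -/
noncomputable def potEntropy (r : ℝ) : EntropyFunctional := fun _ p => pot r p

theorem exists_isMaxEnt {T : EntropyFunctional} (hT : IsContinuousEntropy T) {n : ℕ}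
    (C : Constraints n) (hne : C.feasible.Nonempty) : ∃ p, IsMaxEnt T C.feasible p := by
  obtain ⟨p, hp, hmax⟩ := C.isCompact_feasible.exists_isMaxOn hne ((hT n).mono fun p hp => hp.1)
  exact ⟨p, hp, fun q hq => hmax hq⟩

theorem isContinuousEntropy_potEntropy {r : ℝ} (hr : -1 < r) :
    IsContinuousEntropy (potEntropy r) := fun _ =>
  (continuousOn_pot hr).mono fun _ hp => hp.1

theorem isMaxEnt_of_potEntropy {S : EntropyFunctional} {r : ℝ} (hS : Admissible S)
    (hr : Linearizes (mean S) (powGen r) (Ioi 0)) {n : ℕ} {C : Constraints n} {p : Fin n → ℝ}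
    (hp : IsMaxEnt (potEntropy r) C.feasible p) : IsMaxEnt S C.feasible p := by
  -- `ent` numbers the states of `Fin n` by `Fin (Fintype.card (Fin n))`; generalizing n to k avoids
  -- casts.
  have key : ∀ k, k = Fintype.card (Fin n) → ∀ (C : Constraints k) (p : Fin k → ℝ),
      IsMaxEnt (potEntropy r) C.feasible p → IsMaxEnt S C.feasible p := by
    rintro _ rfl C p ⟨hp, hmax⟩
    let e := Fintype.equivFin (Fin n)
    have hP := comp_equiv_mem_stdSimplex hp.1 e
    have hpot : ∀ q : Fin _ → ℝ, pot r (q ∘ e) = pot r q := fun q =>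
      e.sum_comp fun i => powPot r (q i)
    have hcomp : ∀ q : Fin n → ℝ, (q ∘ e.symm) ∘ e = q := fun q => by ext i; simp
    have hopt : Opt S (p ∘ e) (C.direction.comap (LinearMap.funLeft ℝ ℝ e.symm)) := by
      refine Opt.of_isMax hS hr hP fun q hq hqW => ?_
      rw [hpot, ← hcomp q, hpot]
      refine hmax _ ((Constraints.mem_feasible_iff hp).2
        ⟨comp_equiv_mem_stdSimplex hq e.symm, ?_⟩)
      have h1 := Submodule.mem_comap.1 hqW
      have h2 : LinearMap.funLeft ℝ ℝ e.symm (q - p ∘ e) = q ∘ e.symm - p := by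
        ext i
        simp [LinearMap.funLeft_apply]
      rwa [h2] at h1
    refine ⟨hp, fun q hq => ?_⟩
    have hq' := (Constraints.mem_feasible_iff hp).1 hq
    have hQ := comp_equiv_mem_stdSimplex hq.1 e
    have := hopt.le (q ∘ e) hQ.1 (hQ.2.trans hP.2.symm) (by
      have h2 : LinearMap.funLeft ℝ ℝ e.symm (q ∘ e - p ∘ e) = q - p := by
        ext i
        simp [LinearMap.funLeft_apply]
      rw [Submodule.mem_comap, h2]
      exact hq'.2)
    have he : ∀ q : Fin _ → ℝ, (q ∘ e) ∘ (Fintype.equivFin (Fin n)).symm = q := fun q => by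
      ext i
      simp [e]
    simpa only [ent, hP.2, inv_one, one_smul, he] using this
  exact key n (Fintype.card_fin n).symm C p hp

/-- A MaxEnt distribution of the potential exists by compactness and is one for S; uniqueness for S
gives the other direction. -/
theorem equivalent_potEntropy {S : EntropyFunctional} (hS : Admissible S) :
    ∃ r, -1 < r ∧ Equivalent S (potEntropy r) := by
  obtain ⟨r, hr⟩ := (isWeightedMean_mean hS).exists_powGen
  have hr1 := neg_one_lt_of_linearizes hS hr
  refine ⟨r, hr1, fun n C p => ⟨fun hp => ?_, isMaxEnt_of_potEntropy hS hr⟩⟩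
  obtain ⟨m, hm⟩ := exists_isMaxEnt (isContinuousEntropy_potEntropy hr1) C ⟨p, hp.1⟩
  rwa [(hS.uniq n C ⟨p, hp.1⟩).unique hp (isMaxEnt_of_potEntropy hS hr hm)]

end MaxEntInference

namespace MaxEntInference

open Topology Filter Set

/-! ### Equivalent entropy functionals -/

theorem Equivalent.symm {S T : EntropyFunctional} (h : Equivalent S T) : Equivalent T S :=
  fun n C p => (h n C p).symm

theorem Equivalent.trans {S T R : EntropyFunctional} (h : Equivalent S T) (h' : Equivalent T R) :
    Equivalent S R :=
  fun n C p => (h n C p).trans (h' n C p)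

theorem equivalent_of_le_iff {S T : EntropyFunctional}
    (h : ∀ n, ∀ p ∈ stdSimplex ℝ (Fin n), ∀ q ∈ stdSimplex ℝ (Fin n),
      S n p ≤ S n q ↔ T n p ≤ T n q) : Equivalent S T := fun n _ _ =>
  and_congr_right fun hp => forall₂_congr fun p' hp' => h n p' hp'.1 _ hp.1

theorem sum_rpow_pos {ι : Type} [Fintype ι] {p : ι → ℝ} (hp : p ∈ stdSimplex ℝ ι) (q : ℝ) :
    0 < ∑ i, p i ^ q := by
  obtain ⟨i, -, hi⟩ : ∃ i ∈ Finset.univ, 0 < p i := by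
    by_contra! h
    linarith [Finset.sum_nonpos h, hp.2]
  exact Finset.sum_pos' (fun j _ => Real.rpow_nonneg (hp.1 j) q)
    ⟨i, Finset.mem_univ i, Real.rpow_pos_of_pos hi q⟩

theorem entropyPower_pos (q : ℝ) {n : ℕ} {p : Fin n → ℝ} (hp : p ∈ stdSimplex ℝ (Fin n)) :
    0 < entropyPower q n p := by
  unfold entropyPower
  split_ifs
  · exact Real.exp_pos _
  · exact Real.rpow_pos_of_pos (sum_rpow_pos hp q) _

theorem equivalent_comp_entropyPower (q : ℝ) {f : ℝ → ℝ} (hf : StrictMonoOn f (Ioi 0)) :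
    Equivalent (fun n p => f (entropyPower q n p)) (entropyPower q) :=
  equivalent_of_le_iff fun _ _ hp _ hp' =>
    hf.le_iff_le (entropyPower_pos q hp) (entropyPower_pos q hp')

theorem equivalent_entropyPower_one : Equivalent (entropyPower 1) shannonEntropy :=
  equivalent_of_le_iff fun n p _ p' _ => by simp [entropyPower]

theorem pot_zero_eq {n : ℕ} {p : Fin n → ℝ} (hp : p ∈ stdSimplex ℝ (Fin n)) :
    pot 0 p = shannonEntropy n p + 1 := by
  simp [pot, powPot, Finset.sum_add_distrib, shannonEntropy, hp.2]

theorem pot_eq {r : ℝ} (h : r ≠ 0) {ι : Type} [Fintype ι] {p : ι → ℝ}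
    (hp : p ∈ stdSimplex ℝ ι) : pot r p = (1 - (∑ i, p i ^ (r + 1)) / (r + 1)) / r := by
  simp [pot, powPot, h, ← Finset.sum_div, Finset.sum_sub_distrib, hp.2]

theorem equivalent_potEntropy_entropyPower {r : ℝ} (hr : -1 < r) :
    Equivalent (potEntropy r) (entropyPower (r + 1)) := by
  refine equivalent_of_le_iff fun n p hp p' hp' => ?_
  by_cases h : r = 0
  · subst h
    simp [potEntropy, pot_zero_eq hp, pot_zero_eq hp', entropyPower]
  have h1 : 0 < r + 1 := by linarith
  have hs := sum_rpow_pos hp (r + 1)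
  have hs' := sum_rpow_pos hp' (r + 1)
  simp only [potEntropy, pot_eq h hp, pot_eq h hp', entropyPower, add_eq_right, h, if_false,
    sub_add_cancel_right]
  rcases lt_or_gt_of_ne h with h | h
  · rw [div_le_div_right_of_neg h, sub_le_sub_iff_left, div_le_div_iff_of_pos_right h1,
      Real.rpow_le_rpow_iff hs.le hs'.le (by simpa using h)]
  · rw [div_le_div_iff_of_pos_right h, sub_le_sub_iff_left, div_le_div_iff_of_pos_right h1,
      Real.rpow_le_rpow_iff_of_neg hs hs' (by simpa using h)]

/-! ### The axioms for functionals equivalent to a potential -/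

theorem Constraints.convex_feasible {n : ℕ} (C : Constraints n) : Convex ℝ C.feasible := by
  intro p hp q hq a b ha hb hab
  refine ⟨convex_stdSimplex ℝ _ hp.1 hq.1 ha hb hab, fun k => ?_⟩
  simp only [Pi.add_apply, Pi.smul_apply, smul_eq_mul, mul_add, mul_left_comm _ a,
    mul_left_comm _ b, Finset.sum_add_distrib, ← Finset.mul_sum, hp.2 k, hq.2 k]
  rw [← add_mul, hab, one_mul]

theorem uniqueness_potEntropy {r : ℝ} (hr : -1 < r) : Uniqueness (potEntropy r) := by
  intro n C hne
  obtain ⟨p, hp⟩ := exists_isMaxEnt (isContinuousEntropy_potEntropy hr) C hne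
  refine ⟨p, hp, fun q hq => ?_⟩
  by_contra h
  have h2 : (0 : ℝ) < 1 / 2 := by norm_num
  have h3 := (strictConcaveOn_pot hr).2 hq.1.1.1 hp.1.1.1 h h2 h2 (by norm_num)
  have h4 := hp.2 _ (C.convex_feasible hq.1 hp.1 h2.le h2.le (by norm_num))
  have h5 := hq.2 _ hp.1
  simp only [potEntropy, smul_eq_mul] at h3 h4 h5
  linarith

theorem Equivalent.uniqueness {S T : EntropyFunctional} (h : Equivalent S T) (hT : Uniqueness T) :
    Uniqueness S := by
  intro n C hC
  obtain ⟨p, hp, hu⟩ := hT n C hC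
  exact ⟨p, (h n C p).2 hp, fun q hq => hu q ((h n C q).1 hq)⟩

/-- Sets described by finitely many linear equations on the simplex. -/
def IsFeasibleSet {n : ℕ} (A : Set (Fin n → ℝ)) : Prop := ∃ C : Constraints n, C.feasible = A

theorem isFeasibleSet_of {n : ℕ} {κ : Type} [Fintype κ] (obs : κ → Fin n → ℝ) (val : κ → ℝ)
    {A : Set (Fin n → ℝ)}
    (hA : ∀ p, p ∈ A ↔ p ∈ stdSimplex ℝ (Fin n) ∧ ∀ k, ∑ i, obs k i * p i = val k) :
    IsFeasibleSet A := by
  obtain ⟨C, hC⟩ := exists_constraints obs val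
  exact ⟨C, Set.ext fun p => (hC p).trans (hA p).symm⟩

theorem Equivalent.isMaxEnt_iff {S T : EntropyFunctional} (h : Equivalent S T) {n : ℕ}
    {A : Set (Fin n → ℝ)} (hA : IsFeasibleSet A) (p : Fin n → ℝ) :
    IsMaxEnt S A p ↔ IsMaxEnt T A p := by
  obtain ⟨C, rfl⟩ := hA
  exact h n C p

theorem Uniqueness.eq {S : EntropyFunctional} (h : Uniqueness S) {n : ℕ} {A : Set (Fin n → ℝ)}
    (hA : IsFeasibleSet A) {p q : Fin n → ℝ} (hp : IsMaxEnt S A p) (hq : IsMaxEnt S A q) :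
    p = q := by
  obtain ⟨C, rfl⟩ := hA
  exact (h n C ⟨p, hp.1⟩).unique hp hq

theorem isFeasibleSet_stdSimplex (n : ℕ) : IsFeasibleSet (stdSimplex ℝ (Fin n)) :=
  isFeasibleSet_of (κ := Empty) (fun k => k.elim) (fun k => k.elim) fun p => by simp

theorem isFeasibleSet_perm {n : ℕ} (σ : Equiv.Perm (Fin n)) (C : Constraints n) :
    IsFeasibleSet {x | x ∘ σ ∈ C.feasible} := by
  refine isFeasibleSet_of (fun k i => C.obs k (σ.symm i)) C.val fun p => ?_
  refine and_congr ⟨fun h => ?_, fun h => comp_equiv_mem_stdSimplex h σ⟩ (forall_congr' fun k => ?_)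
  · simpa [Function.comp_assoc] using comp_equiv_mem_stdSimplex h σ.symm
  · rw [← Equiv.sum_comp σ fun i => C.obs k (σ.symm i) * p i]
    simp

theorem Equivalent.permutationInvariance {S : EntropyFunctional} {r : ℝ}
    (h : Equivalent S (potEntropy r)) : PermutationInvariance S := by
  intro n σ C p hp
  rw [h] at hp
  rw [h.isMaxEnt_iff (isFeasibleSet_perm σ C)]
  refine ⟨by simpa [Function.comp_assoc] using hp.1, fun q hq => ?_⟩
  have h1 : pot r (q ∘ σ) = pot r q := Equiv.sum_comp σ fun i => powPot r (q i)
  have h2 : pot r (p ∘ σ.symm) = pot r p := Equiv.sum_comp σ.symm fun i => powPot r (p i)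
  have := hp.2 _ hq
  simp only [potEntropy, h1, h2] at this ⊢
  exact this

theorem Equivalent.maximality {S : EntropyFunctional} {r : ℝ} (hr : -1 < r)
    (h : Equivalent S (potEntropy r)) : Maximality S := by
  intro n hn
  rw [h.isMaxEnt_iff (isFeasibleSet_stdSimplex n)]
  have hn' : (0 : ℝ) < n := by exact_mod_cast hn
  have hpos : (0 : ℝ) < 1 / n := by positivity
  have hu : ∑ _i : Fin n, (1 / n : ℝ) = 1 := by simp [hn'.ne']
  refine ⟨⟨fun _ => hpos.le, hu⟩, fun q hq => ?_⟩
  have h1 := pot_sub_le hr (p := fun _ : Fin n => (1 / n : ℝ)) (fun _ => hpos) hq.1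
  rw [← Finset.sum_mul, Finset.sum_sub_distrib, hq.2, hu, sub_self, zero_mul] at h1
  exact sub_nonpos.1 h1

/-- On a block of mass m the potential is an increasing affine function (for m > 0) of the potential
of the conditional distribution. The converse half of the characterization rests on this. -/
theorem exists_pot_smul {r : ℝ} (hr : -1 < r) {m : ℝ} (hm : 0 ≤ m) : ∃ c : ℝ,
    ∀ {ι : Type} [Fintype ι] {q : ι → ℝ}, q ∈ stdSimplex ℝ ι →
      ∑ i, powPot r (m * q i) = m ^ (r + 1) * pot r q + c := by
  by_cases h : r = 0
  · subst h
    refine ⟨Real.negMulLog m, fun {ι} _ {q} hq => ?_⟩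
    simp only [pot, powPot, if_true, Real.negMulLog_mul, Finset.sum_add_distrib, ← Finset.mul_sum,
      ← Finset.sum_mul, hq.2, zero_add, Real.rpow_one]
    ring
  · refine ⟨(m - m ^ (r + 1)) / r, fun {ι} _ {q} hq => ?_⟩
    have e : ∀ i, (m * q i) ^ (r + 1) = m ^ (r + 1) * q i ^ (r + 1) := fun i =>
      Real.mul_rpow hm (hq.1 i)
    rw [pot_eq h hq]
    simp only [powPot, h, if_false, e, ← Finset.sum_div, Finset.sum_sub_distrib, ← Finset.mul_sum,
      hq.2, mul_one]
    have : r + 1 ≠ 0 := by linarith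
    field_simp
    ring

theorem exists_obs {n : ℕ} {X : Type} [Fintype X] (j : X → Fin n) (g : X → ℝ) :
    ∃ obs : Fin n → ℝ, ∀ p : Fin n → ℝ, ∑ i, obs i * p i = ∑ x, g x * p (j x) := by
  refine ⟨fun i => ∑ x, if j x = i then g x else 0, fun p => ?_⟩
  simp only [Finset.sum_mul]
  rw [Finset.sum_comm]
  simp

theorem isFeasibleSet_of_sums {n : ℕ} {κ : Type} [Fintype κ] {X : κ → Type}
    [∀ k, Fintype (X k)] (j : ∀ k, X k → Fin n) (g : ∀ k, X k → ℝ) (val : κ → ℝ)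
    {A : Set (Fin n → ℝ)} (hA : ∀ p, p ∈ A ↔ p ∈ stdSimplex ℝ (Fin n) ∧
      ∀ k, ∑ x, g k x * p (j k x) = val k) : IsFeasibleSet A := by
  choose obs hobs using fun k => exists_obs (j k) (g k)
  exact isFeasibleSet_of obs val fun p => by simp only [hA p, hobs]

/-- Equivalence compares maximizers only on linear slices, so the block conditions must be put in
that form. Multiplying by m k linearizes them; for m k ≤ 0 the trivial equation 0 = 0 is used. -/
theorem isFeasibleSet_blockFeasible {n K : ℕ} {a : Fin K → ℕ} (e : (Σ k, Fin (a k)) ≃ Fin n)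
    (C : (k : Fin K) → Constraints (a k)) (m : Fin K → ℝ) : IsFeasibleSet (blockFeasible e C m) := by
  classical
  refine isFeasibleSet_of_sums (κ := Fin K ⊕ Σ k, Fin (C k).num)
    (X := fun s => Fin (a (s.elim id Sigma.fst)))
    (fun s i => e ⟨_, i⟩)
    (fun s => match s with
      | Sum.inl _ => fun _ => 1
      | Sum.inr s => fun i => if 0 < m s.1 then (C s.1).obs s.2 i else 0)
    (Sum.elim m fun s => if 0 < m s.1 then m s.1 * (C s.1).val s.2 else 0) fun p => ?_
  refine and_congr_right fun hp => ?_
  rw [Sum.forall, Sigma.forall, forall_and]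
  have hl : (∀ k, ∑ i, p (e ⟨k, i⟩) = m k) ↔
      ∀ k : Fin K, ∑ i : Fin (a k), 1 * p (e ⟨k, i⟩) = m k := by simp
  rw [hl]
  refine and_congr_right fun h1 => forall_congr' fun k => ?_
  simp only [one_mul] at h1
  by_cases hk : 0 < m k
  · have hsimp : (fun i => p (e ⟨k, i⟩) / m k) ∈ stdSimplex ℝ (Fin (a k)) :=
      ⟨fun i => div_nonneg (hp.1 _) hk.le, by rw [← Finset.sum_div, h1, div_self hk.ne']⟩
    refine (forall_prop_of_true hk).trans ((and_iff_right hsimp).trans (forall_congr' fun l => ?_))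
    have h2 : ∑ i, (C k).obs l i * (p (e ⟨k, i⟩) / m k) = (C k).val l ↔
        ∑ i, (C k).obs l i * p (e ⟨k, i⟩) = m k * (C k).val l := by
      simp only [mul_div_assoc', ← Finset.sum_div]
      rw [div_eq_iff hk.ne', mul_comm]
    simp only [Sum.elim_inr, hk, if_true]
    exact h2
  · simp [hk]

/-- Replacing the conditional distribution on block k by a competitor changes only that block's part
of the potential, to which `exists_pot_smul` applies. -/
theorem Equivalent.subsetIndependence {S : EntropyFunctional} {r : ℝ} (hr : -1 < r)
    (h : Equivalent S (potEntropy r)) : SubsetIndependence S := by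
  classical
  intro n K a e C m p hp k hk
  rw [h.isMaxEnt_iff (isFeasibleSet_blockFeasible e C m)] at hp
  rw [h]
  obtain ⟨⟨hps, hpC⟩, hmax⟩ := hp
  refine ⟨(hpC k).2 hk, fun q hq => ?_⟩
  let p' : Fin n → ℝ := fun i => if h : (e.symm i).1 = k then m k * q (h ▸ (e.symm i).2) else p i
  have hp'k : ∀ i, p' (e ⟨k, i⟩) = m k * q i := by
    intro i
    have : ∀ s : Σ k, Fin (a k), s = ⟨k, i⟩ → ∀ h : s.1 = k, q (h ▸ s.2) = q i := by
      rintro _ rfl h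
      rfl
    have h1 : (e.symm (e ⟨k, i⟩)).1 = k := by simp
    simp only [p', h1, dif_pos]
    rw [this _ (by simp)]
  have hp'l : ∀ l, l ≠ k → ∀ i, p' (e ⟨l, i⟩) = p (e ⟨l, i⟩) := by
    intro l hl i
    have h1 : (e.symm (e ⟨l, i⟩)).1 ≠ k := by simpa using hl
    simp only [p', h1, dif_neg, not_false_eq_true]
  have hdecomp : ∀ f : Fin n → ℝ, ∑ i, f i = ∑ l, ∑ i, f (e ⟨l, i⟩) := fun f => by
    rw [← e.sum_comp, Fintype.sum_sigma]
  have hsum : ∀ l, ∑ i, p' (e ⟨l, i⟩) = m l := by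
    intro l
    by_cases hl : l = k
    · subst hl
      simp only [hp'k, ← Finset.mul_sum, hq.1.2, mul_one]
    · simp only [hp'l l hl, (hpC l).1]
  have hp' : p' ∈ blockFeasible e C m := by
    refine ⟨⟨fun i => ?_, ?_⟩, fun l => ⟨hsum l, fun hl0 => ?_⟩⟩
    · obtain ⟨⟨l, i⟩, rfl⟩ := e.surjective i
      by_cases hl : l = k
      · subst hl
        rw [hp'k]
        exact mul_nonneg hk.le (hq.1.1 i)
      · rw [hp'l l hl]
        exact hps.1 _
    · rw [hdecomp, ← hps.2, hdecomp p]
      exact Finset.sum_congr rfl fun l _ => (hsum l).trans (hpC l).1.symm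
    · by_cases hl : l = k
      · subst hl
        simpa only [hp'k, mul_div_cancel_left₀ _ hk.ne'] using hq
      · simpa only [hp'l l hl] using (hpC l).2 hl0
  have h1 := hmax p' hp'
  simp only [potEntropy, pot] at h1
  rw [hdecomp, hdecomp fun i => powPot r (p i), ← Finset.add_sum_erase _ _ (Finset.mem_univ k),
    ← Finset.add_sum_erase _ (fun l => ∑ i, powPot r (p (e ⟨l, i⟩))) (Finset.mem_univ k)] at h1
  have h2 : ∑ l ∈ Finset.univ.erase k, ∑ i, powPot r (p' (e ⟨l, i⟩))
      = ∑ l ∈ Finset.univ.erase k, ∑ i, powPot r (p (e ⟨l, i⟩)) :=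
    Finset.sum_congr rfl fun l hl => by simp only [hp'l l (Finset.ne_of_mem_erase hl)]
  rw [h2] at h1
  have h3 := le_of_add_le_add_right h1
  obtain ⟨c, hc⟩ := exists_pot_smul hr hk.le
  have e1 : ∑ i, powPot r (p' (e ⟨k, i⟩)) = m k ^ (r + 1) * pot r q + c := by
    simp only [hp'k, hc hq.1]
  have e2 : ∑ i, powPot r (p (e ⟨k, i⟩))
      = m k ^ (r + 1) * pot r (fun i => p (e ⟨k, i⟩) / m k) + c := by
    rw [← hc ((hpC k).2 hk).1]
    simp only [mul_div_cancel₀ _ hk.ne']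
  rw [e1, e2] at h3
  exact le_of_mul_le_mul_left (le_of_add_le_add_right h3) (Real.rpow_pos_of_pos hk _)

end MaxEntInference

namespace MaxEntInference

open Topology Filter Set

/-! ### Two systems -/

section
variable {n m N : ℕ} {e : Fin n × Fin m ≃ Fin N} {C : Constraints n} {D : Constraints m}
  {S T : EntropyFunctional} {r : ℝ}

theorem sum_eq_sum_marginalFst (e : Fin n × Fin m ≃ Fin N) (p : Fin N → ℝ) :
    ∑ i, p i = ∑ i, marginalFst e p i := by
  rw [← e.sum_comp, Fintype.sum_prod_type]
  rfl

theorem marginalSnd_eq (e : Fin n × Fin m ≃ Fin N) (p : Fin N → ℝ) :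
    marginalSnd e p = marginalFst ((Equiv.prodComm _ _).trans e) p := rfl

theorem productDist_swap (e : Fin n × Fin m ≃ Fin N) (u : Fin n → ℝ) (v : Fin m → ℝ) :
    productDist ((Equiv.prodComm _ _).trans e) v u = productDist e u v := by
  ext s
  exact mul_comm _ _

theorem productDist_apply (e : Fin n × Fin m ≃ Fin N) (u : Fin n → ℝ) (v : Fin m → ℝ) (i : Fin n)
    (j : Fin m) : productDist e u v (e (i, j)) = u i * v j := by
  simp [productDist]

theorem marginalFst_mem {p : Fin N → ℝ} (hp : p ∈ stdSimplex ℝ (Fin N)) :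
    marginalFst e p ∈ stdSimplex ℝ (Fin n) :=
  ⟨fun _ => Finset.sum_nonneg fun _ _ => hp.1 _, by rw [← sum_eq_sum_marginalFst, hp.2]⟩

theorem marginalFst_productDist (u : Fin n → ℝ) {v : Fin m → ℝ}
    (hv : v ∈ stdSimplex ℝ (Fin m)) : marginalFst e (productDist e u v) = u := by
  ext i
  simp only [marginalFst, productDist_apply, ← Finset.mul_sum, hv.2, mul_one]

theorem marginalSnd_productDist {u : Fin n → ℝ} (hu : u ∈ stdSimplex ℝ (Fin n))
    (v : Fin m → ℝ) : marginalSnd e (productDist e u v) = v := by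
  rw [marginalSnd_eq, ← productDist_swap, marginalFst_productDist _ hu]

theorem productDist_mem {u : Fin n → ℝ} {v : Fin m → ℝ} (hu : u ∈ stdSimplex ℝ (Fin n))
    (hv : v ∈ stdSimplex ℝ (Fin m)) : productDist e u v ∈ stdSimplex ℝ (Fin N) := by
  refine ⟨fun s => mul_nonneg (hu.1 _) (hv.1 _), ?_⟩
  rw [sum_eq_sum_marginalFst e, marginalFst_productDist u hv, hu.2]

theorem mem_jointFeasible_iff {p : Fin N → ℝ} : p ∈ jointFeasible e C D ↔
    p ∈ stdSimplex ℝ (Fin N) ∧ marginalFst e p ∈ C.feasible ∧ marginalSnd e p ∈ D.feasible := by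
  refine and_congr_right fun hp => and_congr ?_ ?_
  · refine Iff.trans ?_ (and_iff_right (marginalFst_mem hp)).symm
    simp only [marginalFst, Finset.mul_sum]
  · rw [marginalSnd_eq]
    refine Iff.trans ?_ (and_iff_right (marginalFst_mem hp)).symm
    refine forall_congr' fun k => ?_
    rw [Finset.sum_comm]
    simp only [marginalFst, Finset.mul_sum]
    rfl

theorem isFeasibleSet_jointFeasible : IsFeasibleSet (jointFeasible e C D) := by
  refine isFeasibleSet_of_sums (κ := Fin C.num ⊕ Fin D.num) (X := fun _ => Fin n × Fin m)
    (fun _ => e) (fun k x => k.elim (fun k => C.obs k x.1) fun k => D.obs k x.2)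
    (Sum.elim C.val D.val) fun p => ?_
  refine and_congr_right fun _ => ?_
  simp only [Sum.forall, Sum.elim_inl, Sum.elim_inr, Fintype.sum_prod_type]

/-- With b fixed, being a product with second factor b is linear in p: p (i, j) equals b j times the
first marginal at i. -/
theorem isFeasibleSet_productDist {b : Fin m → ℝ} (hb : b ∈ stdSimplex ℝ (Fin m)) :
    IsFeasibleSet ((fun x => productDist e x b) '' C.feasible) := by
  classical
  refine isFeasibleSet_of_sums (κ := Fin C.num ⊕ (Fin n × Fin m)) (X := fun _ => Fin n × Fin m)
    (fun _ => e) (fun k x => k.elim (fun k => C.obs k x.1)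
      fun s => (if x = s then 1 else 0) - if x.1 = s.1 then b s.2 else 0)
    (Sum.elim C.val 0) fun p => ?_
  have h1 : ∀ k, ∑ x : Fin n × Fin m, C.obs k x.1 * p (e x)
      = ∑ i, C.obs k i * marginalFst e p i := fun k => by
    simp only [Fintype.sum_prod_type, marginalFst, Finset.mul_sum]
  have h2 : ∀ s : Fin n × Fin m, ∑ x : Fin n × Fin m,
      ((if x = s then 1 else 0) - if x.1 = s.1 then b s.2 else 0) * p (e x)
        = p (e s) - marginalFst e p s.1 * b s.2 := by
    rintro ⟨i, j⟩
    simp only [sub_mul, Finset.sum_sub_distrib, ite_mul, one_mul, zero_mul, Finset.sum_ite_eq',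
      Finset.mem_univ, if_true, Fintype.sum_prod_type]
    rw [Finset.sum_eq_single i (fun i' _ h => by simp [h]) (by simp)]
    simp [marginalFst, Finset.mul_sum, mul_comm]
  simp only [Sum.forall, Sum.elim_inl, Sum.elim_inr, h1, h2, Pi.zero_apply, sub_eq_zero]
  constructor
  · rintro ⟨x, hx, rfl⟩
    rw [marginalFst_productDist x hb]
    exact ⟨productDist_mem hx.1 hb, hx.2, fun s => productDist_apply e x b s.1 s.2⟩
  · rintro ⟨hp, hC, hpb⟩
    refine ⟨marginalFst e p, ⟨marginalFst_mem hp, hC⟩, ?_⟩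
    ext s
    obtain ⟨x, rfl⟩ := e.surjective s
    rw [hpb]
    exact productDist_apply e _ b x.1 x.2

theorem pot_productDist (hr : -1 < r) (e : Fin n × Fin m ≃ Fin N) {b : Fin m → ℝ}
    (hb : b ∈ stdSimplex ℝ (Fin m)) : ∃ c, ∀ x ∈ stdSimplex ℝ (Fin n),
      pot r (productDist e x b) = (∑ j, b j ^ (r + 1)) * pot r x + c := by
  choose c hc using fun j => exists_pot_smul hr (hb.1 j)
  refine ⟨∑ j, c j, fun x hx => ?_⟩
  rw [pot, ← e.sum_comp, Fintype.sum_prod_type, Finset.sum_comm, Finset.sum_mul,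
    ← Finset.sum_add_distrib]
  refine Finset.sum_congr rfl fun j _ => ?_
  rw [← hc j hx]
  simp only [productDist_apply, mul_comm]

theorem Equivalent.isMaxEnt_productDist (hr : -1 < r) (h : Equivalent S (potEntropy r))
    {u : Fin n → ℝ} (hu : IsMaxEnt S C.feasible u) {b : Fin m → ℝ}
    (hb : b ∈ stdSimplex ℝ (Fin m)) :
    IsMaxEnt S ((fun x => productDist e x b) '' C.feasible) (productDist e u b) := by
  rw [h.isMaxEnt_iff (isFeasibleSet_productDist hb)]
  rw [h] at hu
  refine ⟨⟨u, hu.1, rfl⟩, ?_⟩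
  rintro _ ⟨x, hx, rfl⟩
  obtain ⟨c, hc⟩ := pot_productDist hr e hb
  simp only [potEntropy, hc x hx.1, hc u hu.1.1]
  gcongr
  · exact (sum_rpow_pos hb _).le
  · exact hu.2 x hx

/-- Independence is not a linear constraint, and the order of values of S is known only through
linear slices. A product a ⊗ b is therefore compared with u ⊗ b and then with u ⊗ v, one factor
being fixed each time; in case of equality, uniqueness in both slices gives a ⊗ b = u ⊗ v. -/
theorem Equivalent.systemIndependence (hr : -1 < r) (h : Equivalent S (potEntropy r)) :
    SystemIndependence S := by
  intro n m N e C D u v hu hv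
  have hunique := h.uniqueness (uniqueness_potEntropy hr)
  have h1 := fun {b} (hb : b ∈ stdSimplex ℝ (Fin m)) =>
    h.isMaxEnt_productDist hr (e := e) hu hb
  have h2 := h.isMaxEnt_productDist hr (e := (Equiv.prodComm _ _).trans e) hv hu.1.1
  simp only [productDist_swap] at h2
  have hle : ∀ a ∈ C.feasible, ∀ b ∈ D.feasible,
      S N (productDist e a b) ≤ S N (productDist e u b) ∧
        S N (productDist e u b) ≤ S N (productDist e u v) := fun a ha b hb =>
    ⟨(h1 hb.1).2 _ ⟨a, ha, rfl⟩, h2.2 _ ⟨b, hb, rfl⟩⟩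
  have huv : productDist e u v ∈ jointFeasible e C D ∩ independentJoint e := by
    refine ⟨mem_jointFeasible_iff.2 ⟨productDist_mem hu.1.1 hv.1.1, ?_, ?_⟩, ?_⟩
    · rw [marginalFst_productDist u hv.1.1]
      exact hu.1
    · rw [marginalSnd_productDist hu.1.1]
      exact hv.1
    · change _ = _
      rw [marginalFst_productDist u hv.1.1, marginalSnd_productDist hu.1.1]
  intro p
  constructor
  · rintro ⟨⟨hp, hind⟩, hmax⟩
    obtain ⟨-, ha, hb⟩ := mem_jointFeasible_iff.1 hp
    have h3 := hle _ ha _ hb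
    have h4 := hmax _ huv
    have hind' : p = productDist e (marginalFst e p) (marginalSnd e p) := hind
    rw [hind'] at h4 ⊢
    generalize marginalFst e p = a at *
    generalize marginalSnd e p = b at *
    refine (hunique.eq (isFeasibleSet_productDist hb.1) ⟨⟨a, ha, rfl⟩, ?_⟩ (h1 hb.1)).trans
      (hunique.eq ?_ (A := (fun x => productDist e u x) '' D.feasible) ⟨⟨b, hb, rfl⟩, ?_⟩ h2)
    · intro x hx
      exact ((h1 hb.1).2 x hx).trans (h3.2.trans h4)
    · have := isFeasibleSet_productDist (e := (Equiv.prodComm _ _).trans e) (C := D) hu.1.1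
      simpa only [productDist_swap] using this
    · intro x hx
      exact (h2.2 x hx).trans (h4.trans h3.1)
  · rintro rfl
    refine ⟨huv, fun q hq => ?_⟩
    obtain ⟨hq1, hq2⟩ := hq
    obtain ⟨-, ha, hb⟩ := mem_jointFeasible_iff.1 hq1
    have h3 := hle _ ha _ hb
    have hq2' : q = productDist e (marginalFst e q) (marginalSnd e q) := hq2
    rw [hq2']
    exact h3.1.trans h3.2

theorem Equivalent.shoreJohnson (hr : -1 < r) (h : Equivalent S (potEntropy r)) :
    ShoreJohnson S where
  uniqueness := h.uniqueness (uniqueness_potEntropy hr)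
  permutation := h.permutationInvariance
  subset := h.subsetIndependence hr
  system := h.systemIndependence hr
  maximality := h.maximality hr

/-! ### Strong system independence -/

theorem Equivalent.strongSystemIndependence (h : Equivalent S T)
    (hT : StrongSystemIndependence T) : StrongSystemIndependence S := by
  intro n m N e C D u v hu hv p
  rw [h.isMaxEnt_iff isFeasibleSet_jointFeasible]
  exact hT n m N e C D u v ((h _ _ _).1 hu) ((h _ _ _).1 hv) p

theorem negMulLog_le_cross {p c : ℝ} (hp : 0 ≤ p) (hc : 0 ≤ c) (h : c = 0 → p = 0) :
    Real.negMulLog p ≤ -(p * Real.log c) + c - p := by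
  rcases hp.eq_or_lt with rfl | hp
  · simpa using hc
  have hc' : 0 < c := lt_of_le_of_ne hc fun h' => hp.ne' (h h'.symm)
  have h1 := mul_le_mul_of_nonneg_left (Real.log_le_sub_one_of_pos (div_pos hc' hp)) hp.le
  rw [Real.log_div hc'.ne' hp.ne', mul_sub, mul_sub, mul_div_cancel₀ _ hp.ne'] at h1
  rw [Real.negMulLog]
  linarith

/-- Gibbs' inequality against the product of the marginals, summed over all states. -/
theorem shannonEntropy_le_marginals {p : Fin N → ℝ} (hp : p ∈ stdSimplex ℝ (Fin N)) :
    shannonEntropy N p ≤ shannonEntropy n (marginalFst e p)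
      + shannonEntropy m (marginalSnd e p) := by
  set a := marginalFst e p with ha
  set b := marginalSnd e p with hb
  have ha' : a ∈ stdSimplex ℝ (Fin n) := marginalFst_mem hp
  have hb' : b ∈ stdSimplex ℝ (Fin m) := marginalFst_mem (e := (Equiv.prodComm _ _).trans e) hp
  have ha0 : ∀ i j, a i = 0 → p (e (i, j)) = 0 := fun i j h =>
    (Finset.sum_eq_zero_iff_of_nonneg fun j _ => hp.1 _).1 h j (Finset.mem_univ j)
  have hb0 : ∀ i j, b j = 0 → p (e (i, j)) = 0 := fun i j h =>
    (Finset.sum_eq_zero_iff_of_nonneg fun i _ => hp.1 _).1 h i (Finset.mem_univ i)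
  have hterm : ∀ i j, Real.negMulLog (p (e (i, j))) ≤
      -(p (e (i, j)) * Real.log (a i)) - p (e (i, j)) * Real.log (b j) + a i * b j - p (e (i, j)) := by
    intro i j
    refine (negMulLog_le_cross (hp.1 _) (mul_nonneg (ha'.1 i) (hb'.1 j)) fun h => ?_).trans_eq ?_
    · exact (mul_eq_zero.1 h).elim (ha0 i j) (hb0 i j)
    · by_cases h : p (e (i, j)) = 0
      · simp [h]
      · rw [Real.log_mul (fun h' => h (ha0 i j h')) (fun h' => h (hb0 i j h'))]
        ring
  rw [shannonEntropy, ← e.sum_comp, Fintype.sum_prod_type]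
  refine (Finset.sum_le_sum fun i _ => Finset.sum_le_sum fun j _ => hterm i j).trans_eq ?_
  have h1 : ∑ i, ∑ j, p (e (i, j)) * Real.log (a i) = ∑ i, a i * Real.log (a i) :=
    Finset.sum_congr rfl fun i _ => (Finset.sum_mul _ _ _).symm
  have h2 : ∑ i, ∑ j, p (e (i, j)) * Real.log (b j) = ∑ j, b j * Real.log (b j) := by
    rw [Finset.sum_comm]
    exact Finset.sum_congr rfl fun i _ => (Finset.sum_mul _ _ _).symm
  have h3 : ∑ i, ∑ j, a i * b j = 1 := by
    simp only [← Finset.mul_sum, hb'.2, mul_one, ha'.2]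
  have h4 : ∑ i, ∑ j, p (e (i, j)) = 1 := by
    rw [← ha'.2]
    rfl
  simp only [Finset.sum_sub_distrib, Finset.sum_add_distrib, Finset.sum_neg_distrib, h1, h2, h3, h4,
    shannonEntropy, Real.negMulLog, neg_mul]
  ring

theorem shannonEntropy_productDist {u : Fin n → ℝ} {v : Fin m → ℝ}
    (hu : u ∈ stdSimplex ℝ (Fin n)) (hv : v ∈ stdSimplex ℝ (Fin m)) :
    shannonEntropy N (productDist e u v) = shannonEntropy n u + shannonEntropy m v := by
  rw [shannonEntropy, ← e.sum_comp, Fintype.sum_prod_type]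
  simp only [productDist_apply, Real.negMulLog_mul, Finset.sum_add_distrib, ← Finset.sum_mul,
    ← Finset.mul_sum, hu.2, hv.2, one_mul, shannonEntropy]

theorem equivalent_shannonEntropy_potEntropy : Equivalent shannonEntropy (potEntropy 0) := by
  have h := equivalent_potEntropy_entropyPower (r := 0) (by norm_num)
  rw [zero_add] at h
  exact (h.trans equivalent_entropyPower_one).symm

theorem strongSystemIndependence_shannonEntropy : StrongSystemIndependence shannonEntropy := by
  intro n m N e C D u v hu hv p
  have huniq := equivalent_shannonEntropy_potEntropy.uniqueness
    (uniqueness_potEntropy (r := 0) (by norm_num))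
  have hmax : IsMaxEnt shannonEntropy (jointFeasible e C D) (productDist e u v) := by
    refine ⟨mem_jointFeasible_iff.2 ⟨productDist_mem hu.1.1 hv.1.1, ?_, ?_⟩, fun q hq => ?_⟩
    · rw [marginalFst_productDist u hv.1.1]
      exact hu.1
    · rw [marginalSnd_productDist hu.1.1]
      exact hv.1
    · obtain ⟨hq, ha, hb⟩ := mem_jointFeasible_iff.1 hq
      rw [shannonEntropy_productDist hu.1.1 hv.1.1]
      exact (shannonEntropy_le_marginals hq).trans (add_le_add (hu.2 _ ha) (hv.2 _ hb))
  exact ⟨fun hp => huniq.eq isFeasibleSet_jointFeasible hp hmax, fun h => h ▸ hmax⟩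

end

end MaxEntInference

namespace MaxEntInference

/-! ### Strong system independence singles out Shannon entropy -/

open Topology Filter Set

/-- This second difference is -(1/9)^r (2^r - 1)² / r. -/
theorem powGen_mix_ne {r : ℝ} (h : r ≠ 0) :
    powGen r (1 / 9) - powGen r (2 / 9) - powGen r (2 / 9) + powGen r (4 / 9) ≠ 0 := by
  have h2 : (2 / 9 : ℝ) ^ r = 2 ^ r * (1 / 9) ^ r := by
    rw [← Real.mul_rpow (by norm_num) (by norm_num)]
    norm_num
  have h4 : (4 / 9 : ℝ) ^ r = 2 ^ r * (2 ^ r * (1 / 9) ^ r) := by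
    rw [← Real.mul_rpow (by norm_num) (by norm_num), ← Real.mul_rpow (by norm_num) (by norm_num)]
    norm_num
  have h9 : (0 : ℝ) < (1 / 9) ^ r := Real.rpow_pos_of_pos (by norm_num) r
  have hne : (2 : ℝ) ^ r ≠ 1 := by
    rcases lt_or_gt_of_ne h with h | h
    · exact (Real.rpow_lt_one_of_one_lt_of_neg one_lt_two h).ne
    · exact (Real.one_lt_rpow one_lt_two h).ne'
  have e : powGen r (1 / 9) - powGen r (2 / 9) - powGen r (2 / 9) + powGen r (4 / 9)
      = -((1 / 9) ^ r * (2 ^ r - 1) ^ 2 / r) := by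
    simp only [powGen, h, if_false, h2, h4]
    field_simp
    ring
  rw [e]
  exact neg_ne_zero.2 (div_ne_zero (mul_ne_zero h9.ne' (pow_ne_zero 2 (sub_ne_zero.2 hne))) h)

/-- Constraints fixing both marginals to (1/3, 2/3) leave one free direction (+, -, -, +). The
product distribution is an interior point of that line, so its optimality would make the derivative
in `powGen_mix_ne` vanish. -/
theorem eq_zero_of_strongSystemIndependence {r : ℝ} (hr : -1 < r)
    (hS : StrongSystemIndependence (potEntropy r)) : r = 0 := by
  by_contra h
  let u : Fin 2 → ℝ := ![1 / 3, 2 / 3]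
  have hu : u ∈ stdSimplex ℝ (Fin 2) := by
    refine ⟨fun i => ?_, ?_⟩
    · fin_cases i <;> norm_num [u]
    · norm_num [u]
  let C : Constraints 2 := ⟨2, fun k i => if i = k then 1 else 0, u⟩
  have hC : C.feasible = {u} := by
    ext p
    simp only [Constraints.feasible, C, ite_mul, one_mul, zero_mul, Finset.sum_ite_eq',
      Finset.mem_univ, if_true, mem_ofPred_eq, mem_singleton_iff]
    exact ⟨fun hp => funext hp.2, fun hp => ⟨hp ▸ hu, fun k => hp ▸ rfl⟩⟩
  have hmax : IsMaxEnt (potEntropy r) C.feasible u := by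
    rw [hC]
    refine ⟨rfl, ?_⟩
    rintro _ rfl
    exact le_rfl
  let e : Fin 2 × Fin 2 ≃ Fin 4 := finProdFinEquiv
  obtain ⟨-, hm⟩ := (hS 2 2 4 e C C u u hmax hmax (productDist e u u)).2 rfl
  let g : ℝ → ℝ := fun t => powPot r (1 / 9 + t) + powPot r (2 / 9 - t)
    + (powPot r (2 / 9 - t) + powPot r (4 / 9 + t))
  have hpot : ∀ p : Fin 4 → ℝ, pot r p = powPot r (p (e (0, 0))) + powPot r (p (e (0, 1)))
      + (powPot r (p (e (1, 0))) + powPot r (p (e (1, 1)))) := by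
    intro p
    rw [pot, ← e.sum_comp, Fintype.sum_prod_type]
    simp [Fin.sum_univ_two]
  have hloc : IsLocalMax g 0 := by
    -- For t in this interval all four masses 1/9 + t, 2/9 - t, 2/9 - t, 4/9 + t are nonnegative.
    filter_upwards [Ioo_mem_nhds (show (-1 / 9 : ℝ) < 0 by norm_num)
      (show (0 : ℝ) < 2 / 9 by norm_num)] with t ht
    let p : Fin 4 → ℝ := fun s => productDist e u u s
      + t * (if (e.symm s).1 = (e.symm s).2 then 1 else -1)
    have hp : ∀ i j, p (e (i, j)) = u i * u j + t * (if i = j then 1 else -1) := fun i j => by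
      simp [p, productDist_apply]
    have hfst : marginalFst e p = u := by
      ext i
      fin_cases i <;> simp [marginalFst, hp, Fin.sum_univ_two, u] <;> ring
    have hsnd : marginalSnd e p = u := by
      ext i
      fin_cases i <;> simp [marginalSnd, hp, Fin.sum_univ_two, u] <;> ring
    have hps : p ∈ stdSimplex ℝ (Fin 4) := by
      refine ⟨fun s => ?_, by rw [sum_eq_sum_marginalFst e, hfst, hu.2]⟩
      obtain ⟨⟨i, j⟩, rfl⟩ := e.surjective s
      rw [hp]
      have := ht.1
      have := ht.2
      fin_cases i <;> fin_cases j <;> simp [u] <;> linarith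
    have := hm p (mem_jointFeasible_iff.2 ⟨hps, by rw [hfst]; exact hmax.1, by
      rw [hsnd]; exact hmax.1⟩)
    simp only [potEntropy, hpot, hp, productDist_apply] at this
    norm_num [u] at this
    norm_num [g]
    simpa only [sub_eq_add_neg] using this
  have hder : HasDerivAt g (powGen r (1 / 9) * 1 + powGen r (2 / 9) * -1
      + (powGen r (2 / 9) * -1 + powGen r (4 / 9) * 1)) 0 := by
    have key : ∀ a : ℝ, 0 < a → ∀ s : ℝ,
        HasDerivAt (fun t => powPot r (a + s * t)) (powGen r a * s) 0 := by
      intro a ha s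
      have h1 : HasDerivAt (fun t : ℝ => a + s * t) s 0 := by
        simpa using ((hasDerivAt_id (0 : ℝ)).const_mul s).const_add a
      refine HasDerivAt.comp (h₂ := powPot r) 0 ?_ h1
      simpa using hasDerivAt_powPot hr ha
    have hg : g = fun t => powPot r (1 / 9 + 1 * t) + powPot r (2 / 9 + -1 * t)
        + (powPot r (2 / 9 + -1 * t) + powPot r (4 / 9 + 1 * t)) := by
      ext t
      simp only [g]
      ring_nf
    rw [hg]
    exact ((key _ (by norm_num) 1).add (key _ (by norm_num) (-1))).add
      ((key _ (by norm_num) (-1)).add (key _ (by norm_num) 1))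
  have h0 := hloc.hasDerivAt_eq_zero hder
  refine powGen_mix_ne h ?_
  linarith

theorem strongSystemIndependence_entropyPower_iff {q : ℝ} (hq : 0 < q) :
    StrongSystemIndependence (entropyPower q) ↔ q = 1 := by
  constructor
  · intro h
    have hr : -1 < q - 1 := by linarith
    have he := equivalent_potEntropy_entropyPower hr
    rw [sub_add_cancel] at he
    linarith [eq_zero_of_strongSystemIndependence hr (he.strongSystemIndependence h)]
  · rintro rfl
    exact equivalent_entropyPower_one.strongSystemIndependence
      strongSystemIndependence_shannonEntropy

/-! ### The two characterizations -/

theorem shoreJohnson_iff {S : EntropyFunctional} (hS : IsContinuousEntropy S) :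
    ShoreJohnson S ↔ ∃ q : ℝ, 0 < q ∧ Equivalent S (entropyPower q) := by
  constructor
  · intro h
    obtain ⟨r, hr, he⟩ := equivalent_potEntropy ⟨hS, h.uniqueness, h.subset, h.maximality⟩
    exact ⟨r + 1, by linarith, he.trans (equivalent_potEntropy_entropyPower hr)⟩
  · rintro ⟨q, hq, h⟩
    have hr : -1 < q - 1 := by linarith
    have he := equivalent_potEntropy_entropyPower hr
    rw [sub_add_cancel] at he
    exact (h.trans he.symm).shoreJohnson hr

theorem shoreJohnson_and_strong_iff {S : EntropyFunctional} (hS : IsContinuousEntropy S) :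
    ShoreJohnson S ∧ StrongSystemIndependence S ↔ Equivalent S shannonEntropy := by
  constructor
  · rintro ⟨h, hs⟩
    obtain ⟨q, hq, he⟩ := (shoreJohnson_iff hS).1 h
    obtain rfl := (strongSystemIndependence_entropyPower_iff hq).1
      (he.symm.strongSystemIndependence hs)
    exact he.trans equivalent_entropyPower_one
  · intro h
    exact ⟨(h.trans equivalent_shannonEntropy_potEntropy).shoreJohnson (by norm_num),
      h.strongSystemIndependence strongSystemIndependence_shannonEntropy⟩

end MaxEntInference

theorem mainTheorem1 :
    (∀ S : MaxEntInference.EntropyFunctional, MaxEntInference.IsContinuousEntropy S →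
      (MaxEntInference.ShoreJohnson S ↔
        ∃ q : ℝ, 0 < q ∧ MaxEntInference.Equivalent S (MaxEntInference.entropyPower q))) ∧
    (∀ q : ℝ, 0 < q → ∀ f : ℝ → ℝ, StrictMonoOn f (Set.Ioi 0) →
      MaxEntInference.Equivalent (fun n p => f (MaxEntInference.entropyPower q n p))
        (MaxEntInference.entropyPower q)) ∧
    (∀ S : MaxEntInference.EntropyFunctional, MaxEntInference.IsContinuousEntropy S →
      (MaxEntInference.ShoreJohnson S ∧ MaxEntInference.StrongSystemIndependence S ↔
        MaxEntInference.Equivalent S MaxEntInference.shannonEntropy)) ∧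
    (∀ q : ℝ, 0 < q →
      (MaxEntInference.StrongSystemIndependence (MaxEntInference.entropyPower q) ↔ q = 1)) := by
  exact ⟨fun _ hS => MaxEntInference.shoreJohnson_iff hS,
    fun q _ _ hf => MaxEntInference.equivalent_comp_entropyPower q hf,
    fun _ hS => MaxEntInference.shoreJohnson_and_strong_iff hS,
    fun _ hq => MaxEntInference.strongSystemIndependence_entropyPower_iff hq⟩
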